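/- **Setting.** Let $\mathcal B\subset\mathbb R^3$ be a bounded, connected, nonempty open set with smooth boundary (the reference configuration of the satellite), $\rho_0\in C^\infty(\overline{\mathcal B})$ a density with $\rho_0>0$ on $\mathcal B$, $k,M>0$, and $W(x,F)$ a stored energy function, of class $C^2$ on $\overline{\mathcal B}\times\{\det F>0\}$, with $W(x,RF)=W(x,F)$ for all $R\in SO(3)$. Let $\mathcal Q$ be a Banach space of maps $\zeta:\overline{\mathcal B}\to\mathbb R^3$ of class $C^2$, continuously embedded in $C^1(\overline{\mathcal B})$ and stable under $\zeta\mapsto R\zeta$, $R\in SO(3)$. A planet of mass $M$ is fixed at the origin. A state $y=(\zeta,v)\in\mathcal Q\times\mathcal Q$ is *regular* if $\operatorname{dist}(\zeta(\mathcal B),0)>0$ and $\det D\zeta>0$ on $\overline{\mathcal B}$. Put $$V_g(\chi)=-\frac{kM}{|\chi|},\quad V^\zeta_{sg}(\chi)=-\int_{\mathcal B}\frac{k\rho_0(x)}{|\zeta(x)-\chi|}dx,\quad \mathbf L(\zeta,v)=\int_{\mathcal B}\zeta\times\rho_0v\,dx,$$ $$\mathcal H(\zeta,v)=\int_{\mathcal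 B}\Big[\tfrac12\rho_0|v|^2+\rho_0V_g(\zeta)+\tfrac12\rho_0V_{sg}^\zeta(\zeta)+W(x,D\zeta)\Big]dx .$$ Let $G=G(\zeta,v)$ be a nonconservative force (a map assigning a vector field on $\mathcal B$ to each pair $\zeta,v\in\mathcal Q$). A *solution* on $(0,T)$, $0<T\le\infty$, with datum $y_0\in\mathcal Q\times\mathcal Q$ is a $C^2$ curve $y=(\zeta,\dot\zeta):(0,T)\to\mathcal Q\times\mathcal Q$ of regular states with $y(t)\to y_0$ as $t\to0^+$, satisfying pointwise in $\mathcal B$ and on $\partial\mathcal B$ (outer normal $n$) respectively $$\rho_0\ddot\zeta=-\rho_0\nabla V_g(\zeta)-\rho_0\nabla V_{sg}^\zeta(\zeta)+\frac{\partial}{\partial x^a}\frac{\partial W}{\partial(\partial\zeta/\partial x^a)}-G(\zeta,\dot\zeta),\qquad \frac{\partial W}{\partial(\partial\zeta^j/\partial x^a)}n_a=0 .$$ It is *maximal* if it cannot be continued to a longer time interval; it *impacts the planet* if $\inf_{t}\operatorname{dist}(\zeta(\mathcal B,t),0)=0$; it is *bounded* if $\sup_{x,t}|\zeta(x,t)|<\infty$.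 Let $C=(D\zeta)^TD\zeta$. **Assumptions.** (i) The Cauchy problem is locally well-posed (existence on a common time interval, uniqueness, continuous dependence) for all regular data compatible with the boundary conditions, i.e. regular data lying in the closure in $\mathcal Q\times\mathcal Q$ of the set of states reached by solutions. (ii) Every maximal solution that does not impact the planet exists for all $t>0$. (iii) If a solution on $(0,\infty)$ is bounded and does not impact the planet, then for every increasing sequence of positive times $t_n$ a subsequence of $y(t_n)$ converges in $\mathcal Q\times\mathcal Q$ to a regular state. (iv) Along solutions $\mathbf L$ is conserved, $\mathcal H$ is differentiable in time with $\dot{\mathcal H}\le0$, and at each time $\dot{\mathcal H}=0$ if and only if $\dot C=0$ on $\mathcal B$; at the times when $\dot C=0$ on $\mathcal B$ one has $G(\zeta,\dot\zeta)=0$ on $\mathcal B$. **Relative equilibria.** A regular state $z$ (with momentum $\pi=\rho_0v$) is a *relative equilibrium* if $\mathcal H$ is critical at $z$ along the level set $\{\mathbf L=\mathbf L(z)\}$, i.e. $d\mathcal H(z)$ vanishes on $\ker d\mathbf L(z)$; equivalently the class of $z$ is a critical point of the reduced Hamiltonian on $\{\mathbf L=\mathbf L(z)\}/\mathcal G_{\mathbf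 L(z)}$, where $\mathcal G_{\mathbf L}=\{R\in SO(3):R\mathbf L=\mathbf L\}$. The number $\ell\geq 0$ is *nondegenerate* if for each relative equilibrium $z$ with $|\mathbf L(z)|=\ell$ there is a neighbourhood of $z$ in which all relative equilibria with angular momentum $\mathbf L(z)$ lie on the orbit $\mathcal G_{\mathbf L(z)}z$. A *synchronous non-dissipating orbit* is a solution of the form $t\mapsto R(t)z=(R(t)\zeta,R(t)v)$, where $z=(\zeta,v)$ and $R(t)=\exp(t\,\omega\times)$ for a fixed $\omega\in\mathbb R^3$; along it $\dot C=0$. **Theorem.** Under these assumptions let $y$ be a maximal solution with datum $y_0$, let $\mathbf L_0=\mathbf L(y_0)$ be its angular momentum, and suppose that $\ell=|\mathbf L_0|$ is nondegenerate. Then at least one of the following holds: (i) the trajectory of the body is unbounded; (ii) the solution impacts the planet; (iii) the solution exists for all $t>0$ and is asymptotic to a single synchronous non-dissipating orbit: there is a relative equilibrium $z$ with $\mathbf L(z)=\mathbf L_0$ such that $t\mapsto R(t)z$ is a synchronous non-dissipating orbit and $\operatorname{dist}(y(t),\mathcal G_{\mathbf L_0}z)\to0$ as $t\to+\infty$; if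 $\mathbf L_0\ne0$ then moreover $\operatorname{dist}(y(t),\{R(s)z:s\in\mathbb R\})\to0$, and the $\omega$-limit set of $y$ is exactly $\{R(s)z:s\in\mathbb R\}$. Moreover (iii) excludes (i), and, if the datum $y_0$ is regular, (iii) excludes (ii). -/

import Mathlib

open Set Filter Topology MeasureTheory
open scoped ContDiff

noncomputable section

namespace ElasticSatellite

/-- Physical space, with its Euclidean structure. The planet sits at the origin. -/
abbrev E3 : Type := EuclideanSpace ℝ (Fin 3)

/-- The cross product of `ℝ³`. -/
def cross (a b : E3) : E3 := WithLp.toLp 2 (crossProduct a.ofLp b.ofLp)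

/-- The rotation group `SO(3)`: linear isometries of determinant one. -/
def Rotation : Type := {R : E3 ≃ₗᵢ[ℝ] E3 // LinearMap.det (R.toLinearEquiv : E3 →ₗ[ℝ] E3) = 1}

/-- `n` is the outer unit normal at `x` to the smooth boundary of `B`: near `x` the set `B` is
`{g < 0}` for a smooth `g` without critical points, and `n = ∇g(x) / |∇g(x)|`. -/
def IsOuterNormal (B : Set E3) (x n : E3) : Prop :=
  ∃ (U : Set E3) (g : E3 → ℝ), IsOpen U ∧ x ∈ U ∧ ContDiffOn ℝ ∞ g U ∧
    (∀ z ∈ U, gradient g z ≠ 0) ∧ B ∩ U = {z ∈ U | g z < 0} ∧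
    n = ‖gradient g x‖⁻¹ • gradient g x

/-- The material data: reference body, reference density, stored energy function, gravitational
constant and mass of the planet. The stored energy is only meaningful at deformation gradients of
positive determinant. -/
structure Body where
  /-- reference configuration -/
  B : Set E3
  /-- reference density -/
  ρ : E3 → ℝ
  /-- stored energy function `W(x, F)` -/
  W : E3 → (E3 →L[ℝ] E3) → ℝ
  /-- gravitational constant -/
  k : ℝ
  /-- mass of the planet -/
  M : ℝ
  isOpen : IsOpen B
  isConnected : IsConnected B
  bounded : Bornology.IsBounded B
  smooth_boundary : ∀ x ∈ frontier B, ∃ n, IsOuterNormal B x n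
  ρ_smooth : ContDiffOn ℝ ∞ ρ (closure B)
  ρ_pos : ∀ x ∈ B, 0 < ρ x
  W_smooth : ContDiffOn ℝ 2 (fun p : E3 × (E3 →L[ℝ] E3) => W p.1 p.2)
    (closure B ×ˢ {F : E3 →L[ℝ] E3 | 0 < F.det})
  W_frame : ∀ x ∈ B, ∀ F : E3 →L[ℝ] E3, 0 < F.det → ∀ R : Rotation,
    W x ((R.1.toContinuousLinearEquiv : E3 →L[ℝ] E3) ∘L F) = W x F
  k_pos : 0 < k
  M_pos : 0 < M

/-- A realization of the normed space `Q` as a space of maps from the body to `ℝ³`: its elements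
are (faithfully represented by) maps of class `C²` up to the boundary, the norm of `Q` dominates
the `C¹` norm, and `Q` is stable under `ζ ↦ R ζ`, `R ∈ SO(3)`. Only the values on the closed
reference body matter. -/
structure ConfigSpace (S : Body) (Q : Type*) [NormedAddCommGroup Q] [NormedSpace ℝ Q] where
  /-- the map represented by an element of `Q` -/
  ev : Q →ₗ[ℝ] (E3 → E3)
  ev_injective : ∀ ζ : Q, (∀ x ∈ S.B, ev ζ x = 0) → ζ = 0
  ev_smooth : ∀ ζ : Q, ContDiffOn ℝ 2 (ev ζ) (closure S.B)
  ev_bound : ∃ c : ℝ, ∀ ζ : Q, ∀ x ∈ closure S.B,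
    ‖ev ζ x‖ ≤ c * ‖ζ‖ ∧ ‖fderivWithin ℝ (ev ζ) (closure S.B) x‖ ≤ c * ‖ζ‖
  rotation_stable : ∀ (R : Rotation) (ζ : Q), ∃ ζ' : Q, ∀ x ∈ closure S.B, ev ζ' x = R.1 (ev ζ x)

namespace ConfigSpace

variable {S : Body} {Q : Type*} [NormedAddCommGroup Q] [NormedSpace ℝ Q] (C : ConfigSpace S Q)

/-- The action `ζ ↦ R ζ` of `SO(3)` on configurations. -/
def rot (R : Rotation) (ζ : Q) : Q := (C.rotation_stable R ζ).choose

/-- The diagonal action of `SO(3)` on states `(ζ, ζ')` (with momentum `π = ρ ζ'`, this is the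
action `(π, ζ) ↦ (R π, R ζ)`). -/
def rotState (R : Rotation) (y : Q × Q) : Q × Q := (C.rot R y.1, C.rot R y.2)

/-- The deformation gradient `Dζ(x)`, for `x` in the closed body. -/
def defGrad (ζ : Q) (x : E3) : E3 →L[ℝ] E3 := fderivWithin ℝ (C.ev ζ) (closure S.B) x

/-- The right Cauchy–Green tensor `(Dζ)ᵀ Dζ`. -/
def cauchyGreen (ζ : Q) (x : E3) : E3 →L[ℝ] E3 :=
  (ContinuousLinearMap.adjoint (C.defGrad ζ x)) ∘L (C.defGrad ζ x)

/-- A state `(ζ, ζ')` is regular if the body does not touch the planet and the configuration is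
non singular (up to the boundary). -/
def IsRegular (y : Q × Q) : Prop :=
  0 < Metric.infDist 0 (C.ev y.1 '' S.B) ∧ ∀ x ∈ closure S.B, 0 < (C.defGrad y.1 x).det

/-! ### Potentials, energy, angular momentum -/

/-- The potential of the planet. -/
def _root_.ElasticSatellite.Body.planetPotential (S : Body) (χ : E3) : ℝ := -(S.k * S.M) / ‖χ‖

/-- The gravitational potential generated by the satellite in the configuration `ζ`. -/
def selfPotential (ζ : Q) (χ : E3) : ℝ := -∫ x in S.B, S.k * S.ρ x / ‖C.ev ζ x - χ‖

/-- Kinetic energy. -/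
def kinetic (v : Q) : ℝ := (1 / 2) * ∫ x in S.B, S.ρ x * ‖C.ev v x‖ ^ 2

/-- Potential energy of the satellite in the field of the planet. -/
def planetEnergy (ζ : Q) : ℝ := ∫ x in S.B, S.ρ x * S.planetPotential (C.ev ζ x)

/-- Self-gravitational energy. The factor `1/2` makes its `L²` gradient equal to
`ρ ∇V_sg(ζ)`, as in the equations of motion: every pair of material points counts once. -/
def selfEnergy (ζ : Q) : ℝ := (1 / 2) * ∫ x in S.B, S.ρ x * C.selfPotential ζ (C.ev ζ x)

/-- Elastic (stored) energy. -/
def elasticEnergy (ζ : Q) : ℝ := ∫ x in S.B, S.W x (C.defGrad ζ x)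

/-- Total energy, i.e. the Hamiltonian, with the momentum written as `π = ρ ζ'`. -/
def energy (y : Q × Q) : ℝ :=
  C.kinetic y.2 + C.planetEnergy y.1 + C.selfEnergy y.1 + C.elasticEnergy y.1

/-- Total angular momentum with respect to the planet. -/
def angMom (y : Q × Q) : E3 := ∫ x in S.B, cross (C.ev y.1 x) (S.ρ x • C.ev y.2 x)

/-! ### Equations of motion -/

/-- The first Piola–Kirchhoff stress `∂W/∂(∂ζⁱ/∂xᵃ)`. -/
def piola (ζ : Q) (x : E3) (i a : Fin 3) : ℝ :=
  fderiv ℝ (S.W x) (C.defGrad ζ x)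
    ((EuclideanSpace.proj a : E3 →L[ℝ] ℝ).smulRight (EuclideanSpace.single i (1 : ℝ)))

/-- The elastic force `∂/∂xᵃ ∂W/∂(∂ζ/∂xᵃ)`. -/
def elasticForce (ζ : Q) (x : E3) : E3 :=
  WithLp.toLp 2 fun i => ∑ a, fderiv ℝ (fun z => C.piola ζ z i a) x (EuclideanSpace.single a 1)

/-- The stress free boundary condition. -/
def StressFree (ζ : Q) : Prop :=
  ∀ x ∈ frontier S.B, ∀ n, IsOuterNormal S.B x n → ∀ i, ∑ a, C.piola ζ x i a * n a = 0

/-- The interval `(0, T)` of times, where `T` may be infinite. -/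
def _root_.ElasticSatellite.times (T : EReal) : Set ℝ := {t | 0 < t ∧ (t : EReal) < T}

/-- `y = (ζ, ζ')` is a classical solution, on `(0, T)` and with initial datum `y₀`, of the
equations `ρ ζ'' = -ρ ∇V_g(ζ) - ρ ∇V_sg(ζ) + div ∂W/∂F - G(ζ, ζ')` with stress free boundary
conditions. The system is defined on regular states only, so that `y` takes its values there. -/
structure IsSolution (G : Q → Q → E3 → E3) (T : EReal) (y : ℝ → Q × Q) (y₀ : Q × Q) : Prop where
  pos : 0 < T
  smooth : ContDiffOn ℝ 2 y (times T)
  initial : Tendsto y (𝓝[>] 0) (𝓝 y₀)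
  regular : ∀ t ∈ times T, C.IsRegular (y t)
  velocity : ∀ t ∈ times T, HasDerivAt (fun s => (y s).1) (y t).2 t
  motion : ∀ t ∈ times T, ∀ x ∈ S.B,
    S.ρ x • C.ev (deriv (fun s => (y s).2) t) x =
      -(S.ρ x • gradient S.planetPotential (C.ev (y t).1 x))
      - S.ρ x • gradient (C.selfPotential (y t).1) (C.ev (y t).1 x)
      + C.elasticForce (y t).1 x - G (y t).1 (y t).2 x
  boundary : ∀ t ∈ times T, C.StressFree (y t).1

/-- A solution that cannot be continued to a longer interval of times. -/
def IsMaximalSolution (G : Q → Q → E3 → E3) (T : EReal) (y : ℝ → Q × Q) (y₀ : Q × Q) : Prop :=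
  C.IsSolution G T y y₀ ∧
    ∀ (T' : EReal) (u : ℝ → Q × Q), C.IsSolution G T' u y₀ → EqOn u y (times T ∩ times T') → T' ≤ T

/-- The solution impacts the planet: `inf_t dist(ζ(B, t), 0) = 0`. -/
def Impacts (T : EReal) (y : ℝ → Q × Q) : Prop :=
  ∀ ε > 0, ∃ t ∈ times T, Metric.infDist 0 (C.ev (y t).1 '' S.B) < ε

/-- The trajectory of the body is bounded: `sup_{x, t} |ζ(x, t)| < ∞`. -/
def BoundedTrajectory (T : EReal) (y : ℝ → Q × Q) : Prop :=
  ∃ r : ℝ, ∀ t ∈ times T, ∀ x ∈ S.B, ‖C.ev (y t).1 x‖ ≤ r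

/-- Precompactness of a trajectory defined for all positive times. -/
def Precompact (y : ℝ → Q × Q) : Prop :=
  ∀ τ : ℕ → ℝ, StrictMono τ → (∀ n, 0 < τ n) →
    ∃ φ : ℕ → ℕ, StrictMono φ ∧ ∃ z, C.IsRegular z ∧ Tendsto (fun n => y (τ (φ n))) atTop (𝓝 z)

/-- The time derivative of the Cauchy–Green tensor vanishes on the whole body at time `t`. -/
def ShapeStationaryAt (y : ℝ → Q × Q) (t : ℝ) : Prop :=
  ∀ x ∈ S.B, HasDerivAt (fun s => C.cauchyGreen (y s).1 x) 0 t

/-- The regular initial data that are limits, in `Q × Q`, of states reached by solutions. As a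
solution converges to its initial datum, and as the boundary condition is preserved by such limits,
only these data can be the initial datum of a solution: the other ones violate the compatibility
conditions between data and boundary conditions. -/
def admissibleData (G : Q → Q → E3 → E3) : Set (Q × Q) :=
  {z | C.IsRegular z} ∩
    closure {z | ∃ T y y₀, C.IsSolution G T y y₀ ∧ ∃ t ∈ times T, y t = z}

/-- Local well-posedness of the Cauchy problem at `y₀`: existence on a common interval of times,
uniqueness, continuous dependence on the datum. -/
def LocallyWellPosedAt (G : Q → Q → E3 → E3) (y₀ : Q × Q) : Prop :=
  ∃ T : ℝ, 0 < T ∧ ∃ φ : Q × Q → ℝ → Q × Q,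
    (∀ᶠ z in 𝓝[C.admissibleData G] y₀, C.IsSolution G T (φ z) z ∧
      ∀ (T' : EReal) (u : ℝ → Q × Q), C.IsSolution G T' u z → EqOn u (φ z) (times T ∩ times T')) ∧
    ∀ t ∈ times T, ContinuousWithinAt (fun z => φ z t) (C.admissibleData G) y₀

/-- The standing assumptions on the Cauchy problem and on the nonconservative force `G`. -/
structure Assumptions (G : Q → Q → E3 → E3) : Prop where
  /-- local well-posedness -/
  wellPosed : ∀ y₀ ∈ C.admissibleData G, C.LocallyWellPosedAt G y₀
  /-- non-impacting solutions exist, and are non singular, for all times -/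
  global : ∀ T y y₀, C.IsMaximalSolution G T y y₀ → ¬ C.Impacts T y → T = ⊤
  /-- regular bounded solutions are precompact -/
  precompact : ∀ y y₀, C.IsSolution G ⊤ y y₀ → ¬ C.Impacts ⊤ y → C.BoundedTrajectory ⊤ y →
    C.Precompact y
  /-- conservation of the angular momentum -/
  angMom_conserved : ∀ T y y₀, C.IsSolution G T y y₀ →
    ∀ s ∈ times T, ∀ t ∈ times T, C.angMom (y s) = C.angMom (y t)
  /-- the energy does not increase, and is dissipated exactly when the shape is changing -/
  dissipation : ∀ T y y₀, C.IsSolution G T y y₀ → ∀ t ∈ times T,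
    ∃ d : ℝ, HasDerivAt (fun s => C.energy (y s)) d t ∧ d ≤ 0 ∧ (d = 0 ↔ C.ShapeStationaryAt y t)
  /-- the nonconservative force vanishes when there is no dissipation: there the equations of
  motion coincide with the conservative ones -/
  conservative : ∀ T y y₀, C.IsSolution G T y y₀ → ∀ t ∈ times T, C.ShapeStationaryAt y t →
    ∀ x ∈ S.B, G (y t).1 (y t).2 x = 0

/-! ### Relative equilibria and nondegeneracy -/

/-- The orbit of `z` under the group of the rotations that leave its angular momentum fixed (the
rotations about the axis `L(z)`, if `L(z) ≠ 0`). -/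
def isotropyOrbit (z : Q × Q) : Set (Q × Q) :=
  {z' | ∃ R : Rotation, R.1 (C.angMom z) = C.angMom z ∧ z' = C.rotState R z}

/-- Relative equilibria of the Hamiltonian system: the Hamiltonian is critical at `z` along the
level set `{L = L(z)}`, whose tangent space is the kernel of `dL(z)`. As the Hamiltonian is
invariant, this says that the class of `z` is a critical point of the reduced Hamiltonian on the
quotient of `{L = L(z)}` by the rotations fixing `L(z)`. -/
def IsRelEquilibrium (z : Q × Q) : Prop :=
  C.IsRegular z ∧ ∀ δ : Q × Q, HasLineDerivAt ℝ C.angMom 0 z δ → HasLineDerivAt ℝ C.energy 0 z δ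

/-- The class of `z` in the reduced space is not an accumulation point of relative equilibria with
the same angular momentum. -/
def TopNondegenerate (z : Q × Q) : Prop :=
  ∀ᶠ z' in 𝓝 z, C.IsRelEquilibrium z' → C.angMom z' = C.angMom z → z' ∈ C.isotropyOrbit z

/-- The value `ℓ` of the modulus of the angular momentum is nondegenerate. -/
def NondegenerateModulus (l : ℝ) : Prop :=
  ∀ z, C.IsRelEquilibrium z → ‖C.angMom z‖ = l → C.TopNondegenerate z

/-! ### Synchronous orbits -/

/-- `R` is the uniform rotation about the origin with angular velocity `w`, starting at the
identity, i.e. `R(t) = exp(t w ×)`. -/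
def _root_.ElasticSatellite.IsUniformRotation (w : E3) (R : ℝ → Rotation) : Prop :=
  ∀ x, (R 0).1 x = x ∧ ∀ t, HasDerivAt (fun s => (R s).1 x) (cross w ((R t).1 x)) t

/-- The set of limits of `y(tₙ)` along sequences `tₙ → +∞`. -/
def _root_.ElasticSatellite.omegaLimitSet {Y : Type*} [TopologicalSpace Y] (y : ℝ → Y) : Set Y :=
  {z | ∃ τ : ℕ → ℝ, Tendsto τ atTop atTop ∧ Tendsto (fun n => y (τ n)) atTop (𝓝 z)}

/-- `t ↦ R(t) z` is a synchronous non-dissipating orbit with angular velocity `w`: it is a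
solution, along it the satellite rotates uniformly and rigidly about the planet, and its shape is
stationary. -/
def IsSynchronousOrbit (G : Q → Q → E3 → E3) (w : E3) (R : ℝ → Rotation) (z : Q × Q) : Prop :=
  IsUniformRotation w R ∧ C.IsSolution G ⊤ (fun t => C.rotState (R t) z) z ∧
    ∀ t, C.ShapeStationaryAt (fun s => C.rotState (R s) z) t

/-- The solution `y` is asymptotic to a single synchronous non-dissipating orbit, which is the orbit
of a relative equilibrium `z` with the angular momentum `L` of `y`: `y(t)` approaches the class of
`z` in the reduced space and, if `L ≠ 0`, it approaches the orbit `{R(t) z}`, which is exactly the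
limit set of `y`. -/
def AsymptoticToSynchronous (G : Q → Q → E3 → E3) (y : ℝ → Q × Q) (L : E3) : Prop :=
  ∃ (z : Q × Q) (w : E3) (R : ℝ → Rotation),
    C.IsRelEquilibrium z ∧ C.angMom z = L ∧ C.IsSynchronousOrbit G w R z ∧
    Tendsto (fun t => Metric.infDist (y t) (C.isotropyOrbit z)) atTop (𝓝 0) ∧
    (L ≠ 0 →
      Tendsto (fun t => Metric.infDist (y t) (range fun s => C.rotState (R s) z)) atTop (𝓝 0) ∧
      omegaLimitSet y = range fun s => C.rotState (R s) z)

end ConfigSpace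

end ElasticSatellite

end

open ElasticSatellite

noncomputable section

namespace ElasticSatellite

/-! ### The cross product -/

/-! The argument is LaSalle's invariance principle, completed by a mechanical identification of the
limit states.

A bounded solution without impact is global and precompact, so its ω-limit set is nonempty and
consists of regular states. The energy is nonincreasing in time and continuous at regular states, so
it takes a single value on the ω-limit set. Continuous dependence and uniqueness keep the local
solution issuing from a limit state inside that set (`Precompact.exists_local`). Its energy is
therefore constant, so its Cauchy–Green tensor is stationary and G vanishes along it.

Such a solution rotates uniformly about the planet (`IsSolution.exists_uniformRotation`). Equal
Cauchy–Green tensors give a rigid motion R(t)ζ + c(t). When the equations of motion at two times are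
compared, elastic and self-gravitational forces rotate with the body and cancel. What remains says
that, with d = R⁻¹c, the planet's field at X + d minus its value at X is affine in X on an open set,
which forces d = 0 (`eq_zero_of_planetField_sub_affine`). Then R'' = R N with N constant, and a
curve of rotations with this property has constant angular velocity w (`exists_eq_expCross`). The
equation of motion becomes a balance of forces in the rotating frame (`Balanced`). Paired with a
variation it reads dH = ⟨w, dL⟩, so the limit state is a relative equilibrium. Continuation in time
turns the local rotation into a solution on (0, ∞).

Two pieces of analysis support this. The virtual work of the stress needs a divergence theorem for
fields tangent to the boundary (`Body.integral_dvg_of_tangent`), obtained from cutoffs near the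
boundary. Self-gravity must be differentiated although configurations are only locally injective:
det Dζ > 0 bounds the image of Lebesgue measure, which makes |ζ(x) - χ|^(-5/2) integrable uniformly
in χ and in nearby ζ (`ConfigSpace.exists_tame`). This controls the remainder of the expansion of
1/|u|.

Finally, nondegeneracy and compactness isolate the isotropy orbit of a limit state z inside the
ω-limit set. If dist(y(t), orbit) did not tend to 0, by continuity it would take some fixed small
value δ > 0 at arbitrarily late times, and a limit state at distance δ would contradict the
isolation. If L ≠ 0, conservation of L makes w parallel to L, so the isotropy orbit is {R(s)z}, and
nonnegative times s already cover it. Conversely, a solution approaching the compact orbit of a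
regular state is bounded, and it stays away from the planet if its datum is regular. -/

lemma cross_apply_zero (a b : E3) : cross a b 0 = a 1 * b 2 - a 2 * b 1 := by
  simp [cross, cross_apply]

lemma cross_apply_one (a b : E3) : cross a b 1 = a 2 * b 0 - a 0 * b 2 := by
  simp [cross, cross_apply]

lemma cross_apply_two (a b : E3) : cross a b 2 = a 0 * b 1 - a 1 * b 0 := by
  simp [cross, cross_apply]

lemma inner_eq_sum (a b : E3) : inner ℝ a b = a 0 * b 0 + a 1 * b 1 + a 2 * b 2 := by
  simp [PiLp.inner_apply, Fin.sum_univ_three, mul_comm]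

lemma ext3 {a b : E3} (h0 : a 0 = b 0) (h1 : a 1 = b 1) (h2 : a 2 = b 2) : a = b := by
  ext i; fin_cases i <;> assumption

/-- The linear map `x ↦ w × x`. -/
def crossL (w : E3) : E3 →L[ℝ] E3 :=
  LinearMap.toContinuousLinearMap
    { toFun := cross w
      map_add' := fun a b => by
        apply ext3 <;> simp [cross_apply_zero, cross_apply_one, cross_apply_two] <;> ring
      map_smul' := fun c a => by
        apply ext3 <;> simp [cross_apply_zero, cross_apply_one, cross_apply_two] <;> ring }

@[simp] lemma crossL_apply (w x : E3) : crossL w x = cross w x := rfl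

lemma cross_add_right (w a b : E3) : cross w (a + b) = cross w a + cross w b := map_add (crossL w) a b

lemma cross_smul_right (w a : E3) (c : ℝ) : cross w (c • a) = c • cross w a :=
  map_smul (crossL w) c a

lemma cross_anticomm (a b : E3) : cross a b = -cross b a := by
  apply ext3 <;> simp only [PiLp.neg_apply, cross_apply_zero, cross_apply_one, cross_apply_two] <;>
    ring

lemma cross_smul_left (w a : E3) (c : ℝ) : cross (c • w) a = c • cross w a := by
  apply ext3 <;> simp [cross_apply_zero, cross_apply_one, cross_apply_two] <;> ring

lemma cross_add_left (v w a : E3) : cross (v + w) a = cross v a + cross w a := by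
  apply ext3 <;> simp [cross_apply_zero, cross_apply_one, cross_apply_two] <;> ring

@[simp] lemma cross_self (a : E3) : cross a a = 0 := by
  apply ext3 <;> simp [cross_apply_zero, cross_apply_one, cross_apply_two] <;> ring

@[simp] lemma cross_zero_left (a : E3) : cross 0 a = 0 := by
  apply ext3 <;> simp [cross_apply_zero, cross_apply_one, cross_apply_two]

@[simp] lemma cross_zero_right (a : E3) : cross a 0 = 0 := map_zero (crossL a)

lemma inner_cross_comm (a b c : E3) : inner ℝ (cross a b) c = inner ℝ a (cross b c) := by
  simp only [inner_eq_sum, cross_apply_zero, cross_apply_one, cross_apply_two]; ring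

lemma inner_cross_skew (w a b : E3) : inner ℝ (cross w a) b = -inner ℝ a (cross w b) := by
  simp only [inner_eq_sum, cross_apply_zero, cross_apply_one, cross_apply_two]; ring

lemma norm_sq_eq_sum (a : E3) : ‖a‖ ^ 2 = a 0 ^ 2 + a 1 ^ 2 + a 2 ^ 2 := by
  rw [← real_inner_self_eq_norm_sq, inner_eq_sum]; ring

/-- Lagrange's identity. -/
lemma norm_cross_sq (a b : E3) :
    ‖cross a b‖ ^ 2 + (inner ℝ a b) ^ 2 = ‖a‖ ^ 2 * ‖b‖ ^ 2 := by
  simp only [norm_sq_eq_sum, inner_eq_sum, cross_apply_zero, cross_apply_one, cross_apply_two]; ring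

lemma cross_cross_self (w a : E3) :
    cross w (cross w a) = inner ℝ w a • w - ‖w‖ ^ 2 • a := by
  apply ext3 <;>
    simp only [PiLp.sub_apply, PiLp.smul_apply, smul_eq_mul, norm_sq_eq_sum, inner_eq_sum,
      cross_apply_zero, cross_apply_one, cross_apply_two] <;> ring

/-- Skew-symmetric operators of `ℝ³` are cross products. -/
lemma exists_eq_crossL {A : E3 →L[ℝ] E3} (hA : ∀ a b, inner ℝ (A a) b = -inner ℝ a (A b)) :
    ∃ w, A = crossL w := by
  set e : Fin 3 → E3 := fun i => EuclideanSpace.single i 1 with he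
  have hi : ∀ (v : E3) i, inner ℝ v (e i) = v i := fun v i => by
    rw [he, EuclideanSpace.inner_single_right]; simp
  have hi' : ∀ (v : E3) i, inner ℝ (e i) v = v i := fun v i => by
    rw [real_inner_comm, hi]
  have hs : ∀ i j, A (e i) j = -A (e j) i := fun i j => by rw [← hi, hA, hi']
  have h00 : A (e 0) 0 = 0 := by linarith [hs 0 0]
  have h11 : A (e 1) 1 = 0 := by linarith [hs 1 1]
  have h22 : A (e 2) 2 = 0 := by linarith [hs 2 2]
  have h01 := hs 0 1
  have h02 := hs 0 2
  have h12 := hs 1 2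
  refine ⟨!₂[A (e 1) 2, A (e 2) 0, A (e 0) 1], ?_⟩
  ext1 x
  have hx : A x = x 0 • A (e 0) + x 1 • A (e 1) + x 2 • A (e 2) := by
    rw [← map_smul, ← map_smul, ← map_smul, ← map_add, ← map_add]
    congr 1
    apply ext3 <;> simp [he]
  rw [hx, crossL_apply]
  apply ext3 <;>
    simp only [PiLp.add_apply, PiLp.smul_apply, smul_eq_mul, cross_apply_zero, cross_apply_one,
      cross_apply_two, h00, h11, h22, h01, h02, h12] <;> simp <;> ring

lemma crossL_injective {v w : E3} (h : crossL v = crossL w) : v = w := by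
  have h1 : ∀ x, cross v x = cross w x := fun x => by simpa using congrArg (fun A => A x) h
  have h2 := h1 (EuclideanSpace.single 0 1)
  have h3 := h1 (EuclideanSpace.single 1 1)
  have a := congrArg (fun u : E3 => u 1) h2
  have b := congrArg (fun u : E3 => u 2) h2
  have c := congrArg (fun u : E3 => u 2) h3
  simp [cross_apply_one, cross_apply_two] at a b c
  exact ext3 c b a

/-! ### Rotations -/

/-- A rotation as a continuous linear map. -/
def Rotation.clm (R : Rotation) : E3 →L[ℝ] E3 := (R.1.toContinuousLinearEquiv : E3 →L[ℝ] E3)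

@[simp] lemma Rotation.clm_apply (R : Rotation) (x : E3) : R.clm x = R.1 x := rfl

lemma Rotation.det_clm (R : Rotation) : R.clm.det = 1 := R.2

lemma Rotation.inner_map (R : Rotation) (a b : E3) : inner ℝ (R.1 a) (R.1 b) = inner ℝ a b :=
  R.1.inner_map_map a b

lemma Rotation.ext {R R' : Rotation} (h : R.clm = R'.clm) : R = R' := by
  apply Subtype.ext
  ext1 x
  exact congrArg (fun A : E3 →L[ℝ] E3 => A x) h

/-- An isometry has determinant ±1, so a sign condition suffices; positivity is what deformation
gradients and exponentials provide directly. -/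
lemma exists_rotation {A : E3 →L[ℝ] E3} (hA : ∀ x y, inner ℝ (A x) (A y) = inner ℝ x y)
    (hd : 0 < A.det) : ∃ R : Rotation, R.clm = A := by
  let f : E3 →ₗᵢ[ℝ] E3 := (A : E3 →ₗ[ℝ] E3).isometryOfInner hA
  let e : E3 ≃ₗᵢ[ℝ] E3 := f.toLinearIsometryEquiv rfl
  have he : (e.toLinearEquiv : E3 →ₗ[ℝ] E3) = (A : E3 →ₗ[ℝ] E3) := by ext x; rfl
  have h1 : |A.det| = 1 := by
    have h := f.normDet_eq_one
    rw [LinearMap.normDet_eq_abs_det] at h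
    exact h
  refine ⟨⟨e, ?_⟩, ?_⟩
  · rw [he]; change A.det = 1; rwa [abs_of_pos hd] at h1
  · ext1 x; rfl

/-- The scalar triple product is a determinant, which a map of determinant one preserves; testing
against the vectors R c then gives the identity. -/
lemma Rotation.map_cross (R : Rotation) (a b : E3) : R.1 (cross a b) = cross (R.1 a) (R.1 b) := by
  have key : ∀ a b c : E3, inner ℝ (cross (R.1 a) (R.1 b)) (R.1 c) = inner ℝ (cross a b) c := by
    intro a b c
    have hd : ∀ a b c : E3, inner ℝ (cross a b) c =
        Matrix.det ((EuclideanSpace.basisFun (Fin 3) ℝ).toBasis.toMatrix ![a, b, c]) := by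
      intro a b c
      rw [Matrix.det_fin_three]
      simp [Module.Basis.toMatrix_apply, inner_eq_sum, cross_apply_zero, cross_apply_one, cross_apply_two]
      ring
    rw [hd, hd]
    have := (EuclideanSpace.basisFun (Fin 3) ℝ).toBasis.det_comp
      (R.1.toLinearEquiv : E3 →ₗ[ℝ] E3) ![a, b, c]
    rw [R.2, one_mul, Module.Basis.det_apply, Module.Basis.det_apply] at this
    rw [← this]
    congr 2
    ext i
    fin_cases i <;> rfl
  refine ext_inner_right ℝ fun c => ?_
  obtain ⟨d, rfl⟩ := R.1.surjective c
  rw [key, R.1.inner_map_map]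

/-! ### Uniform rotations -/

/-- The exponential of `t w ×`. -/
def expCross (w : E3) (t : ℝ) : E3 →L[ℝ] E3 := NormedSpace.exp (t • crossL w)

@[simp] lemma expCross_zero (w : E3) : expCross w 0 = 1 := by
  have h : (0 : ℝ) • crossL w = 0 := by ext1 x; simp
  rw [expCross, h, NormedSpace.exp_zero]

lemma exp_add_smul {E : Type*} [NormedAddCommGroup E] [NormedSpace ℝ E] [CompleteSpace E]
    (A : E →L[ℝ] E) (s t : ℝ) :
    NormedSpace.exp ((s + t) • A) = NormedSpace.exp (s • A) * NormedSpace.exp (t • A) := by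
  letI : NormedAlgebra ℚ (E →L[ℝ] E) := NormedAlgebra.restrictScalars ℚ ℝ _
  rw [add_smul]
  exact NormedSpace.exp_add_of_commute (((Commute.refl A).smul_left s).smul_right t)

lemma expCross_add (w : E3) (s t : ℝ) : expCross w (s + t) = expCross w s * expCross w t :=
  exp_add_smul (crossL w) s t

lemma expCross_neg_mul (w : E3) (t : ℝ) : expCross w (-t) * expCross w t = 1 := by
  rw [← expCross_add, neg_add_cancel, expCross_zero]

lemma hasDerivAt_expCross (w : E3) (t : ℝ) :
    HasDerivAt (expCross w) (crossL w * expCross w t) t :=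
  hasDerivAt_exp_smul_const' (crossL w) t

lemma hasDerivAt_expCross' (w : E3) (t : ℝ) :
    HasDerivAt (expCross w) (expCross w t * crossL w) t :=
  hasDerivAt_exp_smul_const (crossL w) t

lemma hasDerivAt_expCross_apply (w x : E3) (t : ℝ) :
    HasDerivAt (fun s => expCross w s x) (cross w (expCross w t x)) t := by
  simpa using (hasDerivAt_expCross w t).clm_apply (hasDerivAt_const t x)

lemma contDiff_expCross (w : E3) {n : WithTop ℕ∞} : ContDiff ℝ n (expCross w) := by
  have h : ContDiff ℝ n (NormedSpace.exp : (E3 →L[ℝ] E3) → _) :=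
    contDiff_iff_contDiffAt.2 fun x => (NormedSpace.exp_analytic x).contDiffAt
  exact h.comp (contDiff_id.smul contDiff_const)

lemma inner_expCross (w x y : E3) (t : ℝ) :
    inner ℝ (expCross w t x) (expCross w t y) = inner ℝ x y := by
  have hd : ∀ s, HasDerivAt (fun s => inner ℝ (expCross w s x) (expCross w s y)) 0 s := fun s => by
    have h := (hasDerivAt_expCross_apply w x s).inner ℝ (hasDerivAt_expCross_apply w y s)
    rwa [inner_cross_skew, add_neg_cancel] at h
  have := is_const_of_deriv_eq_zero (fun s => (hd s).differentiableAt) (fun s => (hd s).deriv) t 0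
  simpa using this

lemma expCross_apply_self (w : E3) (t : ℝ) : expCross w t w = w := by
  have h : ∀ s, HasDerivAt (fun s => expCross w s w) 0 s := fun s => by
    have h1 := (hasDerivAt_expCross' w s).clm_apply (hasDerivAt_const s w)
    simpa [crossL_apply, cross_self] using h1
  have := is_const_of_deriv_eq_zero (fun s => (h s).differentiableAt) (fun s => (h s).deriv) t 0
  simpa using this

lemma det_mul_clm (A B : E3 →L[ℝ] E3) : (A * B).det = A.det * B.det :=
  LinearMap.det_comp (A : E3 →ₗ[ℝ] E3) (B : E3 →ₗ[ℝ] E3)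

@[simp] lemma det_one_clm : (1 : E3 →L[ℝ] E3).det = 1 := LinearMap.det_id

/-- The exponential at t is the square of the invertible exponential at t / 2. -/
lemma det_expCross_pos (w : E3) (t : ℝ) : 0 < (expCross w t).det := by
  have h1 : (expCross w (-(t / 2))).det * (expCross w (t / 2)).det = 1 := by
    rw [← det_mul_clm, expCross_neg_mul, det_one_clm]
  have h2 : expCross w t = expCross w (t / 2) * expCross w (t / 2) := by
    rw [← expCross_add, add_halves]
  rw [h2, det_mul_clm]
  have : (expCross w (t / 2)).det ≠ 0 := fun h => by rw [h] at h1; simp at h1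
  exact mul_self_pos.2 this

/-- The uniform rotation with angular velocity `w`. -/
def rotExp (w : E3) (t : ℝ) : Rotation :=
  (exists_rotation (fun x y => inner_expCross w x y t) (det_expCross_pos w t)).choose

@[simp] lemma clm_rotExp (w : E3) (t : ℝ) : (rotExp w t).clm = expCross w t :=
  (exists_rotation (fun x y => inner_expCross w x y t) (det_expCross_pos w t)).choose_spec

lemma rotExp_apply (w : E3) (t : ℝ) (x : E3) : (rotExp w t).1 x = expCross w t x := by
  rw [← clm_rotExp]; rfl

lemma isUniformRotation_rotExp (w : E3) : IsUniformRotation w (rotExp w) := by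
  intro x
  simp only [rotExp_apply]
  exact ⟨by simp, fun t => hasDerivAt_expCross_apply w x t⟩

/-- Pythagoras in the orthonormal frame e, n × e of the plane orthogonal to n. Its use is to prove
that two vectors with the same n-component coincide by comparing two coordinates of their
difference. -/
lemma norm_sq_eq_of_orthogonal {n e d : E3} (hn : ‖n‖ = 1) (he : ‖e‖ = 1)
    (hne : inner ℝ n e = 0) (hnd : inner ℝ n d = 0) :
    ‖d‖ ^ 2 = inner ℝ d e ^ 2 + inner ℝ d (cross n e) ^ 2 := by
  have h1 := norm_cross_sq e d
  have h2 := norm_cross_sq n (cross e d)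
  have h3 : cross n (cross e d) = inner ℝ n d • e - inner ℝ n e • d := by
    apply ext3 <;>
      simp only [PiLp.sub_apply, PiLp.smul_apply, smul_eq_mul, inner_eq_sum,
        cross_apply_zero, cross_apply_one, cross_apply_two] <;> ring
  have h4 : inner ℝ n (cross e d) = inner ℝ d (cross n e) := by
    simp only [inner_eq_sum, cross_apply_zero, cross_apply_one, cross_apply_two]; ring
  rw [h3, hnd, hne, h4] at h2
  rw [he, real_inner_comm] at h1
  simp [hn] at h2
  linarith

/-- Rodrigues' formula on the plane orthogonal to the axis. Both sides solve u' = w × u with the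
same initial value, so exp(-t w ×) applied to the right-hand side is constant. -/
lemma expCross_apply_orthogonal {w e : E3} (hw : w ≠ 0) (hwe : inner ℝ w e = 0) (t : ℝ) :
    expCross w t e = Real.cos (‖w‖ * t) • e + Real.sin (‖w‖ * t) • (‖w‖⁻¹ • cross w e) := by
  have hw' : ‖w‖ ≠ 0 := norm_ne_zero_iff.2 hw
  set f : ℝ → E3 := fun t =>
    Real.cos (‖w‖ * t) • e + Real.sin (‖w‖ * t) • (‖w‖⁻¹ • cross w e) with hf
  have hlin : ∀ t : ℝ, HasDerivAt (fun t => ‖w‖ * t) ‖w‖ t := fun t => by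
    simpa using (hasDerivAt_id t).const_mul ‖w‖
  have hfd : ∀ t, HasDerivAt f (cross w (f t)) t := fun t => by
    have h := ((hlin t).cos.smul_const e).add ((hlin t).sin.smul_const (‖w‖⁻¹ • cross w e))
    refine h.congr_deriv ?_
    simp only [hf, cross_add_right, cross_smul_right, cross_cross_self, hwe, zero_smul, zero_sub,
      smul_neg, smul_smul]
    have e1 : ‖w‖⁻¹ * ‖w‖ ^ 2 = ‖w‖ := by field_simp
    have e2 : ‖w‖ * ‖w‖⁻¹ = 1 := mul_inv_cancel₀ hw'
    rw [mul_assoc (Real.cos _), e2, mul_assoc (Real.sin _) ‖w‖⁻¹, e1, mul_one, add_comm]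
    module
  have hd : ∀ t, HasDerivAt (fun t => expCross w (-t) (f t)) 0 t := fun t => by
    have h1 : HasDerivAt (fun t => expCross w (-t)) (-(expCross w (-t) * crossL w)) t := by
      have := (hasDerivAt_expCross' w (-t)).scomp t (hasDerivAt_neg t)
      rwa [neg_one_smul] at this
    refine (h1.clm_apply (hfd t)).congr_deriv ?_
    simp
  have h0 := is_const_of_deriv_eq_zero (fun s => (hd s).differentiableAt) (fun s => (hd s).deriv) t 0
  have h1 : expCross w t (expCross w (-t) (f t)) = f t := by
    have := congrArg (fun A : E3 →L[ℝ] E3 => A (f t)) (expCross_neg_mul w (-t))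
    simpa using this
  change _ = f t
  rw [← h1, h0]
  simp [hf]

lemma exists_orthogonal_unit (n : E3) : ∃ e : E3, ‖e‖ = 1 ∧ inner ℝ n e = 0 := by
  have : ∃ v : E3, v ≠ 0 ∧ inner ℝ n v = 0 := by
    by_cases h : n 0 = 0 ∧ n 1 = 0
    · exact ⟨EuclideanSpace.single 0 1, by simp, by simp [inner_eq_sum, h.1]⟩
    · refine ⟨!₂[n 1, -n 0, 0], fun h0 => h ?_, by simp [inner_eq_sum]; ring⟩
      have a := congrArg (fun v : E3 => v 0) h0
      have b := congrArg (fun v : E3 => v 1) h0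
      simp at a b
      exact ⟨b, a⟩
  obtain ⟨v, hv, hnv⟩ := this
  refine ⟨‖v‖⁻¹ • v, norm_smul_inv_norm hv, by rw [inner_smul_right, hnv, mul_zero]⟩

/-- Rotations fixing an axis are the rotations about it. -/
lemma Rotation.exists_eq_rotExp {w : E3} (hw : w ≠ 0) {R : Rotation} (hR : R.1 w = w) :
    ∃ t, 0 ≤ t ∧ R = rotExp w t := by
  have hw' : ‖w‖ ≠ 0 := norm_ne_zero_iff.2 hw
  set n : E3 := ‖w‖⁻¹ • w with hn
  have hn1 : ‖n‖ = 1 := norm_smul_inv_norm hw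
  obtain ⟨e, he, hne⟩ := exists_orthogonal_unit n
  have hwn : w = ‖w‖ • n := by rw [hn, smul_smul, mul_inv_cancel₀ hw', one_smul]
  have hwe : inner ℝ w e = 0 := by rw [hwn, inner_smul_left, hne, mul_zero]
  have hRn : R.1 n = n := by rw [hn, map_smul, hR]
  have hcn : ‖cross n e‖ = 1 := by
    have := norm_cross_sq n e
    rw [hne, hn1, he] at this
    have h2 : ‖cross n e‖ ^ 2 = 1 := by linarith
    nlinarith [norm_nonneg (cross n e)]
  have hee : inner ℝ e (cross n e) = 0 := by
    simp only [inner_eq_sum, cross_apply_zero, cross_apply_one, cross_apply_two]; ring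
  have hnRe : inner ℝ n (R.1 e) = 0 := by
    conv_lhs => rw [← hRn]
    rw [R.inner_map, hne]
  set a := inner ℝ (R.1 e) e with ha
  set b := inner ℝ (R.1 e) (cross n e) with hb
  have hab : a ^ 2 + b ^ 2 = 1 := by
    rw [ha, hb, ← norm_sq_eq_of_orthogonal hn1 he hne hnRe, R.1.norm_map, he, one_pow]
  have hRe : R.1 e = a • e + b • cross n e := by
    have h : inner ℝ n (R.1 e - (a • e + b • cross n e)) = 0 := by
      have : inner ℝ n (cross n e) = 0 := by
        simp only [inner_eq_sum, cross_apply_zero, cross_apply_one, cross_apply_two]; ring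
      simp [inner_sub_right, inner_add_right, inner_smul_right, hnRe, hne, this]
    have h2 := norm_sq_eq_of_orthogonal hn1 he hne h
    have h3 : inner ℝ (cross n e) e = 0 := by rw [real_inner_comm, hee]
    simp only [inner_sub_left, inner_add_left, inner_smul_left, ← ha, ← hb, hee, h3,
      real_inner_self_eq_norm_sq, he, hcn] at h2
    simp at h2
    exact sub_eq_zero.1 h2
  obtain ⟨θ, hθ, hθa, hθb⟩ : ∃ θ, 0 ≤ θ ∧ a = Real.cos θ ∧ b = Real.sin θ := by
    have h1 : ‖(⟨a, b⟩ : ℂ)‖ = 1 := by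
      rw [Complex.norm_def, Complex.normSq_mk, ← sq, ← sq, hab, Real.sqrt_one]
    -- The added turn makes the angle nonnegative, which matters because limit sets are only shown
    -- to be invariant under forward rotation.
    refine ⟨Complex.arg ⟨a, b⟩ + 2 * Real.pi, ?_, ?_, ?_⟩
    · linarith [Complex.neg_pi_lt_arg ⟨a, b⟩, Real.pi_pos]
    · rw [Real.cos_add_two_pi, Complex.cos_arg (by rw [← norm_ne_zero_iff, h1]; simp), h1, div_one]
    · rw [Real.sin_add_two_pi, Complex.sin_arg, h1, div_one]
  refine ⟨θ / ‖w‖, by positivity, ?_⟩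
  set P := rotExp w (θ / ‖w‖) with hP
  have hPe : P.1 e = R.1 e := by
    rw [hP, rotExp_apply, expCross_apply_orthogonal hw hwe, mul_div_cancel₀ _ hw', hRe, hθa, hθb,
      ← cross_smul_left]
  have hPn : P.1 n = n := by
    rw [hP, rotExp_apply, hn, map_smul]
    rw [expCross_apply_self]
  have hPc : P.1 (cross n e) = R.1 (cross n e) := by
    rw [P.map_cross, R.map_cross, hPe, hPn, hRn]
  -- R and P agree on the frame n, e, n × e. Hence R x and P x have the same components along the
  -- images of this frame.
  refine Rotation.ext (ContinuousLinearMap.ext fun x => ?_)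
  have hnPe : inner ℝ n (P.1 e) = 0 := by rw [hPe, hnRe]
  have hPe1 : ‖P.1 e‖ = 1 := by rw [P.1.norm_map, he]
  have horth : inner ℝ n (R.1 x - P.1 x) = 0 := by
    rw [inner_sub_right]
    conv_lhs => enter [1]; rw [← hRn]
    conv_lhs => enter [2]; rw [← hPn]
    rw [R.inner_map, P.inner_map, sub_self]
  have h := norm_sq_eq_of_orthogonal hn1 hPe1 hnPe horth
  have hc : cross n (P.1 e) = P.1 (cross n e) := by rw [P.map_cross, hPn]
  rw [hc, inner_sub_left, inner_sub_left] at h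
  nth_rewrite 1 [hPe] at h
  nth_rewrite 1 [hPc] at h
  rw [R.inner_map, P.inner_map, R.inner_map, P.inner_map] at h
  simp at h
  exact sub_eq_zero.1 h

end ElasticSatellite
end

noncomputable section

namespace ElasticSatellite

/-! ### Geometry of the reference body -/

namespace Body

variable (S : Body)

lemma isCompact_closure : IsCompact (closure S.B) := S.bounded.isCompact_closure

lemma measurableSet : MeasurableSet S.B := S.isOpen.measurableSet

lemma nonempty : S.B.Nonempty := S.isConnected.nonempty

lemma volume_lt_top : volume S.B < ⊤ := S.bounded.measure_lt_top

instance : IsFiniteMeasure (volume.restrict S.B) :=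
  ⟨by rw [Measure.restrict_apply_univ]; exact S.volume_lt_top⟩

lemma closure_mem_nhds {x : E3} (hx : x ∈ S.B) : closure S.B ∈ 𝓝 x :=
  mem_of_superset (S.isOpen.mem_nhds hx) subset_closure

variable {S}

lemma nonpos_of_mem_closure {U : Set E3} {g : E3 → ℝ} (hU : IsOpen U)
    (hg : ContDiffOn ℝ ∞ g U) (hB : S.B ∩ U = {z ∈ U | g z < 0}) {x : E3} (hx : x ∈ closure S.B)
    (hxU : x ∈ U) : g x ≤ 0 := by
  have hc : ContinuousWithinAt g S.B x :=
    (hg.continuousOn.continuousAt (hU.mem_nhds hxU)).continuousWithinAt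
  have hne : (𝓝[S.B] x).NeBot := mem_closure_iff_nhdsWithin_neBot.1 hx
  refine le_of_tendsto hc ?_
  filter_upwards [self_mem_nhdsWithin, mem_nhdsWithin_of_mem_nhds (hU.mem_nhds hxU)] with y h1 h2
  have : y ∈ {z ∈ U | g z < 0} := hB ▸ ⟨h1, h2⟩
  exact this.2.le

/-- Interior cone condition at the boundary. -/
lemma exists_cone {x : E3} (hx : x ∈ frontier S.B) : ∃ n : E3, ‖n‖ = 1 ∧ ∃ r > 0,
    ∀ y ∈ closure S.B ∩ Metric.ball x r, ∀ z ∈ Metric.ball x r, z ≠ y →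
      inner ℝ n (z - y) ≤ -(1 / 2) * ‖z - y‖ → z ∈ S.B := by
  obtain ⟨n, U, g, hU, hxU, hg, hg0, hB, hn⟩ := S.smooth_boundary x hx
  have hN := hg0 x hxU
  have hN' : 0 < ‖gradient g x‖ := norm_pos_iff.2 hN
  have hs : HasStrictFDerivAt g (fderiv ℝ g x) x :=
    (hg.contDiffAt (hU.mem_nhds hxU)).hasStrictFDerivAt (by simp)
  -- Strict differentiability controls g z - g y uniformly in both points. The error |∇g| / 4 is
  -- half of the decrease |∇g| / 2 guaranteed by the cone, so g z < 0 there.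
  obtain ⟨r, hr, hball⟩ : ∃ r > 0, ∀ y ∈ Metric.ball x r, ∀ z ∈ Metric.ball x r, y ∈ U ∧
      ‖g z - g y - fderiv ℝ g x (z - y)‖ ≤ ‖gradient g x‖ / 4 * ‖z - y‖ := by
    have h1 := hs.isLittleO.def (c := ‖gradient g x‖ / 4) (by positivity)
    rw [nhds_prod_eq] at h1
    have h2 : ∀ᶠ p : E3 × E3 in 𝓝 x ×ˢ 𝓝 x, p.2 ∈ U := by
      have h3 : ∀ᶠ y in 𝓝 x, y ∈ U := hU.mem_nhds hxU
      exact h3.prod_inr _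
    obtain ⟨V, hV, hVV⟩ := Filter.eventually_prod_self_iff'.1 (h1.and h2)
    obtain ⟨r, hr, hb⟩ := Metric.mem_nhds_iff.1 hV
    exact ⟨r, hr, fun y hy z hz => ⟨(hVV z (hb hz) y (hb hy)).2, (hVV z (hb hz) y (hb hy)).1⟩⟩
  refine ⟨n, by rw [hn]; exact norm_smul_inv_norm hN, r, hr, fun y hy z hz hzy hin => ?_⟩
  have h1 := (hball y hy.2 z hz).2
  have hgy := nonpos_of_mem_closure hU hg hB hy.1 (hball y hy.2 z hz).1
  have hzU := (hball z hz y hy.2).1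
  have h2 : fderiv ℝ g x (z - y) = ‖gradient g x‖ * inner ℝ n (z - y) := by
    rw [hn, inner_smul_left]
    have : inner ℝ (gradient g x) (z - y) = fderiv ℝ g x (z - y) := by
      rw [gradient, InnerProductSpace.toDual_symm_apply]
    rw [this]
    simp [hN'.ne']
  have hpos : 0 < ‖z - y‖ := norm_pos_iff.2 (sub_ne_zero.2 hzy)
  have h3 : g z < 0 := by
    have := (abs_le.1 (Real.norm_eq_abs _ ▸ h1)).2
    nlinarith [mul_pos hN' hpos]
  have : z ∈ S.B ∩ U := by rw [hB]; exact ⟨hzU, h3⟩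
  exact this.1

/-- At a boundary point the interior cone lies in the tangent cone, and it spans the space. This
makes the deformation gradient well defined and continuous up to the boundary. -/
lemma uniqueDiffOn_closure (S : Body) : UniqueDiffOn ℝ (closure S.B) := by
  intro x hx
  by_cases hxB : x ∈ S.B
  · exact uniqueDiffWithinAt_of_mem_nhds (S.closure_mem_nhds hxB)
  obtain ⟨n, hn, r, hr, hcone⟩ := exists_cone (S := S) (x := x)
    ⟨hx, by rwa [S.isOpen.interior_eq]⟩
  refine ⟨?_, subset_closure hx⟩
  have hmem : ∀ h : E3, h ≠ 0 → inner ℝ n h ≤ -(1 / 2) * ‖h‖ → h ∈ tangentConeAt ℝ (closure S.B) x := by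
    intro h h0 hh
    refine mem_tangentConeAt_of_add_smul_mem (l := 𝓝[>] (0 : ℝ)) (c := id)
      (tendsto_id'.2 (nhdsWithin_mono _ fun t ht => ne_of_gt ht)) ?_
    have hlim : Tendsto (fun t : ℝ => x + t • h) (𝓝[>] 0) (𝓝 x) := by
      have : Continuous fun t : ℝ => x + t • h := by fun_prop
      simpa using (this.tendsto 0).mono_left nhdsWithin_le_nhds
    filter_upwards [self_mem_nhdsWithin, hlim (Metric.ball_mem_nhds x hr)] with t ht hb
    have ht : 0 < t := ht
    refine subset_closure (hcone x ⟨hx, Metric.mem_ball_self hr⟩ _ hb ?_ ?_)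
    · simpa using ⟨ht.ne', h0⟩
    · rw [id, add_sub_cancel_left, inner_smul_right, norm_smul, Real.norm_of_nonneg ht.le]
      nlinarith
  have : (Submodule.span ℝ (tangentConeAt ℝ (closure S.B) x) : Submodule ℝ E3) = ⊤ := by
    rw [eq_top_iff]
    intro v _
    -- v is the sum of v - l n and l n. The condition ‖v‖ - l ≤ -(‖v‖ + l) / 2 that puts v - l n in
    -- the cone amounts to l ≥ 3‖v‖; the extra 1 keeps this vector nonzero.
    set l := 3 * ‖v‖ + 1 with hl
    have hlp : 0 < l := by positivity
    have hn0 : n ≠ 0 := fun h => by simp [h] at hn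
    have hnn : inner ℝ n n = 1 := by rw [real_inner_self_eq_norm_sq, hn, one_pow]
    have h1 : -n ∈ tangentConeAt ℝ (closure S.B) x := by
      refine hmem _ (neg_ne_zero.2 hn0) ?_
      rw [inner_neg_right, norm_neg, hnn, hn]; norm_num
    have hnv : inner ℝ n v ≤ ‖v‖ := by
      have := real_inner_le_norm n v
      rwa [hn, one_mul] at this
    have hnorm : ‖v - l • n‖ ≤ ‖v‖ + l := by
      refine (norm_sub_le _ _).trans ?_
      rw [norm_smul, hn, mul_one, Real.norm_of_nonneg hlp.le]
    have hin : inner ℝ n (v - l • n) ≤ ‖v‖ - l := by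
      rw [inner_sub_right, inner_smul_right, hnn]; linarith
    have h2 : v - l • n ∈ tangentConeAt ℝ (closure S.B) x := by
      refine hmem _ (fun h => ?_) ?_
      · rw [h, inner_zero_right] at hin
        linarith [norm_nonneg v]
      · nlinarith [norm_nonneg v]
    have h3 : v = (v - l • n) + (-l) • (-n) := by simp
    rw [h3]
    exact Submodule.add_mem _ (Submodule.subset_span h2)
      (Submodule.smul_mem _ _ (Submodule.subset_span h1))
  rw [this]
  exact dense_univ

/-- Near each of its points, the closure of the body is locally quasiconvex. -/
lemma exists_polygonal {x₀ : E3} (hx₀ : x₀ ∈ closure S.B) {V : Set E3} (hV : V ∈ 𝓝 x₀) :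
    ∃ V' ∈ 𝓝 x₀, ∀ x ∈ S.B ∩ V', ∀ y ∈ S.B ∩ V', ∃ p q : E3,
      segment ℝ x p ⊆ S.B ∩ V ∧ segment ℝ p q ⊆ S.B ∩ V ∧ segment ℝ q y ⊆ S.B ∩ V ∧
      ‖p - x‖ + ‖q - p‖ + ‖y - q‖ ≤ 7 * ‖y - x‖ := by
  by_cases hxB : x₀ ∈ S.B
  · obtain ⟨r, hr, hb⟩ := Metric.mem_nhds_iff.1 (inter_mem (S.isOpen.mem_nhds hxB) hV)
    refine ⟨Metric.ball x₀ r, Metric.ball_mem_nhds _ hr, fun x hx y hy => ⟨x, y, ?_, ?_, ?_, ?_⟩⟩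
    · rw [segment_same]; rintro _ rfl; exact hb hx.2
    · exact ((convex_ball x₀ r).segment_subset hx.2 hy.2).trans hb
    · rw [segment_same]; rintro _ rfl; exact hb hy.2
    · simp; linarith [norm_nonneg (y - x)]
  obtain ⟨n, hn, r, hr, hcone⟩ := exists_cone (S := S) (x := x₀)
    ⟨hx₀, by rwa [S.isOpen.interior_eq]⟩
  have hnn : inner ℝ n n = 1 := by rw [real_inner_self_eq_norm_sq, hn, one_pow]
  obtain ⟨r', hr', hb⟩ := Metric.mem_nhds_iff.1 (inter_mem (Metric.ball_mem_nhds x₀ hr) hV)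
  -- Two points of this ball are at distance d ≤ 2r'/9. A vertical descent of at most 6r'/9, and a
  -- displacement of norm at most 4d, both stay inside the ball of radius r'.
  refine ⟨Metric.ball x₀ (r' / 9), Metric.ball_mem_nhds _ (by positivity), ?_⟩
  have vert : ∀ x ∈ S.B ∩ Metric.ball x₀ (r' / 9), ∀ l : ℝ, 0 ≤ l → l ≤ 6 * (r' / 9) →
      x - l • n ∈ S.B ∩ V := by
    intro x hx l hl hl'
    have hd : x - l • n ∈ Metric.ball x₀ r' := by
      have h1 := hx.2
      rw [Metric.mem_ball, dist_eq_norm] at h1 ⊢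
      calc ‖x - l • n - x₀‖ = ‖(x - x₀) - l • n‖ := by congr 1; abel
        _ ≤ ‖x - x₀‖ + ‖l • n‖ := norm_sub_le _ _
        _ < r' := by rw [norm_smul, hn, mul_one, Real.norm_of_nonneg hl]; linarith
    have h2 := hb hd
    refine ⟨?_, h2.2⟩
    rcases hl.eq_or_lt with rfl | hl
    · simpa using hx.1
    have hx2 : x ∈ Metric.ball x₀ r := (hb (Metric.ball_subset_ball (by linarith) hx.2)).1
    refine hcone x ⟨subset_closure hx.1, hx2⟩ _ h2.1 ?_ ?_
    · intro h
      have h3 : l • n = 0 := by simpa using h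
      have : ‖l • n‖ = l := by rw [norm_smul, hn, mul_one, Real.norm_of_nonneg hl.le]
      rw [h3, norm_zero] at this
      exact hl.ne this
    · rw [sub_sub_cancel_left, inner_neg_right, inner_smul_right, hnn, norm_neg, norm_smul, hn,
        Real.norm_of_nonneg hl.le]
      linarith
  have vertseg : ∀ x ∈ S.B ∩ Metric.ball x₀ (r' / 9), ∀ l : ℝ, 0 ≤ l → l ≤ 6 * (r' / 9) →
      segment ℝ x (x - l • n) ⊆ S.B ∩ V := by
    rintro x hx l hl hl' _ ⟨a, b, ha, hb', hab, rfl⟩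
    have : a • x + b • (x - l • n) = x - (b * l) • n := by
      rw [smul_sub, smul_smul, ← add_sub_assoc, ← add_smul, hab, one_smul]
    rw [this]
    exact vert x hx _ (by positivity) (by nlinarith)
  intro x hx y hy
  set d := ‖y - x‖ with hd
  have hd2 : d ≤ 2 * (r' / 9) := by
    have h1 := hx.2; have h2 := hy.2
    rw [Metric.mem_ball] at h1 h2
    rw [hd, ← dist_eq_norm]
    linarith [dist_triangle_right y x x₀]
  have hd0 : 0 ≤ d := norm_nonneg _
  -- Descend along -n, cross, come back up. Depth 3d is what puts the crossing segment in the cone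
  -- at x, since b d - 3d ≤ -(b d + 3d) / 2 for b ≤ 1. The total length is 3d + d + 3d = 7d.
  refine ⟨x - (3 * d) • n, y - (3 * d) • n, vertseg x hx _ (by positivity) (by linarith), ?_, ?_, ?_⟩
  · rintro _ ⟨a, b, ha, hb', hab, rfl⟩
    have e : a • (x - (3 * d) • n) + b • (y - (3 * d) • n) = x + (b • (y - x) - (3 * d) • n) := by
      have : a = 1 - b := by linarith
      rw [this]; module
    rw [e]
    have hb1 : b ≤ 1 := by linarith
    have hnorm : ‖b • (y - x) - (3 * d) • n‖ ≤ b * d + 3 * d := by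
      refine (norm_sub_le _ _).trans ?_
      rw [norm_smul, norm_smul, hn, mul_one, Real.norm_of_nonneg hb',
        Real.norm_of_nonneg (by positivity)]
    have hball : x + (b • (y - x) - (3 * d) • n) ∈ Metric.ball x₀ r' := by
      have h1 := hx.2
      rw [Metric.mem_ball, dist_eq_norm] at h1 ⊢
      calc _ = ‖(x - x₀) + (b • (y - x) - (3 * d) • n)‖ := by congr 1; abel
        _ ≤ ‖x - x₀‖ + ‖b • (y - x) - (3 * d) • n‖ := norm_add_le _ _
        _ < r' := by nlinarith
    refine ⟨?_, (hb hball).2⟩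
    by_cases h0 : b • (y - x) - (3 * d) • n = 0
    · rw [h0, add_zero]; exact hx.1
    have hx2 : x ∈ Metric.ball x₀ r := (hb (Metric.ball_subset_ball (by linarith) hx.2)).1
    refine hcone x ⟨subset_closure hx.1, hx2⟩ _ (hb hball).1 (by simpa using h0) ?_
    rw [add_sub_cancel_left]
    have hin : inner ℝ n (b • (y - x) - (3 * d) • n) ≤ b * d - 3 * d := by
      rw [inner_sub_right, inner_smul_right, inner_smul_right, hnn, mul_one]
      have := real_inner_le_norm n (y - x)
      rw [hn, one_mul, ← hd] at this
      nlinarith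
    nlinarith
  · rw [segment_symm]; exact vertseg y hy _ (by positivity) (by linarith)
  · have e1 : ‖x - (3 * d) • n - x‖ = 3 * d := by
      rw [sub_sub_cancel_left, norm_neg, norm_smul, hn, mul_one, Real.norm_of_nonneg (by positivity)]
    have e2 : ‖y - (3 * d) • n - (x - (3 * d) • n)‖ = d := by rw [hd]; congr 1; abel
    have e3 : ‖y - (y - (3 * d) • n)‖ = 3 * d := by
      rw [sub_sub_cancel, norm_smul, hn, mul_one, Real.norm_of_nonneg (by positivity)]
    rw [e1, e2, e3]; linarith

/-- Mean value inequality in the body, near a point of its closure. -/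
lemma exists_mean_value {x₀ : E3} (hx₀ : x₀ ∈ closure S.B) {V : Set E3} (hV : V ∈ 𝓝 x₀) :
    ∃ V' ∈ 𝓝 x₀, ∀ (f : E3 → E3) (f' : E3 → E3 →L[ℝ] E3) (A : E3 →L[ℝ] E3) (c : ℝ),
      (∀ x ∈ S.B ∩ V, HasFDerivAt f (f' x) x) → (∀ x ∈ S.B ∩ V, ‖f' x - A‖ ≤ c) →
      ∀ x ∈ S.B ∩ V', ∀ y ∈ S.B ∩ V', ‖f y - f x - A (y - x)‖ ≤ 7 * c * ‖y - x‖ := by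
  obtain ⟨V', hV', h⟩ := exists_polygonal hx₀ hV
  refine ⟨V', hV', fun f f' A c hf hc x hx y hy => ?_⟩
  obtain ⟨p, q, h1, h2, h3, hlen⟩ := h x hx y hy
  have seg : ∀ a b : E3, segment ℝ a b ⊆ S.B ∩ V → ‖f b - f a - A (b - a)‖ ≤ c * ‖b - a‖ :=
    fun a b hab => (convex_segment a b).norm_image_sub_le_of_norm_hasFDerivWithin_le'
      (fun z hz => (hf z (hab hz)).hasFDerivWithinAt) (fun z hz => hc z (hab hz))
      (left_mem_segment ℝ a b) (right_mem_segment ℝ a b)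
  have hc0 : 0 ≤ c := (norm_nonneg _).trans (hc x (h1 (left_mem_segment ℝ x p)))
  have e : f y - f x - A (y - x) = (f p - f x - A (p - x)) + (f q - f p - A (q - p)) +
      (f y - f q - A (y - q)) := by simp only [map_sub]; abel
  rw [e]
  calc _ ≤ c * ‖p - x‖ + c * ‖q - p‖ + c * ‖y - q‖ :=
        norm_add₃_le.trans (add_le_add_three (seg _ _ h1) (seg _ _ h2) (seg _ _ h3))
    _ = c * (‖p - x‖ + ‖q - p‖ + ‖y - q‖) := by ring
    _ ≤ c * (7 * ‖y - x‖) := by gcongr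
    _ = _ := by ring

end Body

end ElasticSatellite
end

noncomputable section

namespace ElasticSatellite

/-! ### Configurations and the action of matrices -/

/-- Operators of `ℝ³` are generated by the rotations. -/
lemma induction_rotation {p : (E3 →L[ℝ] E3) → Prop} (rot : ∀ R : Rotation, p R.clm)
    (one : p 1) (add : ∀ A B, p A → p B → p (A + B)) (smul : ∀ (c : ℝ) A, p A → p (c • A))
    (mul : ∀ A B, p A → p B → p (A * B)) (A : E3 →L[ℝ] E3) : p A := by
  -- The half-turn about n is 2 n nᵀ - 1, so the projection onto n is half the sum of this rotation
  -- and the identity.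
  have hproj : ∀ n : E3, ‖n‖ = 1 → p ((innerSL ℝ n).smulRight n) := by
    intro n hn
    have hfin : Module.finrank ℝ (ℝ ∙ n)ᗮ = 2 := by
      have : Fact (Module.finrank ℝ E3 = 2 + 1) := ⟨by simp⟩
      exact Submodule.finrank_orthogonal_span_singleton (fun h => by simp [h] at hn)
    let R : Rotation := ⟨(ℝ ∙ n).reflection, by
      have := (ℝ ∙ n).det_reflection
      rw [hfin] at this
      rw [show ((-1 : ℝ) ^ 2) = 1 by norm_num] at this
      exact this⟩
    have hR : ∀ x, R.clm x = 2 • (inner ℝ n x) • n - x := fun x => by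
      change (ℝ ∙ n).reflection x = _
      rw [Submodule.reflection_apply, Submodule.starProjection_unit_singleton ℝ hn]
    have : (innerSL ℝ n).smulRight n = (1 / 2 : ℝ) • (R.clm + 1) := by
      ext1 x
      simp only [ContinuousLinearMap.smulRight_apply, innerSL_apply_apply, _root_.smul_apply,
        _root_.add_apply, hR, one_apply_eq_self, sub_add_cancel]
      module
    rw [this]
    exact smul _ _ (add _ _ (rot R) one)
  set e : Fin 3 → E3 := fun i => EuclideanSpace.single i 1 with he
  have hin : ∀ i (x : E3), inner ℝ (e i) x = x i := fun i x => by
    rw [he, EuclideanSpace.inner_single_left]; simp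
  have hee : ∀ i j, e i j = if j = i then 1 else 0 := fun i j => by
    simp [he, Pi.single_apply]
  have hE : ∀ i j, p ((innerSL ℝ (e j)).smulRight (e i)) := by
    intro i j
    have hi := hproj (e i) (by simp [he])
    rcases eq_or_ne i j with rfl | hij
    · exact hi
    have hj := hproj (e j) (by simp [he])
    set m := e i + e j with hm
    have hmn : ‖m‖ ≠ 0 := by
      rw [norm_ne_zero_iff]
      intro h
      have := congrArg (fun v : E3 => v i) h
      simp [hm, hee, hij] at this
    have hmm := hproj (‖m‖⁻¹ • m) (norm_smul_inv_norm (norm_ne_zero_iff.1 hmn))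
    -- An off-diagonal matrix unit is a multiple of the product of three projections, onto e i, onto
    -- e i + e j and onto e j.
    have : (innerSL ℝ (e j)).smulRight (e i) = (‖m‖ ^ 2) • ((innerSL ℝ (e i)).smulRight (e i) *
        ((innerSL ℝ (‖m‖⁻¹ • m)).smulRight (‖m‖⁻¹ • m) * (innerSL ℝ (e j)).smulRight (e j))) := by
      ext1 x
      have h1 : inner ℝ m (e j) = 1 := by rw [real_inner_comm, hin]; simp [hm, hee, hij.symm]
      have h2 : m i = 1 := by simp [hm, hee, hij]
      have hmul' : ∀ (A B : E3 →L[ℝ] E3) y, (A * B) y = A (B y) := fun _ _ _ => rfl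
      simp only [_root_.smul_apply, hmul', ContinuousLinearMap.smulRight_apply,
        innerSL_apply_apply, inner_smul_left, inner_smul_right, h1, h2, smul_smul, hin]
      congr 1
      simp
      field_simp
      rw [h2, mul_one]
    rw [this]
    exact smul _ _ (mul _ _ hi (mul _ _ hmm hj))
  have hA : A = ∑ i, ∑ j, (A (e j) i) • (innerSL ℝ (e j)).smulRight (e i) := by
    ext1 x
    have hx : A x = x 0 • A (e 0) + x 1 • A (e 1) + x 2 • A (e 2) := by
      rw [← map_smul, ← map_smul, ← map_smul, ← map_add, ← map_add]
      congr 1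
      apply ext3 <;> simp [he]
    rw [hx]
    apply ext3 <;>
      simp only [Fin.sum_univ_three, hee, _root_.add_apply, _root_.smul_apply,
        ContinuousLinearMap.smulRight_apply, innerSL_apply_apply, hin, PiLp.add_apply,
        PiLp.smul_apply, smul_eq_mul] <;> simp <;> ring
  have hsum : ∀ f : Fin 3 → E3 →L[ℝ] E3, (∀ i, p (f i)) → p (∑ i, f i) := fun f hf => by
    rw [Fin.sum_univ_three]; exact add _ _ (add _ _ (hf 0) (hf 1)) (hf 2)
  rw [hA]
  exact hsum _ fun i => hsum _ fun j => smul _ _ (hE i j)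

namespace ConfigSpace

variable {S : Body} {Q : Type*} [NormedAddCommGroup Q] [NormedSpace ℝ Q] (C : ConfigSpace S Q)

lemma eq_of_ev_eq {ζ ζ' : Q} (h : ∀ x ∈ S.B, C.ev ζ x = C.ev ζ' x) : ζ = ζ' :=
  sub_eq_zero.1 (C.ev_injective _ fun x hx => by simp [h x hx])

lemma exists_bound : ∃ c : ℝ, 0 < c ∧ ∀ ζ : Q, ∀ x ∈ closure S.B,
    ‖C.ev ζ x‖ ≤ c * ‖ζ‖ ∧ ‖C.defGrad ζ x‖ ≤ c * ‖ζ‖ := by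
  obtain ⟨c, hc⟩ := C.ev_bound
  refine ⟨max c 1, by positivity, fun ζ x hx => ⟨(hc ζ x hx).1.trans ?_, (hc ζ x hx).2.trans ?_⟩⟩ <;>
  · gcongr; exact le_max_left _ _

lemma contDiffOn_ev (ζ : Q) : ContDiffOn ℝ 2 (C.ev ζ) (closure S.B) := C.ev_smooth ζ

lemma continuousOn_ev (ζ : Q) : ContinuousOn (C.ev ζ) (closure S.B) := (C.ev_smooth ζ).continuousOn

lemma hasFDerivWithinAt_ev (ζ : Q) {x : E3} (hx : x ∈ closure S.B) :
    HasFDerivWithinAt (C.ev ζ) (C.defGrad ζ x) (closure S.B) x :=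
  (((C.ev_smooth ζ).differentiableOn (by norm_num)) x hx).hasFDerivWithinAt

lemma hasFDerivAt_ev (ζ : Q) {x : E3} (hx : x ∈ S.B) :
    HasFDerivAt (C.ev ζ) (C.defGrad ζ x) x :=
  (C.hasFDerivWithinAt_ev ζ (subset_closure hx)).hasFDerivAt (S.closure_mem_nhds hx)

lemma defGrad_eq {ζ : Q} {x : E3} (hx : x ∈ closure S.B) {A : E3 →L[ℝ] E3}
    (h : HasFDerivWithinAt (C.ev ζ) A (closure S.B) x) : C.defGrad ζ x = A :=
  h.fderivWithin (S.uniqueDiffOn_closure x hx)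

lemma contDiffOn_defGrad (ζ : Q) : ContDiffOn ℝ 1 (C.defGrad ζ) (closure S.B) :=
  (C.ev_smooth ζ).fderivWithin S.uniqueDiffOn_closure (by norm_num)

lemma continuousOn_defGrad (ζ : Q) : ContinuousOn (C.defGrad ζ) (closure S.B) :=
  (C.contDiffOn_defGrad ζ).continuousOn

/-- Evaluation at a point, as a continuous linear map. -/
def evL {x : E3} (hx : x ∈ closure S.B) : Q →L[ℝ] E3 :=
  LinearMap.mkContinuous
    { toFun := fun ζ => C.ev ζ x
      map_add' := fun a b => by simp
      map_smul' := fun a b => by simp }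
    C.exists_bound.choose fun ζ => (C.exists_bound.choose_spec.2 ζ x hx).1

/-- The deformation gradient at a point, as a continuous linear map. -/
def defGradL {x : E3} (hx : x ∈ closure S.B) : Q →L[ℝ] (E3 →L[ℝ] E3) :=
  LinearMap.mkContinuous
    { toFun := fun ζ => C.defGrad ζ x
      map_add' := fun a b => C.defGrad_eq hx (by
        rw [map_add]; exact (C.hasFDerivWithinAt_ev a hx).add (C.hasFDerivWithinAt_ev b hx))
      map_smul' := fun a b => C.defGrad_eq hx (by
        rw [map_smul]; exact (C.hasFDerivWithinAt_ev b hx).const_smul a) }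
    C.exists_bound.choose fun ζ => (C.exists_bound.choose_spec.2 ζ x hx).2

lemma defGrad_add {x : E3} (hx : x ∈ closure S.B) (a b : Q) :
    C.defGrad (a + b) x = C.defGrad a x + C.defGrad b x := map_add (C.defGradL hx) a b

lemma defGrad_sub {x : E3} (hx : x ∈ closure S.B) (a b : Q) :
    C.defGrad (a - b) x = C.defGrad a x - C.defGrad b x := map_sub (C.defGradL hx) a b

lemma defGrad_smul {x : E3} (hx : x ∈ closure S.B) (c : ℝ) (b : Q) :
    C.defGrad (c • b) x = c • C.defGrad b x := map_smul (C.defGradL hx) c b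

/-- Stability under rotations extends to all matrices because rotations generate them. Infinitesimal
rotations, such as velocities w × ζ, thus stay in Q. -/
lemma exists_mat (A : E3 →L[ℝ] E3) :
    ∀ ζ : Q, ∃ ζ' : Q, ∀ x ∈ closure S.B, C.ev ζ' x = A (C.ev ζ x) := by
  refine induction_rotation (p := fun A => ∀ ζ : Q, ∃ ζ' : Q, ∀ x ∈ closure S.B,
    C.ev ζ' x = A (C.ev ζ x)) (fun R ζ => C.rotation_stable R ζ) (fun ζ => ⟨ζ, by simp⟩)
    (fun A B hA hB ζ => ?_) (fun c A hA ζ => ?_) (fun A B hA hB ζ => ?_) A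
  · obtain ⟨a, ha⟩ := hA ζ
    obtain ⟨b, hb⟩ := hB ζ
    exact ⟨a + b, fun x hx => by simp [ha x hx, hb x hx]⟩
  · obtain ⟨a, ha⟩ := hA ζ
    exact ⟨c • a, fun x hx => by simp [ha x hx]⟩
  · obtain ⟨b, hb⟩ := hB ζ
    obtain ⟨a, ha⟩ := hA b
    exact ⟨a, fun x hx => by simp [ha x hx, hb x hx]⟩

variable [CompleteSpace Q]

/-- The action of matrices on configurations. -/
def act (A : E3 →L[ℝ] E3) : Q →L[ℝ] Q :=
  have hspec := fun ζ => (C.exists_mat A ζ).choose_spec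
  let f : Q →ₗ[ℝ] Q :=
    { toFun := fun ζ => (C.exists_mat A ζ).choose
      map_add' := fun a b => C.eq_of_ev_eq fun x hx => by
        rw [hspec _ x (subset_closure hx), map_add, map_add, Pi.add_apply, Pi.add_apply,
          hspec _ x (subset_closure hx), hspec _ x (subset_closure hx), map_add]
      map_smul' := fun c b => C.eq_of_ev_eq fun x hx => by
        rw [hspec _ x (subset_closure hx), map_smul, map_smul, Pi.smul_apply, Pi.smul_apply,
          hspec _ x (subset_closure hx), map_smul, RingHom.id_apply] }
  -- No bound is assumed on the action, so continuity comes from the closed graph theorem: point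
  -- evaluations are continuous and separate the elements of the complete space Q.
  ⟨f, f.continuous_of_seq_closed_graph fun u a b hu hfu => C.eq_of_ev_eq fun x hx => by
    have hx' : x ∈ closure S.B := subset_closure hx
    have h1 : Tendsto (fun n => C.evL hx' (f (u n))) atTop (𝓝 (C.evL hx' b)) :=
      ((C.evL hx').continuous.tendsto b).comp hfu
    have h2 : Tendsto (fun n => A (C.evL hx' (u n))) atTop (𝓝 (A (C.evL hx' a))) :=
      ((A.continuous.comp (C.evL hx').continuous).tendsto a).comp hu
    have h3 : ∀ n, C.evL hx' (f (u n)) = A (C.evL hx' (u n)) := fun n => hspec _ x hx'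
    simp only [h3] at h1
    exact (tendsto_nhds_unique h1 h2).trans (hspec _ x hx').symm⟩

lemma ev_act (A : E3 →L[ℝ] E3) (ζ : Q) {x : E3} (hx : x ∈ closure S.B) :
    C.ev (C.act A ζ) x = A (C.ev ζ x) := (C.exists_mat A ζ).choose_spec x hx

lemma defGrad_act (A : E3 →L[ℝ] E3) (ζ : Q) {x : E3} (hx : x ∈ closure S.B) :
    C.defGrad (C.act A ζ) x = A ∘L C.defGrad ζ x := by
  refine C.defGrad_eq hx ?_
  exact (A.hasFDerivAt.comp_hasFDerivWithinAt x (C.hasFDerivWithinAt_ev ζ hx)).congr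
    (fun z hz => C.ev_act A ζ hz) (C.ev_act A ζ hx)

lemma act_mul (A B : E3 →L[ℝ] E3) (ζ : Q) : C.act (A * B) ζ = C.act A (C.act B ζ) :=
  C.eq_of_ev_eq fun x hx => by simp [C.ev_act _ _ (subset_closure hx)]

@[simp] lemma act_one (ζ : Q) : C.act 1 ζ = ζ :=
  C.eq_of_ev_eq fun x hx => by simp [C.ev_act _ _ (subset_closure hx)]

lemma rot_eq_act (R : Rotation) (ζ : Q) : C.rot R ζ = C.act R.clm ζ :=
  C.eq_of_ev_eq fun x hx => by
    rw [C.ev_act _ _ (subset_closure hx)]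
    exact (C.rotation_stable R ζ).choose_spec x (subset_closure hx)

/-- The orbit map of a configuration, as a continuous linear map on matrices. -/
def orbitL (ζ : Q) : (E3 →L[ℝ] E3) →L[ℝ] Q :=
  LinearMap.toContinuousLinearMap
    { toFun := fun A => C.act A ζ
      map_add' := fun A B => C.eq_of_ev_eq fun x hx => by simp [C.ev_act _ _ (subset_closure hx)]
      map_smul' := fun c A => C.eq_of_ev_eq fun x hx => by simp [C.ev_act _ _ (subset_closure hx)] }

@[simp] lemma orbitL_apply (ζ : Q) (A : E3 →L[ℝ] E3) : C.orbitL ζ A = C.act A ζ := rfl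

/-- The diagonal action of matrices on states. -/
def actState (A : E3 →L[ℝ] E3) : (Q × Q) →L[ℝ] (Q × Q) := (C.act A).prodMap (C.act A)

@[simp] lemma actState_fst (A : E3 →L[ℝ] E3) (z : Q × Q) : (C.actState A z).1 = C.act A z.1 := rfl

@[simp] lemma actState_snd (A : E3 →L[ℝ] E3) (z : Q × Q) : (C.actState A z).2 = C.act A z.2 := rfl

lemma rotState_eq (R : Rotation) (z : Q × Q) : C.rotState R z = C.actState R.clm z :=
  Prod.ext (C.rot_eq_act R z.1) (C.rot_eq_act R z.2)

@[simp] lemma actState_one (z : Q × Q) : C.actState 1 z = z := by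
  apply Prod.ext <;> simp

lemma actState_mul (A B : E3 →L[ℝ] E3) (z : Q × Q) :
    C.actState (A * B) z = C.actState A (C.actState B z) := by
  apply Prod.ext <;> simp [act_mul]

/-- The orbit map of a state. -/
def orbitStateL (z : Q × Q) : (E3 →L[ℝ] E3) →L[ℝ] (Q × Q) := (C.orbitL z.1).prod (C.orbitL z.2)

end ConfigSpace

end ElasticSatellite
end

noncomputable section

namespace ElasticSatellite

/-! ### The divergence theorem for tangential fields -/

/-- The divergence of a vector field. -/
def dvg (X : E3 → E3) (x : E3) : ℝ := ∑ a, fderiv ℝ X x (EuclideanSpace.single a 1) a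

lemma continuousOn_dvg {X : E3 → E3} {s : Set E3} (hX : ContinuousOn (fderiv ℝ X) s) :
    ContinuousOn (dvg X) s := by
  refine continuousOn_finsetSum _ fun a _ => ?_
  exact (EuclideanSpace.proj a : E3 →L[ℝ] ℝ).continuous.comp_continuousOn
    (hX.clm_apply continuousOn_const)

lemma dvg_smul {ψ : E3 → ℝ} {X : E3 → E3} {x : E3} (hψ : DifferentiableAt ℝ ψ x)
    (hX : DifferentiableAt ℝ X x) :
    dvg (fun z => ψ z • X z) x = ψ x * dvg X x + fderiv ℝ ψ x (X x) := by
  have hx : X x = X x 0 • EuclideanSpace.single 0 (1 : ℝ) + X x 1 • EuclideanSpace.single 1 (1 : ℝ)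
      + X x 2 • EuclideanSpace.single 2 (1 : ℝ) := by
    apply ext3 <;> simp
  conv_rhs => enter [2]; rw [hx]
  simp only [dvg, fderiv_fun_smul hψ hX, Fin.sum_univ_three, map_add, map_smul]
  simp
  ring

lemma integral_dvg_eq_zero {Y : E3 → E3} (hY : ContDiff ℝ 1 Y) (hc : HasCompactSupport Y) :
    Integrable (dvg Y) ∧ ∫ x, dvg Y x = 0 := by
  have hc' : HasCompactSupport (fderiv ℝ Y) := hc.fderiv ℝ
  have hcont : Continuous (fderiv ℝ Y) := hY.continuous_fderiv (by norm_num)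
  have hi : ∀ a : Fin 3, Integrable (fun x => fderiv ℝ Y x (EuclideanSpace.single a 1)) := fun a =>
    (hcont.clm_apply continuous_const).integrable_of_hasCompactSupport
      (hc'.mono fun x hx h => hx (by simp [h]))
  have hi' : ∀ a : Fin 3, Integrable (fun x => fderiv ℝ Y x (EuclideanSpace.single a 1) a) := fun a =>
    (EuclideanSpace.proj a : E3 →L[ℝ] ℝ).integrable_comp (hi a)
  refine ⟨integrable_finsetSum _ fun a _ => hi' a, ?_⟩
  unfold dvg
  rw [integral_finsetSum _ fun a _ => hi' a]
  refine Finset.sum_eq_zero fun a _ => ?_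
  have h0 : ∫ x, fderiv ℝ Y x (EuclideanSpace.single a 1) = 0 := by
    have := integral_smul_fderiv_eq_neg_fderiv_smul_of_integrable (μ := volume) (𝕜 := ℝ)
      (f := fun _ : E3 => (1 : ℝ)) (g := Y) (v := EuclideanSpace.single a (1 : ℝ)) (by simp)
      (by simpa using hi a)
      (by simpa using hY.continuous.integrable_of_hasCompactSupport hc)
      (fun x _ => differentiableAt_const _) (fun x _ => (hY.differentiable (by norm_num)) x)
    simpa using this
  have := (EuclideanSpace.proj a : E3 →L[ℝ] ℝ).integral_comp_comm (hi a)
  rw [h0, map_zero] at this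
  exact this

namespace Body

variable {S : Body} {X : E3 → E3}

lemma contDiffAt_of_contDiffOn {n : WithTop ℕ∞} {F : Type*} [NormedAddCommGroup F] [NormedSpace ℝ F]
    {f : E3 → F} (hf : ContDiffOn ℝ n f (closure S.B)) {x : E3} (hx : x ∈ S.B) :
    ContDiffAt ℝ n f x := hf.contDiffAt (S.closure_mem_nhds hx)

lemma exists_bound_fderiv {F : Type*} [NormedAddCommGroup F] [NormedSpace ℝ F] {f : E3 → F}
    (hf : ContDiffOn ℝ 1 f (closure S.B)) :
    ∃ c, ∀ x ∈ S.B, ‖f x‖ ≤ c ∧ ‖fderiv ℝ f x‖ ≤ c := by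
  have h1 : ContinuousOn (fderivWithin ℝ f (closure S.B)) (closure S.B) :=
    hf.continuousOn_fderivWithin S.uniqueDiffOn_closure (by norm_num)
  obtain ⟨c, hc⟩ := S.isCompact_closure.exists_bound_of_continuousOn h1
  obtain ⟨c', hc'⟩ := S.isCompact_closure.exists_bound_of_continuousOn hf.continuousOn
  refine ⟨max c c', fun x hx => ⟨(hc' x (subset_closure hx)).trans (le_max_right _ _), ?_⟩⟩
  rw [← fderivWithin_of_mem_nhds (S.closure_mem_nhds hx)]
  exact (hc x (subset_closure hx)).trans (le_max_left _ _)

lemma continuousOn_fderiv {F : Type*} [NormedAddCommGroup F] [NormedSpace ℝ F] {f : E3 → F}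
    (hf : ContDiffOn ℝ 1 f (closure S.B)) : ContinuousOn (fderiv ℝ f) S.B :=
  (hf.mono subset_closure).continuousOn_fderiv_of_isOpen S.isOpen (by norm_num)

lemma integrableOn_of_bound {F : Type*} [NormedAddCommGroup F] {f : E3 → F}
    (hf : ContinuousOn f S.B) {c : ℝ} (hc : ∀ x ∈ S.B, ‖f x‖ ≤ c) : IntegrableOn f S.B :=
  IntegrableOn.of_bound S.volume_lt_top (hf.aestronglyMeasurable S.measurableSet) c
    ((ae_restrict_iff' S.measurableSet).2 (Eventually.of_forall hc))

lemma exists_bound_dvg (hX : ContDiffOn ℝ 1 X (closure S.B)) : ∃ c, ∀ x ∈ S.B, ‖dvg X x‖ ≤ c := by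
  obtain ⟨c, hc⟩ := exists_bound_fderiv hX
  refine ⟨∑ _a : Fin 3, c, fun x hx => (norm_sum_le _ _).trans (Finset.sum_le_sum fun a _ => ?_)⟩
  calc _ ≤ ‖fderiv ℝ X x (EuclideanSpace.single a 1)‖ := PiLp.norm_apply_le _ a
    _ ≤ ‖fderiv ℝ X x‖ * ‖EuclideanSpace.single a (1 : ℝ)‖ := ContinuousLinearMap.le_opNorm _ _
    _ ≤ c := by rw [PiLp.norm_single]; simpa using (hc x hx).2

/-- ψ X, which vanishes off the compact set F inside the body, is a compactly supported C¹ field on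
the whole space, so its divergence has zero integral and no boundary term appears. -/
lemma integral_cutoff {F : Set E3} (hF : IsCompact F) (hFB : F ⊆ S.B) {ψ : E3 → ℝ}
    (h0 : ∀ x ∉ F, ψ x = 0) (hψ : ∀ x ∈ F, ContDiffAt ℝ 1 ψ x)
    (hX : ContDiffOn ℝ 1 X (closure S.B)) :
    IntegrableOn (fun x => ψ x * dvg X x + fderiv ℝ ψ x (X x)) S.B ∧
      ∫ x in S.B, (ψ x * dvg X x + fderiv ℝ ψ x (X x)) = 0 := by
  have hev : ∀ x ∉ F, (fun z => ψ z • X z) =ᶠ[𝓝 x] fun _ => 0 := fun x hx => by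
    filter_upwards [hF.isClosed.isOpen_compl.mem_nhds hx] with z hz
    simp [h0 z hz]
  have hevψ : ∀ x ∉ F, ψ =ᶠ[𝓝 x] fun _ => 0 := fun x hx => by
    filter_upwards [hF.isClosed.isOpen_compl.mem_nhds hx] with z hz
    exact h0 z hz
  have hY : ContDiff ℝ 1 (fun z => ψ z • X z) := by
    rw [contDiff_iff_contDiffAt]
    intro x
    by_cases hx : x ∈ F
    · exact (hψ x hx).smul (contDiffAt_of_contDiffOn hX (hFB hx))
    · exact contDiffAt_const.congr_of_eventuallyEq (hev x hx)
  have hc : HasCompactSupport (fun z => ψ z • X z) :=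
    HasCompactSupport.intro hF fun x hx => by simp [h0 x hx]
  obtain ⟨hi, hz⟩ := integral_dvg_eq_zero hY hc
  have heq : ∀ x ∈ S.B, dvg (fun z => ψ z • X z) x = ψ x * dvg X x + fderiv ℝ ψ x (X x) := by
    intro x hx
    refine dvg_smul ?_ ((contDiffAt_of_contDiffOn hX hx).differentiableAt (by norm_num))
    by_cases hxF : x ∈ F
    · exact (hψ x hxF).differentiableAt (by norm_num)
    · exact (differentiableAt_const _).congr_of_eventuallyEq (hevψ x hxF)
  refine ⟨(hi.integrableOn).congr_fun heq S.measurableSet, ?_⟩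
  rw [← setIntegral_congr_fun S.measurableSet heq, setIntegral_eq_integral_of_forall_compl_eq_zero,
    hz]
  intro x hx
  have : fderiv ℝ (fun z => ψ z • X z) x = 0 := by
    rw [(hev x fun h => hx (hFB h)).fderiv_eq]; simp
  simp [dvg, this]

/-- A cutoff function, equal to `1` below `-2` and to `0` above `-1`. -/
def lowCut (s : ℝ) : ℝ := Real.smoothTransition (-s - 1)

lemma lowCut_eq_zero {s : ℝ} (h : -1 ≤ s) : lowCut s = 0 :=
  Real.smoothTransition.zero_of_nonpos (by linarith)

lemma lowCut_eq_one {s : ℝ} (h : s ≤ -2) : lowCut s = 1 :=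
  Real.smoothTransition.one_of_one_le (by linarith)

lemma contDiff_lowCut : ContDiff ℝ 1 lowCut :=
  (Real.smoothTransition.contDiff (n := 1)).comp (by fun_prop)

lemma lowCut_mem (s : ℝ) : ‖lowCut s‖ ≤ 1 := by
  rw [lowCut, Real.norm_of_nonneg (Real.smoothTransition.nonneg _)]
  exact Real.smoothTransition.le_one _

lemma deriv_lowCut_nonpos (s : ℝ) : deriv lowCut s ≤ 0 := by
  have : Antitone lowCut := fun a b hab => Real.smoothTransition.monotone (by linarith)
  exact this.deriv_nonpos

lemma deriv_lowCut_eq_zero {s : ℝ} (h : s < -2) : deriv lowCut s = 0 := by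
  have : lowCut =ᶠ[𝓝 s] fun _ => 1 := by
    filter_upwards [Iio_mem_nhds h] with z hz
    exact lowCut_eq_one (le_of_lt hz)
  rw [this.deriv_eq, deriv_const]

/-- The weak divergence theorem for test functions supported near an interior point. -/
lemma integral_test_interior (hX : ContDiffOn ℝ 1 X (closure S.B)) {φ : E3 → ℝ}
    (hφ : ContDiff ℝ 1 φ) (hc : HasCompactSupport φ) (hs : tsupport φ ⊆ S.B) :
    ∫ x in S.B, (φ x * dvg X x + fderiv ℝ φ x (X x)) = 0 :=
  (integral_cutoff hc hs (fun _ hx => image_eq_zero_of_notMem_tsupport hx)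
    (fun _ _ => hφ.contDiffAt) hX).2

section Boundary

variable {U : Set E3} {g : E3 → ℝ}

/-- φ is cut off by a function that vanishes where g ≥ -ε, so the product is supported inside the
body. The price is a term with lowCut' (g / ε) / ε, concentrated on the boundary layer -2ε ≤ g ≤ -ε.
-/
lemma integral_test_chart (hU : IsOpen U) (hg : ContDiffOn ℝ 1 g U)
    (hB : S.B ∩ U = {z ∈ U | g z < 0}) {φ : E3 → ℝ} (hφ : ContDiff ℝ 1 φ)
    (hc : HasCompactSupport φ) (hs : tsupport φ ⊆ U) (hX : ContDiffOn ℝ 1 X (closure S.B))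
    {ε : ℝ} (hε : 0 < ε) :
    IntegrableOn (fun x => lowCut (g x / ε) * (φ x * dvg X x + fderiv ℝ φ x (X x))
      + φ x * (deriv lowCut (g x / ε) / ε * fderiv ℝ g x (X x))) S.B ∧
    ∫ x in S.B, (lowCut (g x / ε) * (φ x * dvg X x + fderiv ℝ φ x (X x))
      + φ x * (deriv lowCut (g x / ε) / ε * fderiv ℝ g x (X x))) = 0 := by
  set F : Set E3 := {x ∈ tsupport φ | g x ≤ -ε} with hF
  have hFc : IsCompact F := by
    have : IsClosed F :=
      (hg.continuousOn.mono hs).preimage_isClosed_of_isClosed (isClosed_tsupport φ) isClosed_Iic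
    exact hc.of_isClosed_subset this fun x hx => hx.1
  have hFB : F ⊆ S.B := fun x hx => by
    have : x ∈ S.B ∩ U := by rw [hB]; exact ⟨hs hx.1, by linarith [hx.2]⟩
    exact this.1
  have h0 : ∀ x ∉ F, φ x * lowCut (g x / ε) = 0 := fun x hx => by
    by_cases hxs : x ∈ tsupport φ
    · have h1 : -ε < g x := not_le.1 fun h => hx ⟨hxs, h⟩
      rw [lowCut_eq_zero (by rw [le_div_iff₀ hε]; linarith), mul_zero]
    · rw [image_eq_zero_of_notMem_tsupport hxs, zero_mul]
  have hgd : ∀ x ∈ U, ContDiffAt ℝ 1 g x := fun x hx => hg.contDiffAt (hU.mem_nhds hx)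
  have hη : ∀ x ∈ U, ContDiffAt ℝ 1 (fun z => lowCut (g z / ε)) x := fun x hx =>
    contDiff_lowCut.contDiffAt.comp x ((hgd x hx).div_const ε)
  have hder : ∀ x ∈ U, HasFDerivAt (fun z => lowCut (g z / ε))
      ((deriv lowCut (g x / ε)) • (ε⁻¹ • fderiv ℝ g x)) x := fun x hx => by
    have h1 : HasFDerivAt (fun z => g z / ε) (ε⁻¹ • fderiv ℝ g x) x := by
      simp only [div_eq_mul_inv]
      exact ((hgd x hx).differentiableAt (by norm_num)).hasFDerivAt.mul_const ε⁻¹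
    exact ((contDiff_lowCut.differentiable (by norm_num)) _).hasDerivAt.comp_hasFDerivAt x h1
  have h := integral_cutoff hFc hFB h0
    (fun x hx => hφ.contDiffAt.mul (hη x (hs hx.1))) hX
  have heq : ∀ x, φ x * lowCut (g x / ε) * dvg X x +
      fderiv ℝ (fun x => φ x * lowCut (g x / ε)) x (X x) =
      lowCut (g x / ε) * (φ x * dvg X x + fderiv ℝ φ x (X x))
      + φ x * (deriv lowCut (g x / ε) / ε * fderiv ℝ g x (X x)) := by
    intro x
    by_cases hxs : x ∈ tsupport φ
    · have := (((hφ.differentiable (by norm_num)) x).hasFDerivAt.mul (hder x (hs hxs))).fderiv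
      rw [show (fun x => φ x * lowCut (g x / ε)) = φ * (fun x => lowCut (g x / ε)) from rfl, this]
      simp
      ring
    · have h1 : φ =ᶠ[𝓝 x] fun _ => 0 := by
        rw [notMem_tsupport_iff_eventuallyEq] at hxs; exact hxs
      have h2 : (fun x => φ x * lowCut (g x / ε)) =ᶠ[𝓝 x] fun _ => 0 := by
        filter_upwards [h1] with z hz; simp [hz]
      rw [h2.fderiv_eq, h1.fderiv_eq, h1.self_of_nhds]
      simp
  simpa only [heq] using h

/-- The weak divergence theorem for test functions supported in a boundary chart. -/
lemma integral_test_boundary {x₀ n : E3} {m r R : ℝ} (hr : 0 < r) (hrR : r < R)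
    (hU : IsOpen U) (hball : Metric.closedBall x₀ R ⊆ U) (hg : ContDiffOn ℝ 1 g U)
    (hB : S.B ∩ U = {z ∈ U | g z < 0}) (hm : 0 < m) (hn : ∀ x ∈ U, m ≤ fderiv ℝ g x n)
    (hX : ContDiffOn ℝ 1 X (closure S.B)) (htan : ∀ x ∈ frontier S.B ∩ U, fderiv ℝ g x (X x) = 0)
    {φ : E3 → ℝ} (hφ : ContDiff ℝ 1 φ) (hs : tsupport φ ⊆ Metric.ball x₀ r) :
    ∫ x in S.B, (φ x * dvg X x + fderiv ℝ φ x (X x)) = 0 := by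
  have hc : HasCompactSupport φ :=
    (isCompact_closedBall x₀ r).of_isClosed_subset (isClosed_tsupport φ)
      (hs.trans Metric.ball_subset_closedBall)
  have hsU : tsupport φ ⊆ U := (hs.trans (Metric.ball_subset_closedBall.trans
    (Metric.closedBall_subset_closedBall hrR.le))).trans hball
  let χ : ContDiffBump x₀ := ⟨r, R, hr, hrR⟩
  have hχs : tsupport χ ⊆ U := by rw [χ.tsupport_eq]; exact hball
  have hχ1 : ∀ x ∈ tsupport φ, χ x = 1 := fun x hx =>
    χ.one_of_mem_closedBall (Metric.ball_subset_closedBall (hs hx))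
  have hχd : ContDiff ℝ 1 χ := χ.contDiff
  obtain ⟨M, hM⟩ := hc.exists_bound_of_continuous hφ.continuous
  have hM0 : 0 ≤ M := (norm_nonneg _).trans (hM x₀)
  obtain ⟨c, hcX⟩ := exists_bound_fderiv hX
  obtain ⟨c', hcX'⟩ := exists_bound_dvg hX
  set h : E3 → ℝ := fun x => φ x * dvg X x + fderiv ℝ φ x (X x) with hh
  have hhc : ContinuousOn h S.B :=
    (hφ.continuous.continuousOn.mul (continuousOn_dvg (continuousOn_fderiv hX))).add
      ((hφ.continuous_fderiv (by norm_num)).continuousOn.clm_apply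
        (hX.continuousOn.mono subset_closure))
  obtain ⟨D, hD⟩ := (hc.fderiv ℝ).exists_bound_of_continuous (hφ.continuous_fderiv (by norm_num))
  have hhb : ∀ x ∈ S.B, ‖h x‖ ≤ M * c' + D * c := fun x hx => by
    refine (norm_add_le _ _).trans (add_le_add ?_ ?_)
    · rw [norm_mul]
      exact mul_le_mul (hM x) (hcX' x hx) (norm_nonneg _) hM0
    · refine (ContinuousLinearMap.le_opNorm _ _).trans ?_
      exact mul_le_mul (hD x) (hcX x hx).1 (norm_nonneg _) ((norm_nonneg _).trans (hD x))
  have hh0 : ∀ x ∉ tsupport φ, h x = 0 := fun x hx => by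
    have h1 : φ =ᶠ[𝓝 x] fun _ => 0 := by
      rw [notMem_tsupport_iff_eventuallyEq] at hx; exact hx
    simp [hh, h1.self_of_nhds, h1.fderiv_eq]
  have hint : IntegrableOn h S.B := integrableOn_of_bound hhc hhb
  have hcutmeas : ∀ ε : ℝ, 0 < ε → ContinuousOn (fun x => lowCut (g x / ε) * h x) S.B := by
    intro ε hε x hx
    by_cases hxs : x ∈ tsupport φ
    · refine ContinuousWithinAt.mul ?_ (hhc x hx)
      exact (contDiff_lowCut.continuous.continuousAt.comp
        ((hg.continuousOn.continuousAt (hU.mem_nhds (hsU hxs))).div_const ε)).continuousWithinAt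
    · have : (fun x => lowCut (g x / ε) * h x) =ᶠ[𝓝 x] fun _ => 0 := by
        filter_upwards [(isClosed_tsupport φ).isOpen_compl.mem_nhds hxs] with z hz
        rw [hh0 z hz, mul_zero]
      exact (continuousAt_const.congr this.symm).continuousWithinAt
  have hlim : Tendsto (fun ε : ℝ => ∫ x in S.B, lowCut (g x / ε) * h x) (𝓝[>] 0)
      (𝓝 (∫ x in S.B, h x)) := by
    refine tendsto_integral_filter_of_dominated_convergence (fun x => ‖h x‖) ?_ ?_ hint.norm ?_
    · filter_upwards [self_mem_nhdsWithin] with ε hε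
      exact (hcutmeas ε hε).aestronglyMeasurable S.measurableSet
    · refine Eventually.of_forall fun ε => Eventually.of_forall fun x => ?_
      rw [norm_mul]
      exact mul_le_of_le_one_left (norm_nonneg _) (lowCut_mem _)
    · refine (ae_restrict_iff' S.measurableSet).2 (Eventually.of_forall fun x hx => ?_)
      by_cases hxs : x ∈ tsupport φ
      · have hgx : g x < 0 := by
          have : x ∈ {z ∈ U | g z < 0} := hB ▸ ⟨hx, hsU hxs⟩
          exact this.2
        refine tendsto_const_nhds.congr' ?_
        filter_upwards [Ioo_mem_nhdsGT (show (0 : ℝ) < -g x / 2 by linarith)] with ε hε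
        rw [lowCut_eq_one, one_mul]
        rw [div_le_iff₀ hε.1]; linarith [hε.2]
      · rw [hh0 x hxs]; simp
  -- the field `n` bounds the mass of the boundary layer
  have hn1 : ContDiffOn ℝ 1 (fun _ : E3 => n) (closure S.B) := contDiffOn_const
  have hdn : ∀ x, dvg (fun _ : E3 => n) x = 0 := fun x => by simp [dvg]
  obtain ⟨D', hD'⟩ := (χ.hasCompactSupport.fderiv ℝ).exists_bound_of_continuous
    (hχd.continuous_fderiv (by norm_num))
  set layer : ℝ → E3 → ℝ := fun ε x =>
    χ x * (-(deriv lowCut (g x / ε)) / ε * fderiv ℝ g x n) with hlayer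
  have hχint : IntegrableOn (fun x => fderiv ℝ χ x n) S.B :=
    integrableOn_of_bound (c := D' * ‖n‖)
      ((hχd.continuous_fderiv (by norm_num)).clm_apply continuous_const).continuousOn
      fun x _ => (ContinuousLinearMap.le_opNorm _ _).trans (by gcongr; exact hD' x)
  -- For the constant field n the chart identity equates the layer integral with that of lowCut (g /
  -- ε) times the derivative of χ along n, which is bounded independently of ε. As ∂g/∂n ≥ m > 0,
  -- the layer has bounded mass.
  have hlayer_int : ∀ ε : ℝ, 0 < ε → IntegrableOn (layer ε) S.B ∧
      ∫ x in S.B, layer ε x ≤ ∫ x in S.B, ‖fderiv ℝ χ x n‖ := by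
    intro ε hε
    obtain ⟨i1, i2⟩ := integral_test_chart hU hg hB hχd χ.hasCompactSupport hχs hn1 hε
    simp only [hdn, mul_zero, zero_add] at i1 i2
    have hcm : ContinuousOn (fun x => lowCut (g x / ε) * fderiv ℝ χ x n) S.B := by
      intro x hx
      by_cases hxs : x ∈ tsupport χ
      · refine ContinuousWithinAt.mul ?_
          ((hχd.continuous_fderiv (by norm_num)).clm_apply continuous_const).continuousWithinAt
        exact (contDiff_lowCut.continuous.continuousAt.comp
          ((hg.continuousOn.continuousAt (hU.mem_nhds (hχs hxs))).div_const ε)).continuousWithinAt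
      · have : (fun x => lowCut (g x / ε) * fderiv ℝ χ x n) =ᶠ[𝓝 x] fun _ => 0 := by
          filter_upwards [(isClosed_tsupport χ).isOpen_compl.mem_nhds hxs] with z hz
          have h1 : (χ : E3 → ℝ) =ᶠ[𝓝 z] fun _ => 0 := by
            have hz : z ∉ tsupport χ := hz
            rw [notMem_tsupport_iff_eventuallyEq] at hz; exact hz
          rw [h1.fderiv_eq]; simp
        exact (continuousAt_const.congr this.symm).continuousWithinAt
    have i3 : IntegrableOn (fun x => lowCut (g x / ε) * fderiv ℝ χ x n) S.B :=
      Integrable.mono hχint (hcm.aestronglyMeasurable S.measurableSet) (Eventually.of_forall fun x => by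
        rw [norm_mul]; exact mul_le_of_le_one_left (norm_nonneg _) (lowCut_mem _))
    have e : layer ε = fun x => lowCut (g x / ε) * fderiv ℝ χ x n -
        (lowCut (g x / ε) * fderiv ℝ χ x n +
          χ x * (deriv lowCut (g x / ε) / ε * fderiv ℝ g x n)) := by
      ext x; simp only [hlayer]; ring
    rw [e]
    refine ⟨i3.sub i1, ?_⟩
    rw [integral_sub i3 i1, i2, sub_zero]
    refine (Real.le_norm_self _).trans (norm_integral_le_of_norm_le hχint.norm ?_)
    exact Eventually.of_forall fun x => by
      rw [norm_mul]; exact mul_le_of_le_one_left (norm_nonneg _) (lowCut_mem _)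
  set K := ∫ x in S.B, ‖fderiv ℝ χ x n‖ with hK
  have hK0 : 0 ≤ K := integral_nonneg fun x => norm_nonneg _
  have key : ∀ α > 0, ‖∫ x in S.B, h x‖ ≤ M * α / m * K := by
    intro α hα
    -- Tangency makes dg(X) vanish on the boundary. The compact set where |dg(X)| ≥ α therefore lies
    -- in g < 0, hence at g bounded away from 0. The layer term is then at most a constant times α,
    -- for every α > 0.
    obtain ⟨δ, hδ, hsmall⟩ : ∃ δ > 0, ∀ x ∈ S.B ∩ tsupport φ, -δ ≤ g x →
        ‖fderiv ℝ g x (X x)‖ ≤ α := by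
      set Kc : Set E3 := closure S.B ∩ tsupport φ with hKc
      have hKcomp : IsCompact Kc := hc.inter_left isClosed_closure
      have hcont : ContinuousOn (fun x => fderiv ℝ g x (X x)) Kc :=
        ((hg.continuousOn_fderiv_of_isOpen hU (by norm_num)).mono
          (inter_subset_right.trans hsU)).clm_apply (hX.continuousOn.mono inter_subset_left)
      set Z : Set E3 := {x ∈ Kc | α ≤ ‖fderiv ℝ g x (X x)‖} with hZ
      have hZc : IsCompact Z :=
        hKcomp.of_isClosed_subset
          (hcont.norm.preimage_isClosed_of_isClosed hKcomp.isClosed isClosed_Ici) fun x hx => hx.1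
      have hneg : ∀ x ∈ Z, g x < 0 := by
        intro x hx
        by_cases hxB : x ∈ S.B
        · have : x ∈ {z ∈ U | g z < 0} := hB ▸ ⟨hxB, hsU hx.1.2⟩
          exact this.2
        · have := htan x ⟨⟨hx.1.1, by rwa [S.isOpen.interior_eq]⟩, hsU hx.1.2⟩
          have h2 := hx.2
          rw [this, norm_zero] at h2
          linarith
      rcases Z.eq_empty_or_nonempty with he | hne
      · refine ⟨1, one_pos, fun x hx _ => ?_⟩
        by_contra! hlt
        have : x ∈ Z := ⟨⟨subset_closure hx.1, hx.2⟩, hlt.le⟩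
        rw [he] at this
        exact this
      · obtain ⟨z, hz, hmax⟩ := hZc.exists_isMaxOn hne
          (hg.continuousOn.mono fun x hx => hsU hx.1.2)
        refine ⟨-g z / 2, by linarith [hneg z hz], fun x hx hgx => ?_⟩
        by_contra! hlt
        have h1 : g x ≤ g z := hmax (show x ∈ Z from ⟨⟨subset_closure hx.1, hx.2⟩, hlt.le⟩)
        linarith [hneg z hz]
    have hbound : ∀ᶠ ε : ℝ in 𝓝[>] 0, ‖∫ x in S.B, lowCut (g x / ε) * h x‖ ≤ M * α / m * K := by
      filter_upwards [Ioo_mem_nhdsGT (show (0 : ℝ) < δ / 2 by linarith)] with ε hε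
      obtain ⟨i1, i2⟩ := integral_test_chart hU hg hB hφ hc hsU hX hε.1
      have i3 : IntegrableOn (fun x => lowCut (g x / ε) * h x) S.B :=
        integrableOn_of_bound (hcutmeas ε hε.1) (c := M * c' + D * c) fun x hx => by
          rw [norm_mul]
          exact (mul_le_of_le_one_left (norm_nonneg _) (lowCut_mem _)).trans (hhb x hx)
      have e : ∫ x in S.B, lowCut (g x / ε) * h x =
          ∫ x in S.B, -(φ x * (deriv lowCut (g x / ε) / ε * fderiv ℝ g x (X x))) := by
        have := integral_sub i3 i1
        rw [i2, sub_zero] at this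
        rw [← this]
        congr 1
        ext x
        simp only [hh]; ring
      rw [e]
      have hle : ∫ x in S.B, M * α / m * layer ε x ≤ M * α / m * K := by
        rw [integral_const_mul]
        exact mul_le_mul_of_nonneg_left (hlayer_int ε hε.1).2 (by positivity)
      refine (norm_integral_le_of_norm_le ((hlayer_int ε hε.1).1.const_mul (M * α / m)) ?_).trans hle
      refine (ae_restrict_iff' S.measurableSet).2 (Eventually.of_forall fun x hx => ?_)
      have hdn0 : 0 ≤ -(deriv lowCut (g x / ε)) / ε :=
        div_nonneg (by linarith [deriv_lowCut_nonpos (g x / ε)]) hε.1.le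
      by_cases hxs : x ∈ tsupport φ
      · by_cases hlt : g x / ε < -2
        · simp [hlayer, deriv_lowCut_eq_zero hlt]
        · have hgx : -δ ≤ g x := by
            rw [not_lt, le_div_iff₀ hε.1] at hlt
            linarith [hε.2]
          have h1 := hsmall x ⟨hx, hxs⟩ hgx
          have h2 := hn x (hsU hxs)
          simp only [hlayer, hχ1 x hxs, one_mul]
          rw [norm_neg, norm_mul, norm_mul, norm_div, Real.norm_of_nonneg hε.1.le]
          have h3 : ‖deriv lowCut (g x / ε)‖ / ε = -(deriv lowCut (g x / ε)) / ε := by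
            rw [Real.norm_of_nonpos (deriv_lowCut_nonpos _)]
          rw [h3]
          set q := -(deriv lowCut (g x / ε)) / ε
          calc ‖φ x‖ * (q * ‖fderiv ℝ g x (X x)‖) ≤ M * (q * α) :=
                mul_le_mul (hM x) (mul_le_mul_of_nonneg_left h1 hdn0) (by positivity) hM0
            _ = M * α / m * (q * m) := by field_simp
            _ ≤ M * α / m * (q * fderiv ℝ g x n) := by gcongr
      · have h0 : φ x = 0 := image_eq_zero_of_notMem_tsupport hxs
        rw [h0, zero_mul, neg_zero, norm_zero]
        by_cases hxχ : x ∈ tsupport χ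
        · have := hn x (hχs hxχ)
          have h4 : 0 ≤ χ x := χ.nonneg
          have h5 : 0 ≤ fderiv ℝ g x n := hm.le.trans this
          simp only [hlayer]
          positivity
        · simp [hlayer, image_eq_zero_of_notMem_tsupport hxχ]
    exact le_of_tendsto hlim.norm hbound
  have hfin : Tendsto (fun α : ℝ => M * α / m * K) (𝓝[>] 0) (𝓝 0) := by
    have : Continuous fun α : ℝ => M * α / m * K := by fun_prop
    simpa using (this.tendsto 0).mono_left nhdsWithin_le_nhds
  have : ‖∫ x in S.B, h x‖ ≤ 0 :=
    ge_of_tendsto hfin (by filter_upwards [self_mem_nhdsWithin] with α hα using key α hα)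
  exact norm_le_zero_iff.1 this

end Boundary

/-- At a boundary point n is the unnormalized gradient of g; by continuity ∂g/∂n stays above |n|² /
2 on a smaller chart, which is the transversality that the boundary layer estimate needs. -/
lemma exists_ball_integral_test (hX : ContDiffOn ℝ 1 X (closure S.B))
    (htan : ∀ x ∈ frontier S.B, ∀ n, IsOuterNormal S.B x n → inner ℝ n (X x) = 0)
    {x₀ : E3} (hx₀ : x₀ ∈ closure S.B) :
    ∃ r > 0, ∀ φ : E3 → ℝ, ContDiff ℝ 1 φ → tsupport φ ⊆ Metric.ball x₀ r →
      ∫ x in S.B, (φ x * dvg X x + fderiv ℝ φ x (X x)) = 0 := by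
  by_cases hxB : x₀ ∈ S.B
  · obtain ⟨r, hr, hb⟩ := Metric.isOpen_iff.1 S.isOpen x₀ hxB
    exact ⟨r, hr, fun φ hφ hs => integral_test_interior hX hφ
      ((isCompact_closedBall x₀ r).of_isClosed_subset (isClosed_tsupport φ)
        (hs.trans Metric.ball_subset_closedBall)) (hs.trans hb)⟩
  obtain ⟨_, U, g, hU, hxU, hg, hg0, hB, -⟩ := S.smooth_boundary x₀
    ⟨hx₀, by rwa [S.isOpen.interior_eq]⟩
  have hin : ∀ x v, fderiv ℝ g x v = inner ℝ (gradient g x) v := fun x v => by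
    rw [gradient, InnerProductSpace.toDual_symm_apply]
  set n := gradient g x₀ with hn
  have hn0 : 0 < ‖n‖ ^ 2 := by have := norm_pos_iff.2 (hg0 x₀ hxU); positivity
  have hg1 : ContDiffOn ℝ 1 g U := hg.of_le (by norm_cast)
  have hcont : ContinuousOn (fun x => fderiv ℝ g x n) U :=
    (hg1.continuousOn_fderiv_of_isOpen hU (by norm_num)).clm_apply continuousOn_const
  set U' : Set E3 := U ∩ {x | ‖n‖ ^ 2 / 2 < fderiv ℝ g x n} with hU'
  have hU'o : IsOpen U' := hcont.isOpen_inter_preimage hU isOpen_Ioi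
  have hxU' : x₀ ∈ U' := ⟨hxU, by
    rw [mem_ofPred_eq, hin, ← hn, real_inner_self_eq_norm_sq]; linarith⟩
  have hB' : S.B ∩ U' = {z ∈ U' | g z < 0} := by
    ext z
    have : z ∈ S.B ∩ U ↔ z ∈ {z ∈ U | g z < 0} := by rw [hB]
    simp only [hU', mem_inter_iff, mem_ofPred_eq] at this ⊢
    tauto
  obtain ⟨R, hR, hb⟩ := Metric.nhds_basis_closedBall.mem_iff.1 (hU'o.mem_nhds hxU')
  refine ⟨R / 2, by positivity, fun φ hφ hs => integral_test_boundary (m := ‖n‖ ^ 2 / 2)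
    (by positivity) (half_lt_self hR) hU'o hb (hg1.mono inter_subset_left) hB' (by positivity)
    (fun x hx => le_of_lt hx.2) hX ?_ hφ hs⟩
  intro x hx
  have h1 := htan x hx.1 _ ⟨U, g, hU, hx.2.1, hg, hg0, hB, rfl⟩
  rw [inner_smul_left] at h1
  rw [hin]
  have h2 : ‖gradient g x‖⁻¹ ≠ 0 := inv_ne_zero (norm_ne_zero_iff.2 (hg0 x hx.2.1))
  exact (mul_eq_zero.1 h1).resolve_left (by simpa using h2)

/-- The divergence theorem for fields which are tangent to the boundary. -/
theorem integral_dvg_of_tangent (hX : ContDiffOn ℝ 1 X (closure S.B))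
    (htan : ∀ x ∈ frontier S.B, ∀ n, IsOuterNormal S.B x n → inner ℝ n (X x) = 0) :
    ∫ x in S.B, dvg X x = 0 := by
  choose! r hr htest using fun x hx => exists_ball_integral_test hX htan (x₀ := x) hx
  obtain ⟨t, htB, hcov⟩ := S.isCompact_closure.elim_nhds_subcover (fun x => Metric.ball x (r x))
    fun x hx => Metric.ball_mem_nhds x (hr x hx)
  obtain ⟨f, hf⟩ := SmoothPartitionOfUnity.exists_isSubordinate (ι := t) (modelWithCornersSelf ℝ E3)
    (isClosed_closure (s := S.B)) (fun i => Metric.ball (i : E3) (r i))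
    (fun i => Metric.isOpen_ball) (fun x hx => by
      obtain ⟨i, hi, hxi⟩ := mem_iUnion₂.1 (hcov hx)
      exact mem_iUnion.2 ⟨⟨i, hi⟩, hxi⟩)
  have hfd : ∀ i, ContDiff ℝ 1 (f i) := fun i =>
    ((f i).contMDiff.contDiff).of_le (by norm_cast)
  have h0 : ∀ i, ∫ x in S.B, (f i x * dvg X x + fderiv ℝ (f i) x (X x)) = 0 := fun i =>
    htest i (htB i i.2) _ (hfd i) (hf i)
  have hsum : ∀ x ∈ S.B, ∑ i, f i x = 1 := fun x hx => by
    rw [← finsum_eq_sum_of_fintype]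
    exact f.sum_eq_one (subset_closure hx)
  -- The partition sums to 1 on the open body, so its derivatives sum to 0. Adding the localized
  -- identities leaves only the divergence of X.
  have hsumd : ∀ x ∈ S.B, ∑ i, fderiv ℝ (f i) x = 0 := fun x hx => by
    have h1 : (fun z => ∑ i, f i z) =ᶠ[𝓝 x] fun _ => 1 := by
      filter_upwards [S.isOpen.mem_nhds hx] with z hz using hsum z hz
    have h2 := h1.fderiv_eq (𝕜 := ℝ)
    rw [fderiv_fun_sum fun i _ => ((hfd i).differentiable (by norm_num)) x] at h2
    simpa using h2
  obtain ⟨c, hcX⟩ := exists_bound_fderiv hX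
  obtain ⟨c', hcX'⟩ := exists_bound_dvg hX
  have hint : ∀ i, IntegrableOn (fun x => f i x * dvg X x + fderiv ℝ (f i) x (X x)) S.B := by
    intro i
    have hi1 := (hfd i).continuous
    have hi2 := (hfd i).continuous_fderiv (by norm_num)
    obtain ⟨a, ha⟩ := S.isCompact_closure.exists_bound_of_continuousOn hi1.continuousOn
    obtain ⟨b, hb⟩ := S.isCompact_closure.exists_bound_of_continuousOn hi2.continuousOn
    refine integrableOn_of_bound ((hi1.continuousOn.mul (continuousOn_dvg (continuousOn_fderiv hX))).add
      (hi2.continuousOn.clm_apply (hX.continuousOn.mono subset_closure))) (c := a * c' + b * c)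
      fun x hx => (norm_add_le _ _).trans (add_le_add ?_ ?_)
    · rw [norm_mul]
      exact mul_le_mul (ha x (subset_closure hx)) (hcX' x hx) (norm_nonneg _)
        ((norm_nonneg _).trans (ha x (subset_closure hx)))
    · refine (ContinuousLinearMap.le_opNorm _ _).trans ?_
      exact mul_le_mul (hb x (subset_closure hx)) (hcX x hx).1 (norm_nonneg _)
        ((norm_nonneg _).trans (hb x (subset_closure hx)))
  have heq : ∀ x ∈ S.B, dvg X x = ∑ i, (f i x * dvg X x + fderiv ℝ (f i) x (X x)) := by
    intro x hx
    rw [Finset.sum_add_distrib, ← Finset.sum_mul, hsum x hx, one_mul]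
    have : ∑ i, fderiv ℝ (f i) x (X x) = (∑ i, fderiv ℝ (f i) x) (X x) := by simp
    rw [this, hsumd x hx]
    simp
  rw [setIntegral_congr_fun S.measurableSet heq, integral_finsetSum _ fun i _ => hint i]
  exact Finset.sum_eq_zero fun i _ => h0 i

end Body

end ElasticSatellite
end

noncomputable section

namespace ElasticSatellite

/-! ### Newtonian kernels -/

/-- The weight `|u|^(-5/2)`, which is infinite at `0`. -/
def wE (u : E3) : ENNReal := ‖u‖ₑ ^ (-(5 / 2) : ℝ)

/-- The real weight `|u|^(-5/2)`. -/
def wt (u : E3) : ℝ := (‖u‖ ^ 2 * √‖u‖)⁻¹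

lemma wt_nonneg (u : E3) : 0 ≤ wt u := by unfold wt; positivity

lemma wE_zero : wE 0 = ⊤ := by
  rw [wE, enorm_zero, ENNReal.zero_rpow_of_neg (by norm_num)]

lemma wt_eq_rpow (u : E3) : wt u = ‖u‖ ^ (-(5 / 2) : ℝ) := by
  rw [wt, Real.rpow_neg (norm_nonneg _)]
  congr 1
  rcases (norm_nonneg u).eq_or_lt with h | h
  · rw [← h, Real.zero_rpow (by norm_num)]; simp
  · rw [Real.sqrt_eq_rpow, ← Real.rpow_natCast, ← Real.rpow_add h]; norm_num

lemma wE_eq_ofReal {u : E3} (hu : u ≠ 0) : wE u = ENNReal.ofReal (wt u) := by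
  rw [wE, wt_eq_rpow, ← ofReal_norm, ENNReal.ofReal_rpow_of_pos (norm_pos_iff.2 hu)]

lemma measurable_wE : Measurable wE := by unfold wE; fun_prop

lemma measurable_wt : Measurable wt := by unfold wt; fun_prop

lemma wE_le_one {u : E3} (hu : 1 ≤ ‖u‖) : wE u ≤ 1 := by
  rw [wE, ENNReal.rpow_neg, ENNReal.inv_le_one]
  have h : (1 : ENNReal) ≤ ‖u‖ₑ := by
    rw [← ofReal_norm, ← ENNReal.ofReal_one]; exact ENNReal.ofReal_le_ofReal hu
  calc (1 : ENNReal) = 1 ^ (5 / 2 : ℝ) := by simp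
    _ ≤ _ := ENNReal.rpow_le_rpow h (by norm_num)

lemma lintegral_wE_ball_lt_top : ∫⁻ u in Metric.ball (0 : E3) 1, wE u < ⊤ := by
  have h : IntegrableOn (fun u : E3 => ‖u‖ ^ (-(5 / 2) : ℝ)) (Metric.ball 0 1) volume :=
    integrableOn_ball_of_norm_le_rpow (C := 1) (α := 5 / 2) (by simp) (by simp; norm_num)
      (Eventually.of_forall fun u => by
        rw [Real.norm_of_nonneg (by positivity), one_mul]) (measurable_norm.pow_const _).aestronglyMeasurable
  have h2 := h.lintegral_lt_top
  refine lt_of_le_of_lt (lintegral_mono_ae ?_) h2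
  have : ∀ᵐ u ∂(volume.restrict (Metric.ball (0 : E3) 1)), u ≠ 0 :=
    ae_restrict_of_ae (compl_mem_ae_iff.2 (measure_singleton (0 : E3)))
  filter_upwards [this] with u hu
  rw [wE_eq_ofReal hu, wt_eq_rpow]

section Kernel

variable {Ω : Type*} [MeasurableSpace Ω] {μ : Measure Ω}

/-- A family of displacements `u` along which the kernel `|u|^(-5/2)` is integrable. -/
structure Tame (μ : Measure Ω) (u : Ω → E3) (M : ℝ) : Prop where
  nonneg : 0 ≤ M
  meas : AEStronglyMeasurable u μ
  bound : ∫⁻ w, wE (u w) ∂μ ≤ ENNReal.ofReal M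

namespace Tame

variable {u : Ω → E3} {M : ℝ} (h : Tame μ u M)
include h

/-- Unlike `wt`, the extended weight `wE` is infinite at 0, so its integrability by itself makes
collisions negligible. -/
lemma ae_ne : ∀ᵐ w ∂μ, u w ≠ 0 := by
  have : ∀ᵐ w ∂μ, wE (u w) < ⊤ :=
    ae_lt_top' (measurable_wE.comp_aemeasurable h.meas.aemeasurable)
      (ne_top_of_le_ne_top ENNReal.ofReal_ne_top h.bound)
  filter_upwards [this] with w hw h0
  rw [h0, wE_zero] at hw
  exact lt_irrefl _ hw

lemma lintegral_wt : ∫⁻ w, ENNReal.ofReal (wt (u w)) ∂μ ≤ ENNReal.ofReal M := by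
  refine le_trans (lintegral_mono_ae ?_) h.bound
  filter_upwards [h.ae_ne] with w hw
  rw [wE_eq_ofReal hw]

lemma integrable_wt : Integrable (fun w => wt (u w)) μ := by
  refine ⟨(measurable_wt.comp_aemeasurable h.meas.aemeasurable).aestronglyMeasurable, ?_⟩
  rw [hasFiniteIntegral_iff_ofReal (Eventually.of_forall fun w => wt_nonneg _)]
  exact lt_of_le_of_lt h.lintegral_wt ENNReal.ofReal_lt_top

lemma integral_wt_le : ∫ w, wt (u w) ∂μ ≤ M := by
  rw [integral_eq_lintegral_of_nonneg_ae (Eventually.of_forall fun w => wt_nonneg _)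
    h.integrable_wt.1]
  exact ENNReal.toReal_le_of_le_ofReal h.nonneg h.lintegral_wt

end Tame

lemma inv_norm_le (u : E3) : 1 / ‖u‖ ≤ 1 + wt u := by
  rcases eq_or_ne u 0 with rfl | hu
  · simpa using add_nonneg zero_le_one (wt_nonneg 0)
  have hp := norm_pos_iff.2 hu
  by_cases h1 : 1 ≤ ‖u‖
  · have : 1 / ‖u‖ ≤ 1 := by rw [div_le_one hp]; exact h1
    linarith [wt_nonneg u]
  · have h2 : 1 / ‖u‖ ≤ wt u := by
      rw [wt, one_div]
      refine inv_anti₀ (by positivity) ?_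
      have : √‖u‖ ≤ 1 := Real.sqrt_le_one.2 (by linarith)
      nlinarith [Real.sqrt_nonneg ‖u‖]
    linarith

lemma inv_norm_sq_le (u : E3) : 1 / ‖u‖ ^ 2 ≤ 1 + wt u := by
  rcases eq_or_ne u 0 with rfl | hu
  · simpa using add_nonneg zero_le_one (wt_nonneg 0)
  have hp := norm_pos_iff.2 hu
  by_cases h1 : 1 ≤ ‖u‖
  · have : 1 / ‖u‖ ^ 2 ≤ 1 := by rw [div_le_one (by positivity)]; exact one_le_pow₀ h1
    linarith [wt_nonneg u]
  · have h2 : 1 / ‖u‖ ^ 2 ≤ wt u := by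
      rw [wt, one_div]
      refine inv_anti₀ (by positivity) ?_
      have : √‖u‖ ≤ 1 := Real.sqrt_le_one.2 (by linarith)
      nlinarith [Real.sqrt_nonneg ‖u‖, sq_nonneg ‖u‖]
    linarith

lemma norm_inner_div_le (u h : E3) : ‖inner ℝ u h / ‖u‖ ^ 3‖ ≤ ‖h‖ * (1 + wt u) := by
  rcases eq_or_ne u 0 with rfl | hu
  · simp; exact mul_nonneg (norm_nonneg _) (add_nonneg zero_le_one (wt_nonneg 0))
  have hp := norm_pos_iff.2 hu
  rw [norm_div, norm_pow, norm_norm]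
  calc _ ≤ ‖u‖ * ‖h‖ / ‖u‖ ^ 3 := by gcongr; exact norm_inner_le_norm u h
    _ = ‖h‖ * (1 / ‖u‖ ^ 2) := by field_simp
    _ ≤ _ := by gcongr; exact inv_norm_sq_le u

/-- The second order remainder of `1 / |u|`. -/
lemma newton_remainder_sq {u h : E3} (hu : u ≠ 0) (huh : u + h ≠ 0) :
    |1 / ‖u + h‖ - 1 / ‖u‖ + inner ℝ u h / ‖u‖ ^ 3| ≤ 3 * (‖h‖ ^ 2 / (‖u‖ ^ 2 * ‖u + h‖)) := by
  set a := ‖u‖ with ha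
  set b := ‖u + h‖ with hb
  set t := ‖h‖ with ht
  have ha0 : 0 < a := norm_pos_iff.2 hu
  have hb0 : 0 < b := norm_pos_iff.2 huh
  have ht0 : 0 ≤ t := norm_nonneg _
  have hab : |b - a| ≤ t := by
    have := abs_norm_sub_norm_le (u + h) u
    simpa using this
  set i := inner ℝ u h with hi
  have hi1 : |i| ≤ a * t := abs_real_inner_le_norm u h
  have hbb : b ^ 2 = a ^ 2 + 2 * i + t ^ 2 := norm_add_sq_real u h
  -- Exact factorization based on b² = a² + 2i + t². The factors i and b - a, bounded by a t and t,
  -- supply the two powers of t.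
  have e : 1 / b - 1 / a + i / a ^ 3 =
      i * ((b - a) * (b + 2 * a)) / (a ^ 3 * b * (a + b)) - t ^ 2 / (a * b * (a + b)) := by
    have h1 : i = (b ^ 2 - a ^ 2 - t ^ 2) / 2 := by linarith
    have hs : a + b ≠ 0 := by positivity
    rw [h1]
    field_simp
    ring
  have h1 : |i * ((b - a) * (b + 2 * a)) / (a ^ 3 * b * (a + b))| ≤ 2 * (t ^ 2 / (a ^ 2 * b)) := by
    rw [abs_div, abs_mul, abs_mul, abs_of_pos (show 0 < b + 2 * a by positivity),
      abs_of_pos (show 0 < a ^ 3 * b * (a + b) by positivity)]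
    calc _ ≤ (a * t) * (t * (2 * (a + b))) / (a ^ 3 * b * (a + b)) := by
          gcongr; linarith
      _ = _ := by field_simp
  have h2 : |t ^ 2 / (a * b * (a + b))| ≤ t ^ 2 / (a ^ 2 * b) := by
    rw [abs_of_nonneg (by positivity)]
    refine div_le_div_of_nonneg_left (by positivity) (by positivity) ?_
    nlinarith [mul_pos (mul_pos ha0 hb0) hb0]
  rw [e]
  calc _ ≤ _ := abs_sub _ _
    _ ≤ 2 * (t ^ 2 / (a ^ 2 * b)) + t ^ 2 / (a ^ 2 * b) := add_le_add h1 h2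
    _ = _ := by ring

/-- The quadratic remainder t² / |u|³ has a kernel that is not integrable in dimension three. Giving
up half a power of t yields t^(3/2) |u|^(-5/2), integrable and still o(t). If t ≤ 2b, half a power
of t is absorbed by b; otherwise t ≤ a + b gives t ≤ 2a, and the factor t² is absorbed by a. -/
lemma interpolation {a b t : ℝ} (ha : 0 < a) (hb : 0 < b) (ht : 0 ≤ t) (htab : t ≤ a + b) :
    t ^ 2 / (a ^ 2 * b) ≤ 4 * (t * √t) * ((a ^ 2 * √a)⁻¹ + (b ^ 2 * √b)⁻¹) := by
  obtain ⟨x, hx, rfl⟩ : ∃ x, 0 < x ∧ a = x ^ 2 := ⟨√a, Real.sqrt_pos.2 ha, (Real.sq_sqrt ha.le).symm⟩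
  obtain ⟨y, hy, rfl⟩ : ∃ x, 0 < x ∧ b = x ^ 2 := ⟨√b, Real.sqrt_pos.2 hb, (Real.sq_sqrt hb.le).symm⟩
  obtain ⟨s, hs, rfl⟩ : ∃ x, 0 ≤ x ∧ t = x ^ 2 := ⟨√t, Real.sqrt_nonneg t, (Real.sq_sqrt ht).symm⟩
  rw [Real.sqrt_sq hx.le, Real.sqrt_sq hy.le, Real.sqrt_sq hs]
  have hxi : 0 < ((x ^ 2) ^ 2 * x)⁻¹ := by positivity
  have hyi : 0 < ((y ^ 2) ^ 2 * y)⁻¹ := by positivity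
  by_cases h : s ^ 2 ≤ 2 * y ^ 2
  · have hsy : s ≤ 2 * y := by nlinarith
    have h1 : ((x ^ 2) ^ 2 * y)⁻¹ ≤ ((x ^ 2) ^ 2 * x)⁻¹ + ((y ^ 2) ^ 2 * y)⁻¹ := by
      rcases le_total x y with hxy | hxy
      · have : ((x ^ 2) ^ 2 * y)⁻¹ ≤ ((x ^ 2) ^ 2 * x)⁻¹ := by gcongr
        linarith
      · have : ((x ^ 2) ^ 2 * y)⁻¹ ≤ ((y ^ 2) ^ 2 * y)⁻¹ := by gcongr
        linarith
    calc (s ^ 2) ^ 2 / ((x ^ 2) ^ 2 * y ^ 2) = s ^ 2 * s * (s / y) * ((x ^ 2) ^ 2 * y)⁻¹ := by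
          field_simp
      _ ≤ s ^ 2 * s * 4 * ((x ^ 2) ^ 2 * y)⁻¹ := by
          gcongr
          rw [div_le_iff₀ hy]; linarith
      _ ≤ s ^ 2 * s * 4 * (((x ^ 2) ^ 2 * x)⁻¹ + ((y ^ 2) ^ 2 * y)⁻¹) := by gcongr
      _ = _ := by ring
  · have hxs : s ^ 2 ≤ 2 * x ^ 2 := by linarith
    have hs0 : 0 < s := by
      rcases hs.eq_or_lt with h0 | h0
      · exfalso; apply h; rw [← h0]; nlinarith [sq_nonneg y]
      · exact h0
    have hys : y ≤ s := by
      by_contra! hlt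
      apply h
      nlinarith
    calc (s ^ 2) ^ 2 / ((x ^ 2) ^ 2 * y ^ 2) = (s ^ 2 / x ^ 2) ^ 2 * (y ^ 2 * y) * ((y ^ 2) ^ 2 * y)⁻¹ := by
          field_simp
      _ ≤ 2 ^ 2 * (s ^ 2 * s) * ((y ^ 2) ^ 2 * y)⁻¹ := by
          gcongr
          rw [div_le_iff₀ (by positivity)]; linarith
      _ ≤ 2 ^ 2 * (s ^ 2 * s) * (((x ^ 2) ^ 2 * x)⁻¹ + ((y ^ 2) ^ 2 * y)⁻¹) := by
          gcongr; linarith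
      _ = _ := by ring

lemma newton_remainder {u h : E3} (hu : u ≠ 0) (huh : u + h ≠ 0) {t : ℝ} (ht : ‖h‖ ≤ t) :
    |1 / ‖u + h‖ - 1 / ‖u‖ + inner ℝ u h / ‖u‖ ^ 3| ≤ 12 * (t * √t) * (wt u + wt (u + h)) := by
  refine (newton_remainder_sq hu huh).trans ?_
  have htab : ‖h‖ ≤ ‖u‖ + ‖u + h‖ := by
    have := norm_sub_le (u + h) u
    rw [add_sub_cancel_left] at this
    linarith
  have := interpolation (norm_pos_iff.2 hu) (norm_pos_iff.2 huh) (norm_nonneg h) htab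
  have hsq : ‖h‖ * √‖h‖ ≤ t * √t := by
    gcongr
    exact (norm_nonneg h).trans ht
  calc _ ≤ 3 * (4 * (‖h‖ * √‖h‖) * (wt u + wt (u + h))) := by gcongr; exact this
    _ = 12 * (‖h‖ * √‖h‖) * (wt u + wt (u + h)) := by ring
    _ ≤ _ := by
      have := add_nonneg (wt_nonneg u) (wt_nonneg (u + h))
      gcongr

variable [IsFiniteMeasure μ] {u h : Ω → E3} {m : Ω → ℝ} {M m₀ t : ℝ}

lemma Tame.integrable_newton (hu : Tame μ u M) (hm : AEStronglyMeasurable m μ)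
    (hm₀ : ∀ᵐ w ∂μ, |m w| ≤ m₀) : Integrable (fun w => m w / ‖u w‖) μ := by
  refine Integrable.mono' (((integrable_const (1 : ℝ)).add hu.integrable_wt).const_mul m₀)
    (hm.aemeasurable.div hu.meas.norm.aemeasurable).aestronglyMeasurable ?_
  filter_upwards [hm₀] with w hw
  rw [norm_div, norm_norm, div_eq_mul_one_div]
  exact mul_le_mul hw (inv_norm_le _) (by positivity) ((abs_nonneg _).trans hw)

lemma Tame.integrable_grad (hu : Tame μ u M) (hh : AEStronglyMeasurable h μ)
    (ht : ∀ᵐ w ∂μ, ‖h w‖ ≤ t) (hm : AEStronglyMeasurable m μ) (hm₀ : ∀ᵐ w ∂μ, |m w| ≤ m₀) :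
    Integrable (fun w => m w * (inner ℝ (u w) (h w) / ‖u w‖ ^ 3)) μ := by
  refine Integrable.mono' (((integrable_const (1 : ℝ)).add hu.integrable_wt).const_mul (m₀ * t))
    (hm.mul (((hu.meas.inner hh).aemeasurable.div
      (hu.meas.norm.aemeasurable.pow_const 3)).aestronglyMeasurable)) ?_
  filter_upwards [hm₀, ht] with w hw hwt
  rw [norm_mul, mul_assoc]
  refine mul_le_mul hw ((norm_inner_div_le _ _).trans ?_) (norm_nonneg _) ((abs_nonneg _).trans hw)
  have : 0 ≤ 1 + wt (u w) := add_nonneg zero_le_one (wt_nonneg _)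
  exact mul_le_mul_of_nonneg_right hwt this

/-- First order expansion of Newtonian potentials. -/
lemma Tame.newton_expansion (hu : Tame μ u M) (huh : Tame μ (fun w => u w + h w) M)
    (hh : AEStronglyMeasurable h μ) (ht : ∀ᵐ w ∂μ, ‖h w‖ ≤ t) (ht0 : 0 ≤ t)
    (hm : AEStronglyMeasurable m μ) (hm₀ : ∀ᵐ w ∂μ, |m w| ≤ m₀) (h0 : 0 ≤ m₀) :
    |∫ w, m w / ‖u w + h w‖ ∂μ - ∫ w, m w / ‖u w‖ ∂μ +
      ∫ w, m w * (inner ℝ (u w) (h w) / ‖u w‖ ^ 3) ∂μ| ≤ 24 * m₀ * M * (t * √t) := by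
  have i1 := huh.integrable_newton hm hm₀
  have i2 := hu.integrable_newton hm hm₀
  have i3 := hu.integrable_grad hh ht hm hm₀
  have i12 : Integrable (fun w => m w / ‖u w + h w‖ - m w / ‖u w‖) μ := i1.sub i2
  rw [← integral_sub i1 i2, ← integral_add i12 i3, ← Real.norm_eq_abs]
  have hi : Integrable (fun w => m₀ * (12 * (t * √t)) * (wt (u w) + wt (u w + h w))) μ :=
    (hu.integrable_wt.add huh.integrable_wt).const_mul _
  refine (norm_integral_le_of_norm_le hi ?_).trans ?_
  · filter_upwards [hm₀, ht, hu.ae_ne, huh.ae_ne] with w h1 h2 h3 h4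
    have e : m w / ‖u w + h w‖ - m w / ‖u w‖ + m w * (inner ℝ (u w) (h w) / ‖u w‖ ^ 3) =
        m w * (1 / ‖u w + h w‖ - 1 / ‖u w‖ + inner ℝ (u w) (h w) / ‖u w‖ ^ 3) := by ring
    rw [e, norm_mul, mul_assoc]
    exact mul_le_mul h1 (newton_remainder h3 h4 h2) (norm_nonneg _) h0
  · rw [integral_const_mul, integral_add hu.integrable_wt huh.integrable_wt]
    calc _ ≤ m₀ * (12 * (t * √t)) * (M + M) := by
          gcongr
          · exact hu.integral_wt_le
          · exact huh.integral_wt_le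
      _ = _ := by ring

lemma Tame.abs_integral_grad_le (hu : Tame μ u M) (ht : ∀ᵐ w ∂μ, ‖h w‖ ≤ t) (ht0 : 0 ≤ t)
    (hm₀ : ∀ᵐ w ∂μ, |m w| ≤ m₀) (h0 : 0 ≤ m₀) :
    |∫ w, m w * (inner ℝ (u w) (h w) / ‖u w‖ ^ 3) ∂μ| ≤ m₀ * t * (μ.real univ + M) := by
  rw [← Real.norm_eq_abs]
  have hi : Integrable (fun w => m₀ * t * (1 + wt (u w))) μ :=
    ((integrable_const (1 : ℝ)).add hu.integrable_wt).const_mul _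
  refine (norm_integral_le_of_norm_le hi ?_).trans ?_
  · filter_upwards [hm₀, ht] with w hw hwt
    rw [norm_mul, mul_assoc]
    refine mul_le_mul hw ((norm_inner_div_le _ _).trans ?_) (norm_nonneg _) h0
    have : 0 ≤ 1 + wt (u w) := add_nonneg zero_le_one (wt_nonneg _)
    exact mul_le_mul_of_nonneg_right hwt this
  · rw [integral_const_mul, integral_add (integrable_const _) hu.integrable_wt]
    gcongr
    · simp
    · exact hu.integral_wt_le

end Kernel

end ElasticSatellite
end

noncomputable section

namespace ElasticSatellite

namespace ConfigSpace

variable {S : Body} {Q : Type*} [NormedAddCommGroup Q] [NormedSpace ℝ Q] (C : ConfigSpace S Q)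

/-! ### Self-gravitation -/

lemma exists_antilipschitz_of_det_ne_zero {A : E3 →L[ℝ] E3} (hA : A.det ≠ 0) :
    ∃ c > 0, ∀ h, c * ‖h‖ ≤ ‖A h‖ := by
  have hA' : LinearMap.det (A : E3 →ₗ[ℝ] E3) ≠ 0 := hA
  have hker : LinearMap.ker (A : E3 →ₗ[ℝ] E3) = ⊥ := by
    by_contra h
    exact hA' (LinearMap.det_eq_zero_iff_ker_ne_bot.2 h)
  obtain ⟨K, hK, hant⟩ := LinearMap.exists_antilipschitzWith (A : E3 →ₗ[ℝ] E3) hker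
  have hK' : (0 : ℝ) < K := by exact_mod_cast hK
  refine ⟨(K : ℝ)⁻¹, inv_pos.2 hK', fun h => ?_⟩
  have := hant.le_mul_dist h 0
  simp only [dist_zero_right, map_zero] at this
  rw [inv_mul_le_iff₀ hK']
  exact this

lemma continuous_det_clm : Continuous fun A : E3 →L[ℝ] E3 => A.det :=
  ContinuousLinearMap.continuous_det

/-- Near x₀ the gradients of all configurations close to ζ are close to one invertible A. The mean
value inequality up to the boundary makes these configurations injective on a common piece of the
body, and the change of variables bounds the image of Lebesgue measure by 2 / det A. Global
injectivity is not assumed. -/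
lemma exists_local_pushforward_bound {ζ : Q} (hζ : ∀ x ∈ closure S.B, 0 < (C.defGrad ζ x).det)
    {x₀ : E3} (hx₀ : x₀ ∈ closure S.B) :
    ∃ V ∈ 𝓝 x₀, ∃ r > 0, ∃ K : ENNReal, K ≠ ⊤ ∧ ∀ ζ' : Q, ‖ζ' - ζ‖ ≤ r →
      ∀ f : E3 → ENNReal, ∫⁻ x in S.B ∩ V, f (C.ev ζ' x) ≤ K * ∫⁻ u, f u := by
  set A := C.defGrad ζ x₀ with hA
  have hdet : 0 < A.det := hζ x₀ hx₀
  obtain ⟨c, hc, hcA⟩ := exists_antilipschitz_of_det_ne_zero hdet.ne'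
  obtain ⟨e, he, hball⟩ : ∃ e > 0, ∀ F : E3 →L[ℝ] E3, ‖F - A‖ ≤ e → A.det / 2 < F.det := by
    have : {F : E3 →L[ℝ] E3 | A.det / 2 < F.det} ∈ 𝓝 A :=
      (isOpen_lt continuous_const continuous_det_clm).mem_nhds (half_lt_self hdet)
    obtain ⟨e, he, hb⟩ := Metric.nhds_basis_closedBall.mem_iff.1 this
    exact ⟨e, he, fun F hF => hb (by rwa [Metric.mem_closedBall, dist_eq_norm])⟩
  -- The mean value inequality loses a factor 7, and 7d ≤ c / 2 is less than the expansion c of A,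
  -- whence injectivity.
  set d := min e (c / 14) with hd
  have hd0 : 0 < d := lt_min he (by positivity)
  obtain ⟨κ, hκ, hbound⟩ := C.exists_bound
  obtain ⟨V₀, hV₀, hVd⟩ : ∃ V ∈ 𝓝 x₀, ∀ x ∈ closure S.B ∩ V, ‖C.defGrad ζ x - A‖ ≤ d / 2 := by
    have h1 : {x | dist (C.defGrad ζ x) A < d / 2} ∈ 𝓝[closure S.B] x₀ :=
      (C.continuousOn_defGrad ζ x₀ hx₀) (Metric.ball_mem_nhds _ (by positivity))
    obtain ⟨V, hV, hsub⟩ := mem_nhdsWithin_iff_exists_mem_nhds_inter.1 h1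
    refine ⟨V, hV, fun x hx => ?_⟩
    rw [← dist_eq_norm]
    exact le_of_lt (hsub ⟨hx.2, hx.1⟩)
  obtain ⟨V₁, hV₁, hmv⟩ := S.exists_mean_value hx₀ hV₀
  obtain ⟨V, hVsub, hVo, hxV⟩ := mem_nhds_iff.1 (inter_mem hV₀ hV₁)
  refine ⟨V, hVo.mem_nhds hxV, d / (2 * κ), by positivity, (ENNReal.ofReal (A.det / 2))⁻¹, ?_, ?_⟩
  · rw [Ne, ENNReal.inv_eq_top, ENNReal.ofReal_eq_zero]; linarith
  intro ζ' hζ' f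
  have hD : ∀ x ∈ S.B ∩ V₀, ‖C.defGrad ζ' x - A‖ ≤ d := by
    intro x hx
    have hxc : x ∈ closure S.B := subset_closure hx.1
    have h1 : ‖C.defGrad ζ' x - C.defGrad ζ x‖ ≤ d / 2 := by
      rw [← C.defGrad_sub hxc]
      refine (hbound _ x hxc).2.trans ?_
      calc κ * ‖ζ' - ζ‖ ≤ κ * (d / (2 * κ)) := by gcongr
        _ = d / 2 := by field_simp
    have h2 := hVd x ⟨hxc, hx.2⟩
    calc _ = ‖(C.defGrad ζ' x - C.defGrad ζ x) + (C.defGrad ζ x - A)‖ := by congr 1; abel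
      _ ≤ _ := norm_add_le _ _
      _ ≤ d := by linarith
  have hinj : InjOn (C.ev ζ') (S.B ∩ V) := by
    intro x hx y hy hxy
    have h1 := hmv (C.ev ζ') (C.defGrad ζ') A d (fun x hx => C.hasFDerivAt_ev ζ' hx.1) hD
      x ⟨hx.1, (hVsub hx.2).2⟩ y ⟨hy.1, (hVsub hy.2).2⟩
    rw [hxy, sub_self, zero_sub, norm_neg] at h1
    have h2 := hcA (y - x)
    have h3 : 7 * d ≤ c / 2 := by have := min_le_right e (c / 14); linarith
    have h4 : 7 * d * ‖y - x‖ ≤ c / 2 * ‖y - x‖ := by gcongr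
    have h5 : ‖y - x‖ ≤ 0 := by
      by_contra! hpos
      nlinarith
    exact (sub_eq_zero.1 (norm_le_zero_iff.1 h5)).symm
  have hmeas : MeasurableSet (S.B ∩ V) := S.measurableSet.inter hVo.measurableSet
  have hcv := lintegral_image_eq_lintegral_abs_det_fderiv_mul volume hmeas
    (fun x hx => (C.hasFDerivAt_ev ζ' hx.1).hasFDerivWithinAt) hinj f
  have hle : ENNReal.ofReal (A.det / 2) * ∫⁻ x in S.B ∩ V, f (C.ev ζ' x) ≤ ∫⁻ u, f u := by
    rw [← lintegral_const_mul' _ _ ENNReal.ofReal_ne_top]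
    calc _ ≤ ∫⁻ x in S.B ∩ V, ENNReal.ofReal |(C.defGrad ζ' x).det| * f (C.ev ζ' x) := by
          refine setLIntegral_mono' hmeas fun x hx => ?_
          gcongr
          have := hball _ ((hD x ⟨hx.1, (hVsub hx.2).1⟩).trans (min_le_left _ _))
          exact this.le.trans (le_abs_self _)
      _ = ∫⁻ u in C.ev ζ' '' (S.B ∩ V), f u := hcv.symm
      _ ≤ _ := setLIntegral_le_lintegral _ _
  rw [mul_comm, ← div_eq_mul_inv]
  refine (ENNReal.le_div_iff_mul_le (Or.inl ?_) (Or.inl ENNReal.ofReal_ne_top)).2 ?_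
  · rw [Ne, ENNReal.ofReal_eq_zero]; linarith
  · rwa [mul_comm]

lemma aestronglyMeasurable_ev (ζ : Q) :
    AEStronglyMeasurable (C.ev ζ) (volume.restrict S.B) :=
  ((C.continuousOn_ev ζ).mono subset_closure).aestronglyMeasurable S.measurableSet

/-- The Newtonian kernels of all the configurations near a regular one are uniformly tame. -/
lemma exists_tame {ζ : Q} (hζ : ∀ x ∈ closure S.B, 0 < (C.defGrad ζ x).det) :
    ∃ r > 0, ∃ M, ∀ ζ' : Q, ‖ζ' - ζ‖ ≤ r → ∀ χ : E3,
      Tame (volume.restrict S.B) (fun x => C.ev ζ' x - χ) M := by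
  choose! V hV r hr K hK hVK using fun x hx => C.exists_local_pushforward_bound hζ (x₀ := x) hx
  obtain ⟨t, htB, hcov⟩ := S.isCompact_closure.elim_nhds_subcover V hV
  have hI := lintegral_wE_ball_lt_top
  set I := ∫⁻ u in Metric.ball (0 : E3) 1, wE u with hIdef
  obtain ⟨r₀, hr₀, hr₀'⟩ : ∃ r₀ > 0, ∀ x ∈ t, r₀ ≤ r x := by
    rcases t.eq_empty_or_nonempty with rfl | hne
    · exact ⟨1, one_pos, by simp⟩
    · obtain ⟨x, hx, hmin⟩ := t.exists_min_image r hne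
      exact ⟨r x, hr x (htB x hx), hmin⟩
  -- On each piece of the cover the weight is split at distance 1 from χ. The near part is bounded
  -- through the image measure, by a quantity independent of χ by translation invariance; the far
  -- part is at most 1. Overlaps of different pieces only add terms.
  set N := ∑ x ∈ t, (K x * I + volume S.B) with hN
  have hNtop : N ≠ ⊤ := by
    refine ENNReal.sum_ne_top.2 fun x hx => ?_
    exact ENNReal.add_ne_top.2 ⟨ENNReal.mul_ne_top (hK x (htB x hx)) hI.ne, S.volume_lt_top.ne⟩
  refine ⟨r₀, hr₀, N.toReal, fun ζ' hζ' χ => ⟨ENNReal.toReal_nonneg,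
    (C.aestronglyMeasurable_ev ζ').sub aestronglyMeasurable_const, ?_⟩⟩
  rw [ENNReal.ofReal_toReal hNtop]
  have hsub : S.B ⊆ ⋃ x ∈ t, S.B ∩ V x := fun y hy => by
    obtain ⟨x, hx, hxy⟩ := mem_iUnion₂.1 (hcov (subset_closure hy))
    exact mem_iUnion₂.2 ⟨x, hx, hy, hxy⟩
  calc ∫⁻ x in S.B, wE (C.ev ζ' x - χ)
      ≤ ∫⁻ x in ⋃ x ∈ t, S.B ∩ V x, wE (C.ev ζ' x - χ) := lintegral_mono_set hsub
    _ ≤ ∑ x ∈ t, ∫⁻ y in S.B ∩ V x, wE (C.ev ζ' y - χ) := by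
        classical
        clear_value N I
        clear hcov hsub hN hr₀' htB
        induction t using Finset.induction_on with
        | empty => simp
        | insert a s ha ih =>
          rw [Finset.set_biUnion_insert, Finset.sum_insert ha]
          exact (lintegral_union_le _ _ _).trans (add_le_add le_rfl ih)
    _ ≤ N := Finset.sum_le_sum fun x hx => ?_
  set f : E3 → ENNReal := (Metric.ball χ 1).indicator fun u => wE (u - χ) with hf
  have hle : ∀ y, wE (C.ev ζ' y - χ) ≤ f (C.ev ζ' y) + 1 := fun y => by
    by_cases hy : C.ev ζ' y ∈ Metric.ball χ 1
    · rw [hf, indicator_of_mem hy]; exact le_self_add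
    · rw [Metric.mem_ball, dist_eq_norm, not_lt] at hy
      exact (wE_le_one hy).trans le_add_self
  have hfI : ∫⁻ u, f u = I := by
    rw [hIdef, ← lintegral_indicator measurableSet_ball,
      ← lintegral_sub_right_eq_self (fun u => (Metric.ball 0 1).indicator wE u) χ]
    refine lintegral_congr fun u => ?_
    by_cases hu : u ∈ Metric.ball χ 1
    · rw [hf, indicator_of_mem hu, indicator_of_mem]
      simpa [dist_eq_norm] using hu
    · rw [hf, indicator_of_notMem hu, indicator_of_notMem]
      simpa [dist_eq_norm] using hu
  calc ∫⁻ y in S.B ∩ V x, wE (C.ev ζ' y - χ) ≤ ∫⁻ y in S.B ∩ V x, (f (C.ev ζ' y) + 1) :=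
        lintegral_mono fun y => hle y
    _ = (∫⁻ y in S.B ∩ V x, f (C.ev ζ' y)) + volume (S.B ∩ V x) := by
        rw [lintegral_add_right _ measurable_const]; simp
    _ ≤ K x * I + volume S.B := by
        rw [← hfI]
        exact add_le_add (hVK x (htB x hx) ζ' (hζ'.trans (hr₀' x hx)) f)
          (measure_mono inter_subset_left)

/-- The normalized Lebesgue measure of pairs of material points. -/
abbrev pairs (S : Body) : Measure (E3 × E3) := (volume.restrict S.B).prod (volume.restrict S.B)

lemma aestronglyMeasurable_fst (ζ : Q) : AEStronglyMeasurable (fun p => C.ev ζ p.1) (pairs S) :=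
  (C.aestronglyMeasurable_ev ζ).comp_fst

lemma aestronglyMeasurable_snd (ζ : Q) : AEStronglyMeasurable (fun p => C.ev ζ p.2) (pairs S) :=
  (C.aestronglyMeasurable_ev ζ).comp_snd

lemma tame_pairs {ζ : Q} {M : ℝ} (h : ∀ χ : E3, Tame (volume.restrict S.B) (fun x => C.ev ζ x - χ) M) :
    Tame (pairs S) (fun p => C.ev ζ p.2 - C.ev ζ p.1) (M * volume.real S.B) := by
  have hm := (C.aestronglyMeasurable_snd ζ).sub (C.aestronglyMeasurable_fst ζ)
  refine ⟨mul_nonneg (h 0).nonneg measureReal_nonneg, hm, ?_⟩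
  have hm' : AEMeasurable (fun p : E3 × E3 => wE (C.ev ζ p.2 - C.ev ζ p.1)) (pairs S) :=
    measurable_wE.comp_aemeasurable hm.aemeasurable
  rw [lintegral_prod _ hm']
  calc _ ≤ ∫⁻ _x in S.B, ENNReal.ofReal M := lintegral_mono fun x => (h (C.ev ζ x)).bound
    _ = _ := by
      rw [setLIntegral_const, ENNReal.ofReal_mul (h 0).nonneg, Measure.real,
        ENNReal.ofReal_toReal S.volume_lt_top.ne]

variable (S) in
lemma exists_density_bound : ∃ c, 0 ≤ c ∧ ∀ x ∈ closure S.B, |S.ρ x| ≤ c := by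
  obtain ⟨c, hc⟩ := S.isCompact_closure.exists_bound_of_continuousOn S.ρ_smooth.continuousOn
  obtain ⟨x, hx⟩ := S.nonempty
  exact ⟨c, (norm_nonneg _).trans (hc x (subset_closure hx)), hc⟩

variable (S) in
lemma aestronglyMeasurable_density : AEStronglyMeasurable S.ρ (volume.restrict S.B) :=
  (S.ρ_smooth.continuousOn.mono subset_closure).aestronglyMeasurable S.measurableSet

lemma ae_restrict_of_forall {p : E3 → Prop} (h : ∀ x ∈ S.B, p x) :
    ∀ᵐ x ∂(volume.restrict S.B), p x :=
  (ae_restrict_iff' S.measurableSet).2 (Eventually.of_forall h)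

lemma ae_pairs_of_forall {p : E3 × E3 → Prop} (h : ∀ x ∈ S.B, ∀ y ∈ S.B, p (x, y)) :
    ∀ᵐ q ∂(pairs S), p q := by
  rw [pairs, Measure.prod_restrict,
    ae_restrict_iff' (S.measurableSet.prod S.measurableSet)]
  exact Eventually.of_forall fun q hq => h q.1 hq.1 q.2 hq.2

/-- The gravitational field of the satellite. -/
def selfField (ζ : Q) (χ : E3) : E3 :=
  -∫ x in S.B, (S.k * S.ρ x / ‖C.ev ζ x - χ‖ ^ 3) • (C.ev ζ x - χ)

lemma norm_density_le {c : ℝ} (hc : ∀ x ∈ closure S.B, |S.ρ x| ≤ c) {x : E3} (hx : x ∈ S.B) :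
    |S.k * S.ρ x| ≤ S.k * c := by
  rw [abs_mul, abs_of_pos S.k_pos]
  exact mul_le_mul_of_nonneg_left (hc x (subset_closure hx)) S.k_pos.le

lemma integrable_field {ζ : Q} {χ : E3} {M : ℝ}
    (h : Tame (volume.restrict S.B) (fun x => C.ev ζ x - χ) M) :
    IntegrableOn (fun x => (S.k * S.ρ x / ‖C.ev ζ x - χ‖ ^ 3) • (C.ev ζ x - χ)) S.B := by
  obtain ⟨c, hc0, hc⟩ := exists_density_bound S
  have hm := (aestronglyMeasurable_density S).const_mul S.k
  refine Integrable.mono' (((integrable_const (1 : ℝ)).add h.integrable_wt).const_mul (S.k * c))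
    (((hm.aemeasurable.div (h.meas.norm.aemeasurable.pow_const 3)).aestronglyMeasurable).smul h.meas)
    (ae_restrict_of_forall fun x hx => ?_)
  rw [norm_smul, norm_div, norm_pow, norm_norm]
  rcases eq_or_ne (C.ev ζ x - χ) 0 with h0 | h0
  · rw [h0, norm_zero, mul_zero]
    exact mul_nonneg (mul_nonneg S.k_pos.le hc0) (add_nonneg zero_le_one (wt_nonneg _))
  have hp := norm_pos_iff.2 h0
  calc ‖S.k * S.ρ x‖ / ‖C.ev ζ x - χ‖ ^ 3 * ‖C.ev ζ x - χ‖ =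
        ‖S.k * S.ρ x‖ * (1 / ‖C.ev ζ x - χ‖ ^ 2) := by field_simp
    _ ≤ S.k * c * (1 + wt (C.ev ζ x - χ)) :=
      mul_le_mul (norm_density_le hc hx) (inv_norm_sq_le _) (by positivity)
        (mul_nonneg S.k_pos.le hc0)

/-- A shift of χ by h displaces every u by -h, and the expansion of Newtonian potentials leaves a
remainder of order |h|^(3/2). This holds also at points occupied by the body, where the equation of
motion evaluates the gradient. -/
lemma hasGradientAt_selfPotential {ζ : Q} (hζ : ∀ x ∈ closure S.B, 0 < (C.defGrad ζ x).det)
    (χ : E3) : HasGradientAt (C.selfPotential ζ) (C.selfField ζ χ) χ := by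
  obtain ⟨r, hr, M, hM⟩ := C.exists_tame hζ
  have hT : ∀ χ, Tame (volume.restrict S.B) (fun x => C.ev ζ x - χ) M := hM ζ (by simp [hr.le])
  obtain ⟨c, hc0, hc⟩ := exists_density_bound S
  have hm := (aestronglyMeasurable_density S).const_mul S.k
  have hm₀ : ∀ᵐ x ∂(volume.restrict S.B), |S.k * S.ρ x| ≤ S.k * c :=
    ae_restrict_of_forall fun x hx => norm_density_le hc hx
  have hexp : ∀ h : E3, |C.selfPotential ζ (χ + h) - C.selfPotential ζ χ -
      inner ℝ (C.selfField ζ χ) h| ≤ 24 * (S.k * c) * M * (‖h‖ * √‖h‖) := by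
    intro h
    have hu' : Tame (volume.restrict S.B) (fun x => C.ev ζ x - χ + (-h)) M := by
      have := hT (χ + h)
      simpa only [sub_add_eq_sub_sub, ← sub_eq_add_neg] using this
    have key := (hT χ).newton_expansion hu' aestronglyMeasurable_const (t := ‖h‖)
      (Eventually.of_forall fun x => by simp) (norm_nonneg _) hm hm₀ (mul_nonneg S.k_pos.le hc0)
    have e1 : C.selfPotential ζ (χ + h) = -∫ x in S.B, S.k * S.ρ x / ‖C.ev ζ x - χ + -h‖ := by
      simp only [selfPotential, sub_add_eq_sub_sub, ← sub_eq_add_neg]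
    have e2 : inner ℝ (C.selfField ζ χ) h =
        ∫ x in S.B, S.k * S.ρ x * (inner ℝ (C.ev ζ x - χ) (-h) / ‖C.ev ζ x - χ‖ ^ 3) := by
      rw [selfField, inner_neg_left, real_inner_comm, ← integral_inner (C.integrable_field (hT χ)),
        ← integral_neg]
      congr 1
      ext x
      rw [inner_smul_right, inner_neg_right, real_inner_comm]
      ring
    rw [e1, e2, selfPotential, ← abs_neg]
    convert key using 2
    ring
  rw [hasGradientAt_iff_hasFDerivAt, hasFDerivAt_iff_isLittleO_nhds_zero]
  have h1 : (fun h : E3 => C.selfPotential ζ (χ + h) - C.selfPotential ζ χ -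
      (InnerProductSpace.toDual ℝ E3) (C.selfField ζ χ) h) =O[𝓝 0] fun h => √‖h‖ * ‖h‖ :=
    Asymptotics.IsBigO.of_bound (24 * (S.k * c) * M) (Eventually.of_forall fun h => by
      rw [InnerProductSpace.toDual_apply_apply, Real.norm_eq_abs,
        Real.norm_of_nonneg (by positivity), mul_comm (√‖h‖)]
      exact hexp h)
  refine h1.trans_isLittleO ?_
  have h2 : (fun h : E3 => √‖h‖) =o[𝓝 0] fun _ => (1 : ℝ) := by
    rw [Asymptotics.isLittleO_one_iff]
    have : Continuous fun h : E3 => √‖h‖ := by fun_prop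
    simpa using this.tendsto 0
  have h3 := h2.mul_isBigO (Asymptotics.isBigO_refl (fun h : E3 => ‖h‖) (𝓝 0))
  simp only [one_mul] at h3
  exact h3.of_norm_right

lemma gradient_selfPotential {ζ : Q} (hζ : ∀ x ∈ closure S.B, 0 < (C.defGrad ζ x).det)
    (χ : E3) : gradient (C.selfPotential ζ) χ = C.selfField ζ χ :=
  (C.hasGradientAt_selfPotential hζ χ).gradient

/-- The mass density of pairs. -/
def pairDensity (S : Body) (p : E3 × E3) : ℝ := S.ρ p.1 * (S.k * S.ρ p.2)

lemma aestronglyMeasurable_pairDensity : AEStronglyMeasurable (pairDensity S) (pairs S) :=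
  ((aestronglyMeasurable_density S).comp_fst).mul
    (((aestronglyMeasurable_density S).const_mul S.k).comp_snd)

lemma abs_pairDensity_le {c : ℝ} (hc : ∀ x ∈ closure S.B, |S.ρ x| ≤ c) (h0 : 0 ≤ c) :
    ∀ᵐ p ∂(pairs S), |pairDensity S p| ≤ c * (S.k * c) := by
  refine ae_pairs_of_forall fun x hx y hy => ?_
  rw [pairDensity, abs_mul]
  exact mul_le_mul (hc x (subset_closure hx)) (norm_density_le hc hy) (abs_nonneg _) h0

lemma selfEnergy_eq {ζ : Q} {M : ℝ}
    (h : ∀ χ : E3, Tame (volume.restrict S.B) (fun x => C.ev ζ x - χ) M) :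
    C.selfEnergy ζ = -(1 / 2) * ∫ p, pairDensity S p / ‖C.ev ζ p.2 - C.ev ζ p.1‖ ∂(pairs S) := by
  obtain ⟨c, hc0, hc⟩ := exists_density_bound S
  have hi := (C.tame_pairs h).integrable_newton aestronglyMeasurable_pairDensity
    (abs_pairDensity_le hc hc0)
  rw [integral_prod _ hi, selfEnergy, neg_mul, ← mul_neg, ← integral_neg]
  congr 1
  refine integral_congr_ae (Eventually.of_forall fun x => ?_)
  simp only [selfPotential, pairDensity, mul_neg, neg_inj]
  rw [← integral_const_mul]
  congr 1
  ext y
  ring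

/-- The derivative of the self-gravitational energy along `δ`, as an integral over pairs. -/
lemma selfEnergy_expansion {ζ δ : Q} {M t : ℝ}
    (h : ∀ χ : E3, Tame (volume.restrict S.B) (fun x => C.ev ζ x - χ) M)
    (h' : ∀ χ : E3, Tame (volume.restrict S.B) (fun x => C.ev (ζ + δ) x - χ) M)
    (ht0 : 0 ≤ t) (ht : ∀ x ∈ S.B, ‖C.ev δ x‖ ≤ t) {c : ℝ}
    (hc0 : 0 ≤ c) (hc : ∀ x ∈ closure S.B, |S.ρ x| ≤ c) :
    |C.selfEnergy (ζ + δ) - C.selfEnergy ζ - (1 / 2) * ∫ p, pairDensity S p *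
      (inner ℝ (C.ev ζ p.2 - C.ev ζ p.1) (C.ev δ p.2 - C.ev δ p.1) / ‖C.ev ζ p.2 - C.ev ζ p.1‖ ^ 3)
        ∂(pairs S)| ≤ 12 * (c * (S.k * c)) * (M * volume.real S.B) * (2 * t * √(2 * t)) := by
  have hm := (C.aestronglyMeasurable_snd δ).sub (C.aestronglyMeasurable_fst δ)
  have hT : Tame (pairs S) (fun p => C.ev ζ p.2 - C.ev ζ p.1 + (C.ev δ p.2 - C.ev δ p.1))
      (M * volume.real S.B) := by
    have := C.tame_pairs h'
    simpa only [map_add, Pi.add_apply, add_sub_add_comm] using this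
  have key := (C.tame_pairs h).newton_expansion hT hm (t := 2 * t)
    (ae_pairs_of_forall fun x hx y hy => (norm_sub_le _ _).trans
      (by linarith [ht x hx, ht y hy])) (by positivity) aestronglyMeasurable_pairDensity
    (abs_pairDensity_le hc hc0) (by have := S.k_pos; positivity)
  rw [C.selfEnergy_eq h, C.selfEnergy_eq h']
  simp only [map_add, Pi.add_apply, add_sub_add_comm]
  rw [← abs_neg]
  set J := ∫ p, pairDensity S p *
      (inner ℝ (C.ev ζ p.2 - C.ev ζ p.1) (C.ev δ p.2 - C.ev δ p.1) / ‖C.ev ζ p.2 - C.ev ζ p.1‖ ^ 3)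
        ∂(pairs S)
  calc _ = |1 / 2 * (∫ p, pairDensity S p / ‖C.ev ζ p.2 - C.ev ζ p.1 + (C.ev δ p.2 - C.ev δ p.1)‖
        ∂(pairs S) - ∫ p, pairDensity S p / ‖C.ev ζ p.2 - C.ev ζ p.1‖ ∂(pairs S) + J)| := by
        congr 1; ring
    _ ≤ 1 / 2 * (24 * (c * (S.k * c)) * (M * volume.real S.B) * (2 * t * √(2 * t))) := by
        rw [abs_mul, abs_of_pos (show (0 : ℝ) < 1 / 2 by norm_num)]
        exact mul_le_mul_of_nonneg_left key (by norm_num)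
    _ = _ := by ring

/-- Exchanging the two material points identifies, up to sign, the contributions of δ at either end
(action and reaction); the two equal halves compensate the factor 1/2 in the energy. -/
lemma integral_pairs_eq {ζ δ : Q} {M : ℝ}
    (h : ∀ χ : E3, Tame (volume.restrict S.B) (fun x => C.ev ζ x - χ) M) :
    (1 / 2) * ∫ p, pairDensity S p * (inner ℝ (C.ev ζ p.2 - C.ev ζ p.1) (C.ev δ p.2 - C.ev δ p.1)
      / ‖C.ev ζ p.2 - C.ev ζ p.1‖ ^ 3) ∂(pairs S) =
    ∫ x in S.B, S.ρ x * inner ℝ (C.selfField ζ (C.ev ζ x)) (C.ev δ x) := by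
  obtain ⟨c, hc0, hc⟩ := exists_density_bound S
  obtain ⟨κ, hκ, hbound⟩ := C.exists_bound
  have hdens := abs_pairDensity_le hc hc0
  have hT := C.tame_pairs h
  have i1 := hT.integrable_grad (C.aestronglyMeasurable_fst δ) (t := κ * ‖δ‖)
    (ae_pairs_of_forall fun x hx y hy => (hbound δ x (subset_closure hx)).1)
    aestronglyMeasurable_pairDensity hdens
  have i2 := hT.integrable_grad (C.aestronglyMeasurable_snd δ) (t := κ * ‖δ‖)
    (ae_pairs_of_forall fun x hx y hy => (hbound δ y (subset_closure hy)).1)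
    aestronglyMeasurable_pairDensity hdens
  have hswap : ∫ p, pairDensity S p * (inner ℝ (C.ev ζ p.2 - C.ev ζ p.1) (C.ev δ p.2)
      / ‖C.ev ζ p.2 - C.ev ζ p.1‖ ^ 3) ∂(pairs S) =
      -∫ p, pairDensity S p * (inner ℝ (C.ev ζ p.2 - C.ev ζ p.1) (C.ev δ p.1)
      / ‖C.ev ζ p.2 - C.ev ζ p.1‖ ^ 3) ∂(pairs S) := by
    rw [← integral_neg, ← integral_prod_swap]
    congr 1
    ext p
    simp only [Prod.fst_swap, Prod.snd_swap, pairDensity]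
    rw [← neg_sub (C.ev ζ p.2), inner_neg_left, norm_neg]
    ring
  have hsplit : ∫ p, pairDensity S p * (inner ℝ (C.ev ζ p.2 - C.ev ζ p.1) (C.ev δ p.2 - C.ev δ p.1)
      / ‖C.ev ζ p.2 - C.ev ζ p.1‖ ^ 3) ∂(pairs S) =
      -2 * ∫ p, pairDensity S p * (inner ℝ (C.ev ζ p.2 - C.ev ζ p.1) (C.ev δ p.1)
      / ‖C.ev ζ p.2 - C.ev ζ p.1‖ ^ 3) ∂(pairs S) := by
    have e : (fun p => pairDensity S p * (inner ℝ (C.ev ζ p.2 - C.ev ζ p.1)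
        (C.ev δ p.2 - C.ev δ p.1) / ‖C.ev ζ p.2 - C.ev ζ p.1‖ ^ 3)) =
        fun p => pairDensity S p * (inner ℝ (C.ev ζ p.2 - C.ev ζ p.1) (C.ev δ p.2)
          / ‖C.ev ζ p.2 - C.ev ζ p.1‖ ^ 3) - pairDensity S p *
          (inner ℝ (C.ev ζ p.2 - C.ev ζ p.1) (C.ev δ p.1) / ‖C.ev ζ p.2 - C.ev ζ p.1‖ ^ 3) := by
      ext p
      rw [inner_sub_right]
      ring
    rw [e, integral_sub i2 i1, hswap]
    ring
  rw [hsplit, integral_prod _ i1, ← mul_assoc, show (1 / 2 * -2 : ℝ) = -1 by norm_num, neg_one_mul,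
    ← integral_neg]
  refine integral_congr_ae (Eventually.of_forall fun x => ?_)
  dsimp only
  rw [selfField, inner_neg_left, real_inner_comm, ← integral_inner (C.integrable_field (h _)),
    mul_neg, ← integral_const_mul]
  congr 2
  ext y
  rw [inner_smul_right, real_inner_comm, pairDensity]
  ring

lemma hasDerivAt_selfEnergy {ζ : Q} (hζ : ∀ x ∈ closure S.B, 0 < (C.defGrad ζ x).det) (δ : Q) :
    HasDerivAt (fun s : ℝ => C.selfEnergy (ζ + s • δ))
      (∫ x in S.B, S.ρ x * inner ℝ (C.selfField ζ (C.ev ζ x)) (C.ev δ x)) 0 := by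
  obtain ⟨r, hr, M, hM⟩ := C.exists_tame hζ
  have hT : ∀ χ, Tame (volume.restrict S.B) (fun x => C.ev ζ x - χ) M := hM ζ (by simp [hr.le])
  obtain ⟨c, hc0, hc⟩ := exists_density_bound S
  obtain ⟨κ, hκ, hbound⟩ := C.exists_bound
  rw [hasDerivAt_iff_isLittleO_nhds_zero]
  set J := ∫ x in S.B, S.ρ x * inner ℝ (C.selfField ζ (C.ev ζ x)) (C.ev δ x) with hJ
  set D := 12 * (c * (S.k * c)) * (M * volume.real S.B) with hD
  set b := 2 * (κ * ‖δ‖) with hb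
  have hb0 : 0 ≤ b := by positivity
  have hnear : ∀ᶠ s : ℝ in 𝓝 0, ‖s • δ‖ ≤ r := by
    have : Continuous fun s : ℝ => ‖s • δ‖ := by fun_prop
    have h0 := this.tendsto 0
    simp only [zero_smul, norm_zero] at h0
    exact (h0.eventually_lt_const hr).mono fun s hs => hs.le
  have h1 : (fun s : ℝ => C.selfEnergy (ζ + (0 + s) • δ) - C.selfEnergy (ζ + (0 : ℝ) • δ) - s • J)
      =O[𝓝 0] fun s => √|s| * s := by
    refine Asymptotics.IsBigO.of_bound (D * (b * √b)) ?_
    filter_upwards [hnear] with s hs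
    have key := C.selfEnergy_expansion hT (δ := s • δ) (hM (ζ + s • δ) (by simpa using hs))
      (t := |s| * (κ * ‖δ‖)) (by positivity) (fun x hx => by
        rw [map_smul, Pi.smul_apply, norm_smul, Real.norm_eq_abs]
        gcongr
        exact (hbound δ x (subset_closure hx)).1) hc0 hc
    rw [C.integral_pairs_eq hT] at key
    have e : ∫ x in S.B, S.ρ x * inner ℝ (C.selfField ζ (C.ev ζ x)) (C.ev (s • δ) x) = s • J := by
      rw [hJ, smul_eq_mul, ← integral_const_mul]
      congr 1
      ext x
      rw [map_smul, Pi.smul_apply, inner_smul_right]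
      ring
    rw [e] at key
    rw [zero_add, zero_smul, add_zero, Real.norm_eq_abs]
    refine key.trans (le_of_eq ?_)
    have e2 : 2 * (|s| * (κ * ‖δ‖)) = |s| * b := by rw [hb]; ring
    rw [e2, Real.sqrt_mul (abs_nonneg s), norm_mul, Real.norm_eq_abs s,
      Real.norm_of_nonneg (Real.sqrt_nonneg _)]
    ring
  refine h1.trans_isLittleO ?_
  have h2 : (fun s : ℝ => √|s|) =o[𝓝 0] fun _ => (1 : ℝ) := by
    rw [Asymptotics.isLittleO_one_iff]
    have : Continuous fun s : ℝ => √|s| := by fun_prop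
    simpa using this.tendsto 0
  simpa only [one_mul] using h2.mul_isBigO (Asymptotics.isBigO_refl (fun s : ℝ => s) (𝓝 0))

lemma continuousAt_selfEnergy {ζ : Q} (hζ : ∀ x ∈ closure S.B, 0 < (C.defGrad ζ x).det) :
    ContinuousAt C.selfEnergy ζ := by
  obtain ⟨r, hr, M, hM⟩ := C.exists_tame hζ
  have hT : ∀ χ, Tame (volume.restrict S.B) (fun x => C.ev ζ x - χ) M := hM ζ (by simp [hr.le])
  obtain ⟨c, hc0, hc⟩ := exists_density_bound S
  obtain ⟨κ, hκ, hbound⟩ := C.exists_bound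
  set D := 12 * (c * (S.k * c)) * (M * volume.real S.B) with hD
  set D' := 1 / 2 * (c * (S.k * c)) * ((pairs S).real univ + M * volume.real S.B) with hD'
  have hest : ∀ᶠ ζ' : Q in 𝓝 ζ, |C.selfEnergy ζ' - C.selfEnergy ζ| ≤
      D * (2 * (κ * ‖ζ' - ζ‖) * √(2 * (κ * ‖ζ' - ζ‖))) + D' * (2 * (κ * ‖ζ' - ζ‖)) := by
    filter_upwards [Metric.closedBall_mem_nhds ζ hr] with ζ' hζ'
    rw [Metric.mem_closedBall, dist_eq_norm] at hζ'
    set δ := ζ' - ζ with hδ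
    have e : ζ' = ζ + δ := by rw [hδ]; abel
    have hδb : ∀ x ∈ S.B, ‖C.ev δ x‖ ≤ κ * ‖δ‖ := fun x hx => (hbound δ x (subset_closure hx)).1
    have key := C.selfEnergy_expansion hT (δ := δ) (fun χ => by rw [← e]; exact hM ζ' hζ' χ)
      (t := κ * ‖δ‖) (by positivity) hδb hc0 hc
    have key2 := (C.tame_pairs hT).abs_integral_grad_le (t := 2 * (κ * ‖δ‖))
      (h := fun p => C.ev δ p.2 - C.ev δ p.1)
      (ae_pairs_of_forall fun x hx y hy => (norm_sub_le _ _).trans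
        (by linarith [hδb x hx, hδb y hy])) (by positivity) (abs_pairDensity_le hc hc0)
      (by have := S.k_pos; positivity)
    rw [← e] at key
    set J := ∫ p, pairDensity S p * (inner ℝ (C.ev ζ p.2 - C.ev ζ p.1) (C.ev δ p.2 - C.ev δ p.1)
      / ‖C.ev ζ p.2 - C.ev ζ p.1‖ ^ 3) ∂(pairs S)
    have h3 : |1 / 2 * J| ≤ D' * (2 * (κ * ‖δ‖)) := by
      rw [abs_mul, abs_of_pos (show (0 : ℝ) < 1 / 2 by norm_num)]
      calc _ ≤ 1 / 2 * _ := mul_le_mul_of_nonneg_left key2 (by norm_num)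
        _ = _ := by rw [hD']; ring
    calc _ = |(C.selfEnergy ζ' - C.selfEnergy ζ - 1 / 2 * J) + 1 / 2 * J| := by congr 1; ring
      _ ≤ _ := abs_add_le _ _
      _ ≤ _ := add_le_add key h3
  rw [ContinuousAt, tendsto_iff_norm_sub_tendsto_zero]
  refine squeeze_zero' (Eventually.of_forall fun _ => norm_nonneg _) hest ?_
  have : Continuous fun ζ' : Q => D * (2 * (κ * ‖ζ' - ζ‖) * √(2 * (κ * ‖ζ' - ζ‖))) +
      D' * (2 * (κ * ‖ζ' - ζ‖)) := by fun_prop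
  simpa using this.tendsto ζ

end ConfigSpace

end ElasticSatellite
end

noncomputable section

namespace ElasticSatellite

/-! ### Integral functionals of linear fields -/

/-- A bounded linear family of continuous fields on the closed body. -/
structure LinearField (S : Body) (Z Y : Type*) [NormedAddCommGroup Z] [NormedSpace ℝ Z]
    [NormedAddCommGroup Y] [NormedSpace ℝ Y] where
  /-- the field associated with a parameter -/
  app : Z → E3 → Y
  add_smul_app : ∀ z δ (s : ℝ), ∀ x ∈ closure S.B, app (z + s • δ) x = app z x + s • app δ x
  continuousOn_app : ∀ z, ContinuousOn (app z) (closure S.B)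
  bound : ∃ c > 0, ∀ z, ∀ x ∈ closure S.B, ‖app z x‖ ≤ c * ‖z‖

namespace LinearField

variable {S : Body} {Z Y E : Type*} [NormedAddCommGroup Z] [NormedSpace ℝ Z]
  [NormedAddCommGroup Y] [NormedSpace ℝ Y] [NormedAddCommGroup E] [NormedSpace ℝ E]
  (p : LinearField S Z Y)

/-- The field of z sends the compact closed body into a compact subset of U, and a closed thickening
of it still lies in U. Nearby parameters take values in that thickening, which supplies constant
dominating functions under the integral sign. -/
lemma exists_compact_tube [ProperSpace Y] {U : Set Y} (hU : IsOpen U) {z : Z}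
    (hz : ∀ x ∈ closure S.B, p.app z x ∈ U) :
    ∃ r > 0, ∃ K, IsCompact K ∧ K ⊆ U ∧ ∀ z', ‖z' - z‖ ≤ r → ∀ x ∈ closure S.B, p.app z' x ∈ K := by
  have hK : IsCompact (p.app z '' closure S.B) :=
    S.isCompact_closure.image_of_continuousOn (p.continuousOn_app z)
  obtain ⟨e, he, hsub⟩ := hK.exists_cthickening_subset_open hU (image_subset_iff.2 hz)
  obtain ⟨c, hc, hbound⟩ := p.bound
  refine ⟨e / c, by positivity, Metric.cthickening e (p.app z '' closure S.B), hK.cthickening, hsub,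
    fun z' hz' x hx => ?_⟩
  refine Metric.mem_cthickening_of_dist_le _ _ _ _ (mem_image_of_mem _ hx) ?_
  have h1 := p.add_smul_app z (z' - z) 1 x hx
  rw [one_smul, one_smul, add_sub_cancel] at h1
  rw [h1, dist_eq_norm, add_sub_cancel_left]
  refine (hbound _ x hx).trans ?_
  calc c * ‖z' - z‖ ≤ c * (e / c) := by gcongr
    _ = e := by field_simp

lemma continuousOn_comp {U : Set Y} {j : E3 → Y → E}
    (hj : ContinuousOn (fun q : E3 × Y => j q.1 q.2) (closure S.B ×ˢ U)) {z : Z}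
    (hz : ∀ x ∈ closure S.B, p.app z x ∈ U) :
    ContinuousOn (fun x => j x (p.app z x)) (closure S.B) :=
  hj.comp (continuousOn_id.prodMk (p.continuousOn_app z)) fun x hx => ⟨hx, hz x hx⟩

lemma aestronglyMeasurable_comp {U : Set Y} {j : E3 → Y → E}
    (hj : ContinuousOn (fun q : E3 × Y => j q.1 q.2) (closure S.B ×ˢ U)) {z : Z}
    (hz : ∀ x ∈ closure S.B, p.app z x ∈ U) :
    AEStronglyMeasurable (fun x => j x (p.app z x)) (volume.restrict S.B) :=
  ((p.continuousOn_comp hj hz).mono subset_closure).aestronglyMeasurable S.measurableSet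

variable [ProperSpace Y] {U : Set Y} (hU : IsOpen U) {z : Z}
  (hz : ∀ x ∈ closure S.B, p.app z x ∈ U)
include hU hz

lemma continuousAt_integral {j : E3 → Y → E}
    (hj : ContinuousOn (fun q : E3 × Y => j q.1 q.2) (closure S.B ×ˢ U)) :
    ContinuousAt (fun z => ∫ x in S.B, j x (p.app z x)) z := by
  obtain ⟨r, hr, K, hK, hKU, htube⟩ := p.exists_compact_tube hU hz
  obtain ⟨b, hb⟩ := (S.isCompact_closure.prod hK).exists_bound_of_continuousOn
    (hj.mono (prod_mono le_rfl hKU))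
  have hnear : ∀ᶠ z' in 𝓝 z, ‖z' - z‖ ≤ r := by
    filter_upwards [Metric.closedBall_mem_nhds z hr] with z' hz'
    rwa [Metric.mem_closedBall, dist_eq_norm] at hz'
  obtain ⟨c, hc, hbound⟩ := p.bound
  refine continuousAt_of_dominated (bound := fun _ => b) ?_ ?_ (integrable_const _) ?_
  · filter_upwards [hnear] with z' hz'
    exact p.aestronglyMeasurable_comp hj fun x hx => hKU (htube z' hz' x hx)
  · filter_upwards [hnear] with z' hz'
    exact ConfigSpace.ae_restrict_of_forall fun x hx =>
      hb (x, p.app z' x) ⟨subset_closure hx, htube z' hz' x (subset_closure hx)⟩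
  · refine ConfigSpace.ae_restrict_of_forall fun x hx => ?_
    have hxc := subset_closure hx
    have h1 : ContinuousAt (fun z => p.app z x) z := by
      rw [ContinuousAt, tendsto_iff_norm_sub_tendsto_zero]
      refine squeeze_zero (fun _ => norm_nonneg _) (g := fun z' => c * ‖z' - z‖) (fun z' => ?_) ?_
      · have h1 := p.add_smul_app z (z' - z) 1 x hxc
        rw [one_smul, one_smul, add_sub_cancel] at h1
        rw [h1, add_sub_cancel_left]
        exact hbound _ x hxc
      · have : Continuous fun z' : Z => c * ‖z' - z‖ := by fun_prop
        simpa using this.tendsto z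
    have h2 : ContinuousAt (j x) (p.app z x) := by
      have h3 : ContinuousOn (fun y => j x y) U :=
        hj.comp (Continuous.continuousOn (by fun_prop : Continuous fun y : Y => (x, y)))
          fun y hy => ⟨hxc, hy⟩
      exact h3.continuousAt (hU.mem_nhds (hz x hxc))
    exact h2.comp (f := fun z => p.app z x) h1

lemma hasDerivAt_integral {j : E3 → Y → E} {j' : E3 → Y → Y →L[ℝ] E}
    (hj : ContinuousOn (fun q : E3 × Y => j q.1 q.2) (closure S.B ×ˢ U))
    (hj' : ContinuousOn (fun q : E3 × Y => j' q.1 q.2) (closure S.B ×ˢ U))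
    (hd : ∀ x ∈ S.B, ∀ y ∈ U, HasFDerivAt (j x) (j' x y) y) (δ : Z) :
    HasDerivAt (fun s : ℝ => ∫ x in S.B, j x (p.app (z + s • δ) x))
      (∫ x in S.B, j' x (p.app z x) (p.app δ x)) 0 := by
  obtain ⟨r, hr, K, hK, hKU, htube⟩ := p.exists_compact_tube hU hz
  obtain ⟨b, hb⟩ := (S.isCompact_closure.prod hK).exists_bound_of_continuousOn
    (hj.mono (prod_mono le_rfl hKU))
  obtain ⟨b', hb'⟩ := (S.isCompact_closure.prod hK).exists_bound_of_continuousOn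
    (hj'.mono (prod_mono le_rfl hKU))
  obtain ⟨c, hc, hbound⟩ := p.bound
  have hset : {s : ℝ | ‖s • δ‖ < r} ∈ 𝓝 (0 : ℝ) := by
    have : Continuous fun s : ℝ => ‖s • δ‖ := by fun_prop
    exact (isOpen_lt this continuous_const).mem_nhds (by simpa using hr)
  have hin : ∀ s ∈ {s : ℝ | ‖s • δ‖ < r}, ∀ x ∈ closure S.B, p.app (z + s • δ) x ∈ K :=
    fun s hs x hx => htube _ (by rw [add_sub_cancel_left]; exact hs.le) x hx
  have h0 : (0 : ℝ) ∈ {s : ℝ | ‖s • δ‖ < r} := by simpa using hr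
  have hδc := p.continuousOn_app δ
  have key := hasDerivAt_integral_of_dominated_loc_of_deriv_le (μ := volume.restrict S.B)
    (F := fun s x => j x (p.app (z + s • δ) x))
    (F' := fun s x => j' x (p.app (z + s • δ) x) (p.app δ x)) (x₀ := 0)
    (bound := fun _ => b' * (c * ‖δ‖)) hset ?_ ?_ ?_ ?_ (integrable_const _) ?_
  · simpa using key.2
  · filter_upwards [hset] with s hs
    exact p.aestronglyMeasurable_comp hj fun x hx => hKU (hin s hs x hx)
  · refine Integrable.mono' (integrable_const b)
      (p.aestronglyMeasurable_comp hj fun x hx => hKU (hin 0 h0 x hx)) ?_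
    exact ConfigSpace.ae_restrict_of_forall fun x hx =>
      hb (x, p.app (z + (0 : ℝ) • δ) x) ⟨subset_closure hx, hin 0 h0 x (subset_closure hx)⟩
  · have h1 := p.continuousOn_comp hj' (z := z + (0 : ℝ) • δ) fun x hx => hKU (hin 0 h0 x hx)
    exact ((h1.clm_apply hδc).mono subset_closure).aestronglyMeasurable S.measurableSet
  · refine ConfigSpace.ae_restrict_of_forall fun x hx s hs => ?_
    have hxc := subset_closure hx
    refine (ContinuousLinearMap.le_opNorm _ _).trans ?_
    have h1 := hb' (x, p.app (z + s • δ) x) ⟨hxc, hin s hs x hxc⟩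
    exact mul_le_mul h1 (hbound δ x hxc) (norm_nonneg _) ((norm_nonneg _).trans h1)
  · refine ConfigSpace.ae_restrict_of_forall fun x hx s hs => ?_
    have hxc := subset_closure hx
    have h1 : HasDerivAt (fun s : ℝ => p.app z x + s • p.app δ x) (p.app δ x) s := by
      simpa using ((hasDerivAt_id s).smul_const (p.app δ x)).const_add (p.app z x)
    have h2 : (fun s : ℝ => p.app z x + s • p.app δ x) = fun s : ℝ => p.app (z + s • δ) x := by
      ext s; exact (p.add_smul_app z δ s x hxc).symm
    rw [h2] at h1
    exact (hd x hx _ (hKU (hin s hs x hxc))).comp_hasDerivAt s h1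

end LinearField

namespace ConfigSpace

variable {S : Body} {Q : Type*} [NormedAddCommGroup Q] [NormedSpace ℝ Q] (C : ConfigSpace S Q)

/-- The configurations, as fields. -/
def evField : LinearField S Q E3 where
  app := fun ζ => C.ev ζ
  add_smul_app := fun z δ s x _ => by simp
  continuousOn_app := C.continuousOn_ev
  bound := by
    obtain ⟨c, hc, h⟩ := C.exists_bound
    exact ⟨c, hc, fun z x hx => (h z x hx).1⟩

/-- The deformation gradients, as fields. -/
def gradField : LinearField S Q (E3 →L[ℝ] E3) where
  app := fun ζ => C.defGrad ζ
  add_smul_app := fun z δ s x hx => by rw [C.defGrad_add hx, C.defGrad_smul hx]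
  continuousOn_app := C.continuousOn_defGrad
  bound := by
    obtain ⟨c, hc, h⟩ := C.exists_bound
    exact ⟨c, hc, fun z x hx => (h z x hx).2⟩

/-- The pairs (position, velocity), as fields. -/
def stateField : LinearField S (Q × Q) (E3 × E3) where
  app := fun z x => (C.ev z.1 x, C.ev z.2 x)
  add_smul_app := fun z δ s x _ => by simp
  continuousOn_app := fun z => (C.continuousOn_ev z.1).prodMk (C.continuousOn_ev z.2)
  bound := by
    obtain ⟨c, hc, h⟩ := C.exists_bound
    refine ⟨c, hc, fun z x hx => ?_⟩
    rw [Prod.norm_def]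
    refine max_le ((h z.1 x hx).1.trans ?_) ((h z.2 x hx).1.trans ?_)
    · exact mul_le_mul_of_nonneg_left (norm_fst_le z) hc.le
    · exact mul_le_mul_of_nonneg_left (norm_snd_le z) hc.le

lemma continuousOn_density_fst {Y : Type*} [TopologicalSpace Y] (U : Set Y) :
    ContinuousOn (fun q : E3 × Y => S.ρ q.1) (closure S.B ×ˢ U) :=
  S.ρ_smooth.continuousOn.comp continuousOn_fst fun _ hq => hq.1

/-! #### Kinetic energy -/

lemma kinetic_eq (v : Q) :
    C.kinetic v = ∫ x in S.B, S.ρ x * (1 / 2 * ‖C.evField.app v x‖ ^ 2) := by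
  rw [kinetic, ← integral_const_mul]
  congr 1
  ext x
  change _ = S.ρ x * (1 / 2 * ‖C.ev v x‖ ^ 2)
  ring

lemma continuous_kinetic : Continuous C.kinetic := by
  rw [continuous_iff_continuousAt, show C.kinetic = _ from funext C.kinetic_eq]
  exact fun v => C.evField.continuousAt_integral isOpen_univ (fun _ _ => mem_univ _)
    (j := fun x u => S.ρ x * (1 / 2 * ‖u‖ ^ 2))
    ((continuousOn_density_fst _).mul (Continuous.continuousOn (by fun_prop)))

lemma hasDerivAt_kinetic (v δ : Q) : HasDerivAt (fun s : ℝ => C.kinetic (v + s • δ))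
    (∫ x in S.B, S.ρ x * inner ℝ (C.ev v x) (C.ev δ x)) 0 := by
  simp only [C.kinetic_eq]
  refine C.evField.hasDerivAt_integral isOpen_univ (fun _ _ => mem_univ _)
    (j := fun x u => S.ρ x * (1 / 2 * ‖u‖ ^ 2)) (j' := fun x u => S.ρ x • innerSL ℝ u)
    ((continuousOn_density_fst _).mul (Continuous.continuousOn (by fun_prop)))
    ((continuousOn_density_fst _).smul (Continuous.continuousOn (by fun_prop))) ?_ δ
  intro x _ u _
  have h1 := ((hasStrictFDerivAt_norm_sq u).hasFDerivAt.const_mul (1 / 2 : ℝ)).const_mul (S.ρ x)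
  refine h1.congr_fderiv ?_
  ext h
  simp

/-! #### Energy in the field of the planet -/

/-- The field of the planet. -/
def _root_.ElasticSatellite.Body.planetField (S : Body) (χ : E3) : E3 :=
  (S.k * S.M / ‖χ‖ ^ 3) • χ

lemma hasFDerivAt_planetPotential {χ : E3} (h : χ ≠ 0) :
    HasFDerivAt S.planetPotential (innerSL ℝ (S.planetField χ)) χ := by
  have h0 : ‖χ‖ ≠ 0 := norm_ne_zero_iff.2 h
  have h1 : HasFDerivAt (fun χ : E3 => ‖χ‖) (‖χ‖⁻¹ • innerSL ℝ χ) χ := by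
    have h2 := (hasStrictFDerivAt_norm_sq χ).hasFDerivAt.sqrt (by positivity)
    simp only [Real.sqrt_sq (norm_nonneg _)] at h2
    refine h2.congr_fderiv ?_
    ext v
    simp
    field_simp
  have h3 := ((hasDerivAt_inv h0).comp_hasFDerivAt χ h1).const_mul (-(S.k * S.M))
  have e : S.planetPotential = fun χ => -(S.k * S.M) * (Inv.inv ∘ fun χ : E3 => ‖χ‖) χ := by
    ext χ; simp [Body.planetPotential, div_eq_mul_inv]
  rw [e]
  refine h3.congr_fderiv ?_
  ext v
  simp [Body.planetField]
  field_simp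

lemma gradient_planetPotential {χ : E3} (h : χ ≠ 0) :
    gradient S.planetPotential χ = S.planetField χ := by
  refine HasGradientAt.gradient ?_
  rw [hasGradientAt_iff_hasFDerivAt]
  exact hasFDerivAt_planetPotential h

lemma continuousOn_planetPotential : ContinuousOn S.planetPotential {χ | χ ≠ 0} :=
  fun _ h => (hasFDerivAt_planetPotential h).continuousAt.continuousWithinAt

lemma continuousOn_planetField : ContinuousOn S.planetField {χ | χ ≠ 0} := by
  have h1 : ContinuousOn (fun χ : E3 => S.k * S.M / ‖χ‖ ^ 3) {χ | χ ≠ 0} :=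
    continuousOn_const.div (Continuous.continuousOn (by fun_prop))
      fun χ h => pow_ne_zero _ (norm_ne_zero_iff.2 h)
  exact h1.smul continuousOn_id

variable {C} in
lemma IsRegular.ev_ne_zero {z : Q × Q} (hz : C.IsRegular z) {x : E3} (hx : x ∈ closure S.B) :
    C.ev z.1 x ≠ 0 := by
  intro h0
  have h1 : C.ev z.1 x ∈ closure (C.ev z.1 '' S.B) :=
    (C.continuousOn_ev z.1).image_closure (mem_image_of_mem _ hx)
  rw [h0] at h1
  have := Metric.infDist_zero_of_mem_closure h1
  exact hz.1.ne' this

lemma isOpen_ne_zero : IsOpen {χ : E3 | χ ≠ 0} := isOpen_ne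

lemma continuousOn_planet_density : ContinuousOn (fun q : E3 × E3 => S.ρ q.1 * S.planetPotential q.2)
    (closure S.B ×ˢ {χ | χ ≠ 0}) :=
  (continuousOn_density_fst _).mul
    (continuousOn_planetPotential.comp continuousOn_snd fun _ hq => hq.2)

lemma continuousAt_planetEnergy {z : Q × Q} (hz : C.IsRegular z) :
    ContinuousAt C.planetEnergy z.1 :=
  C.evField.continuousAt_integral isOpen_ne_zero (fun _ hx => hz.ev_ne_zero hx)
    (j := fun x χ => S.ρ x * S.planetPotential χ) continuousOn_planet_density

lemma hasDerivAt_planetEnergy {z : Q × Q} (hz : C.IsRegular z) (δ : Q) :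
    HasDerivAt (fun s : ℝ => C.planetEnergy (z.1 + s • δ))
      (∫ x in S.B, S.ρ x * inner ℝ (S.planetField (C.ev z.1 x)) (C.ev δ x)) 0 := by
  refine C.evField.hasDerivAt_integral isOpen_ne_zero (fun _ hx => hz.ev_ne_zero hx)
    (j := fun x χ => S.ρ x * S.planetPotential χ)
    (j' := fun x χ => S.ρ x • innerSL ℝ (S.planetField χ)) continuousOn_planet_density ?_ ?_ δ
  · exact (continuousOn_density_fst _).smul ((innerSL ℝ).continuous.comp_continuousOn
      (continuousOn_planetField.comp continuousOn_snd fun _ hq => hq.2))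
  · intro x _ χ hχ
    exact (hasFDerivAt_planetPotential hχ).const_mul _

/-! #### Elastic energy -/

variable (S) in
/-- The domain of the stored energy function. -/
def energyDomain : Set (E3 × (E3 →L[ℝ] E3)) := closure S.B ×ˢ {F : E3 →L[ℝ] E3 | 0 < F.det}

lemma isOpen_det_pos : IsOpen {F : E3 →L[ℝ] E3 | 0 < F.det} :=
  isOpen_lt continuous_const continuous_det_clm

lemma uniqueDiffOn_energyDomain : UniqueDiffOn ℝ (energyDomain S) :=
  S.uniqueDiffOn_closure.prod isOpen_det_pos.uniqueDiffOn

variable (S) in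
/-- The stress `∂W/∂F`. -/
def stress (q : E3 × (E3 →L[ℝ] E3)) : (E3 →L[ℝ] E3) →L[ℝ] ℝ :=
  (fderivWithin ℝ (fun p : E3 × (E3 →L[ℝ] E3) => S.W p.1 p.2) (energyDomain S) q).comp
    (ContinuousLinearMap.inr ℝ E3 (E3 →L[ℝ] E3))

lemma contDiffOn_stress : ContDiffOn ℝ 1 (stress S) (energyDomain S) := by
  have h1 : ContDiffOn ℝ 1 (fderivWithin ℝ (fun p : E3 × (E3 →L[ℝ] E3) => S.W p.1 p.2)
    (energyDomain S)) (energyDomain S) :=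
    S.W_smooth.fderivWithin uniqueDiffOn_energyDomain (by norm_num)
  exact h1.clm_comp contDiffOn_const

/-- W is only differentiable within the closed body in x, but for x fixed the domain in F is open,
so the partial derivative in F is a genuine one even at boundary points. -/
lemma hasFDerivAt_stored {x : E3} (hx : x ∈ closure S.B) {F : E3 →L[ℝ] E3} (hF : 0 < F.det) :
    HasFDerivAt (S.W x) (stress S (x, F)) F := by
  have h1 := ((S.W_smooth.differentiableOn (by norm_num)) (x, F) ⟨hx, hF⟩).hasFDerivWithinAt
  have h2 : HasFDerivWithinAt (fun F : E3 →L[ℝ] E3 => (x, F))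
      (ContinuousLinearMap.inr ℝ E3 (E3 →L[ℝ] E3)) {F | 0 < F.det} F :=
    (hasFDerivAt_prodMk_right x F).hasFDerivWithinAt
  exact (h1.comp F h2 fun F hF => ⟨hx, hF⟩).hasFDerivAt (isOpen_det_pos.mem_nhds hF)

lemma fderiv_stored {x : E3} (hx : x ∈ closure S.B) {F : E3 →L[ℝ] E3} (hF : 0 < F.det) :
    fderiv ℝ (S.W x) F = stress S (x, F) := (hasFDerivAt_stored hx hF).fderiv

lemma continuousAt_elasticEnergy {ζ : Q} (hζ : ∀ x ∈ closure S.B, 0 < (C.defGrad ζ x).det) :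
    ContinuousAt C.elasticEnergy ζ :=
  C.gradField.continuousAt_integral isOpen_det_pos hζ (j := S.W) S.W_smooth.continuousOn

lemma hasDerivAt_elasticEnergy {ζ : Q} (hζ : ∀ x ∈ closure S.B, 0 < (C.defGrad ζ x).det) (δ : Q) :
    HasDerivAt (fun s : ℝ => C.elasticEnergy (ζ + s • δ))
      (∫ x in S.B, stress S (x, C.defGrad ζ x) (C.defGrad δ x)) 0 :=
  C.gradField.hasDerivAt_integral isOpen_det_pos hζ (j := S.W) (j' := fun x F => stress S (x, F))
    S.W_smooth.continuousOn contDiffOn_stress.continuousOn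
    (fun _ hx _ hF => hasFDerivAt_stored (subset_closure hx) hF) δ

/-! #### Angular momentum -/

lemma continuous_cross : Continuous fun q : E3 × E3 => cross q.1 q.2 := by
  unfold cross
  refine (PiLp.continuous_toLp 2 _).comp ?_
  refine continuous_pi fun i => ?_
  fin_cases i <;> simp [crossProduct] <;> fun_prop

lemma angMom_eq (z : Q × Q) : C.angMom z =
    ∫ x in S.B, S.ρ x • cross (C.stateField.app z x).1 (C.stateField.app z x).2 := by
  simp only [angMom, cross_smul_right]
  rfl

lemma continuous_angMom : Continuous C.angMom := by
  rw [continuous_iff_continuousAt, show C.angMom = _ from funext C.angMom_eq]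
  exact fun z => C.stateField.continuousAt_integral isOpen_univ (fun _ _ => mem_univ _)
    (j := fun x u => S.ρ x • cross u.1 u.2)
    ((continuousOn_density_fst _).smul (continuous_cross.comp continuous_snd).continuousOn)

lemma continuousOn_angMom_density (a b : Q) :
    ContinuousOn (fun x => S.ρ x • cross (C.ev a x) (C.ev b x)) (closure S.B) := by
  exact C.stateField.continuousOn_comp (U := univ) (z := (a, b))
    (j := fun x u => S.ρ x • cross u.1 u.2)
    ((continuousOn_density_fst _).smul (continuous_cross.comp continuous_snd).continuousOn)
    (fun _ _ => mem_univ _)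

lemma integrableOn_of_continuousOn_closure {E : Type*} [NormedAddCommGroup E] {f : E3 → E}
    (hf : ContinuousOn f (closure S.B)) : IntegrableOn f S.B :=
  (hf.integrableOn_compact S.isCompact_closure).mono_set subset_closure

lemma integral_quadratic {α E : Type*} [MeasurableSpace α] {μ : Measure α} [NormedAddCommGroup E]
    [NormedSpace ℝ E] {f g h k : α → E} (hf : Integrable f μ) (hg : Integrable g μ)
    (hh : Integrable h μ) (hk : Integrable k μ) (s : ℝ) :
    ∫ x, (f x + s • (g x + h x) + s ^ 2 • k x) ∂μ =
      ∫ x, f x ∂μ + s • (∫ x, g x ∂μ + ∫ x, h x ∂μ) + s ^ 2 • ∫ x, k x ∂μ := by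
  have h1 : Integrable (fun x => s • (g x + h x)) μ := (hg.add hh).smul s
  have h2 : Integrable (fun x => f x + s • (g x + h x)) μ := hf.add h1
  have h3 : Integrable (fun x => s ^ 2 • k x) μ := hk.smul _
  rw [integral_add h2 h3, integral_add hf h1, integral_smul, integral_smul, integral_add hg hh]

lemma hasDerivAt_quadratic {E : Type*} [NormedAddCommGroup E] [NormedSpace ℝ E] (a b c : E) :
    HasDerivAt (fun s : ℝ => a + s • b + s ^ 2 • c) b 0 := by
  have h1 := (((hasDerivAt_id (0 : ℝ)).smul_const b).const_add a).fun_add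
    ((hasDerivAt_pow 2 (0 : ℝ)).smul_const c)
  simpa using h1

lemma angMom_line (z δ : Q × Q) (s : ℝ) : C.angMom (z + s • δ) = C.angMom z +
    s • (C.angMom (z.1, δ.2) + C.angMom (δ.1, z.2)) + s ^ 2 • C.angMom δ := by
  have hi := fun a b => integrableOn_of_continuousOn_closure (C.continuousOn_angMom_density a b)
  simp only [angMom, cross_smul_right]
  rw [← integral_quadratic (hi _ _) (hi _ _) (hi _ _) (hi _ _)]
  congr 1
  ext1 x
  simp only [Prod.fst_add, Prod.snd_add, Prod.smul_fst, Prod.smul_snd, map_add, map_smul,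
    Pi.add_apply, Pi.smul_apply, cross_add_right, cross_add_left, cross_smul_right,
    cross_smul_left]
  module

lemma hasDerivAt_angMom (z δ : Q × Q) : HasDerivAt (fun s : ℝ => C.angMom (z + s • δ))
    (C.angMom (z.1, δ.2) + C.angMom (δ.1, z.2)) 0 := by
  simp only [C.angMom_line z δ]
  exact hasDerivAt_quadratic _ _ _

lemma continuousAt_energy {z : Q × Q} (hz : C.IsRegular z) : ContinuousAt C.energy z := by
  unfold energy
  exact ((C.continuous_kinetic.continuousAt.comp continuousAt_snd).add
    ((C.continuousAt_planetEnergy hz).comp continuousAt_fst)).add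
    ((C.continuousAt_selfEnergy hz.2).comp continuousAt_fst) |>.add
    ((C.continuousAt_elasticEnergy hz.2).comp continuousAt_fst)

lemma hasDerivAt_energy {z : Q × Q} (hz : C.IsRegular z) (δ : Q × Q) :
    HasDerivAt (fun s : ℝ => C.energy (z + s • δ))
      ((∫ x in S.B, S.ρ x * inner ℝ (C.ev z.2 x) (C.ev δ.2 x)) +
        (∫ x in S.B, S.ρ x * inner ℝ (S.planetField (C.ev z.1 x)) (C.ev δ.1 x)) +
        (∫ x in S.B, S.ρ x * inner ℝ (C.selfField z.1 (C.ev z.1 x)) (C.ev δ.1 x)) +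
        ∫ x in S.B, stress S (x, C.defGrad z.1 x) (C.defGrad δ.1 x)) 0 :=
  (((C.hasDerivAt_kinetic z.2 δ.2).add (C.hasDerivAt_planetEnergy hz δ.1)).add
    (C.hasDerivAt_selfEnergy hz.2 δ.1)).add (C.hasDerivAt_elasticEnergy hz.2 δ.1)

end ConfigSpace

end ElasticSatellite
end

noncomputable section

namespace ElasticSatellite

namespace ConfigSpace

variable {S : Body} {Q : Type*} [NormedAddCommGroup Q] [NormedSpace ℝ Q] (C : ConfigSpace S Q)

/-! ### Elastic forces -/

/-- The traction across the coordinate plane of index `a`, a column of the Piola–Kirchhoff stress. -/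
def traction (ζ : Q) (a : Fin 3) (x : E3) : E3 := WithLp.toLp 2 fun i => C.piola ζ x i a

lemma eq_sum_single (h : E3) : h = h 0 • EuclideanSpace.single 0 (1 : ℝ) +
    h 1 • EuclideanSpace.single 1 (1 : ℝ) + h 2 • EuclideanSpace.single 2 (1 : ℝ) := by
  apply ext3 <;> simp

lemma clm_eq_sum (A : E3 →L[ℝ] E3) :
    A = ∑ a, (EuclideanSpace.proj a : E3 →L[ℝ] ℝ).smulRight (A (EuclideanSpace.single a 1)) := by
  ext1 h
  conv_lhs => rw [eq_sum_single h]
  simp [Fin.sum_univ_three]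

variable {ζ : Q} (hζ : ∀ x ∈ closure S.B, 0 < (C.defGrad ζ x).det)

include hζ in
lemma piola_eq {x : E3} (hx : x ∈ closure S.B) (i a : Fin 3) :
    C.piola ζ x i a = stress S (x, C.defGrad ζ x)
      ((EuclideanSpace.proj a : E3 →L[ℝ] ℝ).smulRight (EuclideanSpace.single i (1 : ℝ))) := by
  rw [piola, fderiv_stored hx (hζ x hx)]

include hζ in
lemma inner_traction {x : E3} (hx : x ∈ closure S.B) (a : Fin 3) (h : E3) :
    inner ℝ (C.traction ζ a x) h =
      stress S (x, C.defGrad ζ x) ((EuclideanSpace.proj a : E3 →L[ℝ] ℝ).smulRight h) := by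
  have e : (EuclideanSpace.proj a : E3 →L[ℝ] ℝ).smulRight h =
      h 0 • (EuclideanSpace.proj a : E3 →L[ℝ] ℝ).smulRight (EuclideanSpace.single 0 (1 : ℝ)) +
      h 1 • (EuclideanSpace.proj a : E3 →L[ℝ] ℝ).smulRight (EuclideanSpace.single 1 (1 : ℝ)) +
      h 2 • (EuclideanSpace.proj a : E3 →L[ℝ] ℝ).smulRight (EuclideanSpace.single 2 (1 : ℝ)) := by
    ext1 y
    conv_lhs => rw [eq_sum_single h]
    simp [smul_smul, mul_comm]
  rw [inner_eq_sum, e, map_add, map_add, map_smul, map_smul, map_smul, ← C.piola_eq hζ hx,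
    ← C.piola_eq hζ hx, ← C.piola_eq hζ hx]
  simp only [traction, smul_eq_mul]
  ring

include hζ in
lemma contDiffOn_traction (a : Fin 3) : ContDiffOn ℝ 1 (C.traction ζ a) (closure S.B) := by
  rw [contDiffOn_euclidean]
  intro i
  have h1 : ContDiffOn ℝ 1 (fun x => stress S (x, C.defGrad ζ x)) (closure S.B) :=
    contDiffOn_stress.comp (contDiffOn_id.prodMk (C.contDiffOn_defGrad ζ)) fun x hx => ⟨hx, hζ x hx⟩
  exact (h1.clm_apply contDiffOn_const).congr fun x hx => C.piola_eq hζ hx i a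

include hζ in
lemma differentiableAt_traction (a : Fin 3) {x : E3} (hx : x ∈ S.B) :
    DifferentiableAt ℝ (C.traction ζ a) x :=
  (Body.contDiffAt_of_contDiffOn (C.contDiffOn_traction hζ a) hx).differentiableAt (by norm_num)

include hζ in
lemma elasticForce_eq {x : E3} (hx : x ∈ S.B) : C.elasticForce ζ x =
    ∑ a, fderiv ℝ (C.traction ζ a) x (EuclideanSpace.single a 1) := by
  ext i
  simp only [elasticForce]
  rw [show ((∑ a, fderiv ℝ (C.traction ζ a) x (EuclideanSpace.single a 1) : E3)) i =
    (EuclideanSpace.proj i : E3 →L[ℝ] ℝ) (∑ a, fderiv ℝ (C.traction ζ a) x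
      (EuclideanSpace.single a 1)) from rfl, map_sum]
  refine Finset.sum_congr rfl fun a _ => ?_
  have h1 := ((EuclideanSpace.proj i : E3 →L[ℝ] ℝ).hasFDerivAt.comp x
    (C.differentiableAt_traction hζ a hx).hasFDerivAt).fderiv
  have h2 : (fun z => C.piola ζ z i a) = (EuclideanSpace.proj i : E3 →L[ℝ] ℝ) ∘ C.traction ζ a := by
    ext z; simp [traction]
  rw [h2, h1]
  rfl

/-- The virtual work of the elastic stress. -/
lemma integral_stress (hζ : ∀ x ∈ closure S.B, 0 < (C.defGrad ζ x).det) (hs : C.StressFree ζ)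
    (δ : Q) : IntegrableOn (fun x => inner ℝ (C.elasticForce ζ x) (C.ev δ x)) S.B ∧
      ∫ x in S.B, stress S (x, C.defGrad ζ x) (C.defGrad δ x) =
        -∫ x in S.B, inner ℝ (C.elasticForce ζ x) (C.ev δ x) := by
  -- X is the transposed stress applied to δ. The stress-free condition says exactly what is needed
  -- for X to be tangent to the boundary, and div X is the density of stress work plus that of force
  -- work.
  set X : E3 → E3 := fun x => WithLp.toLp 2 fun a => inner ℝ (C.traction ζ a x) (C.ev δ x) with hX
  have hX1 : ContDiffOn ℝ 1 X (closure S.B) := by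
    rw [contDiffOn_euclidean]
    exact fun a => (C.contDiffOn_traction hζ a).inner ℝ ((C.contDiffOn_ev δ).of_le (by norm_num))
  have htan : ∀ x ∈ frontier S.B, ∀ n, IsOuterNormal S.B x n → inner ℝ n (X x) = 0 := by
    intro x hx n hn
    have h0 := hs x hx n hn 0
    have h1 := hs x hx n hn 1
    have h2 := hs x hx n hn 2
    simp only [Fin.sum_univ_three] at h0 h1 h2
    rw [inner_eq_sum]
    simp only [hX, inner_eq_sum, traction]
    linear_combination (C.ev δ x 0) * h0 + (C.ev δ x 1) * h1 + (C.ev δ x 2) * h2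
  have hdvg : ∀ x ∈ S.B, dvg X x = stress S (x, C.defGrad ζ x) (C.defGrad δ x) +
      inner ℝ (C.elasticForce ζ x) (C.ev δ x) := by
    intro x hx
    have hd : DifferentiableAt ℝ X x :=
      (Body.contDiffAt_of_contDiffOn hX1 hx).differentiableAt (by norm_num)
    rw [C.elasticForce_eq hζ hx, sum_inner, clm_eq_sum (C.defGrad δ x), map_sum,
      ← Finset.sum_add_distrib, dvg]
    refine Finset.sum_congr rfl fun a _ => ?_
    have h1 := ((EuclideanSpace.proj a : E3 →L[ℝ] ℝ).hasFDerivAt.comp x hd.hasFDerivAt)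
    have h2 := (C.differentiableAt_traction hζ a hx).hasFDerivAt.inner ℝ (C.hasFDerivAt_ev δ hx)
    have h3 := DFunLike.congr_fun (h1.unique h2) (EuclideanSpace.single a (1 : ℝ))
    rw [← C.inner_traction hζ (subset_closure hx)]
    simpa using h3
  have hi1 : IntegrableOn (fun x => stress S (x, C.defGrad ζ x) (C.defGrad δ x)) S.B := by
    refine integrableOn_of_continuousOn_closure (ContinuousOn.clm_apply ?_ (C.continuousOn_defGrad δ))
    exact contDiffOn_stress.continuousOn.comp (continuousOn_id.prodMk (C.continuousOn_defGrad ζ))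
      fun x hx => ⟨hx, hζ x hx⟩
  obtain ⟨c, hc⟩ := Body.exists_bound_dvg hX1
  have hi2 : IntegrableOn (dvg X) S.B :=
    Body.integrableOn_of_bound (continuousOn_dvg (Body.continuousOn_fderiv hX1)) hc
  have hi3 : IntegrableOn (fun x => inner ℝ (C.elasticForce ζ x) (C.ev δ x)) S.B := by
    refine (hi2.sub hi1).congr_fun (fun x hx => ?_) S.measurableSet
    rw [Pi.sub_apply, hdvg x hx, add_sub_cancel_left]
  refine ⟨hi3, ?_⟩
  have h4 := Body.integral_dvg_of_tangent hX1 htan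
  rw [setIntegral_congr_fun S.measurableSet hdvg, integral_add hi1 hi3] at h4
  linarith

/-! ### Equivariance -/

/-- Differentiated frame indifference W(x, R F) = W(x, F). -/
lemma stress_rotation {x : E3} (hx : x ∈ S.B) {F : E3 →L[ℝ] E3} (hF : 0 < F.det) (R : Rotation)
    (H : E3 →L[ℝ] E3) : stress S (x, R.clm * F) (R.clm * H) = stress S (x, F) H := by
  have hRF : 0 < (R.clm * F).det := by rw [det_mul_clm, R.det_clm, one_mul]; exact hF
  have hxc := subset_closure hx
  have h1 : HasFDerivAt (fun F : E3 →L[ℝ] E3 => R.clm * F)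
      (ContinuousLinearMap.compL ℝ E3 E3 E3 R.clm) F :=
    (ContinuousLinearMap.compL ℝ E3 E3 E3 R.clm).hasFDerivAt
  have h2 := (hasFDerivAt_stored hxc hRF).comp F h1
  have h3 : S.W x ∘ (fun F : E3 →L[ℝ] E3 => R.clm * F) =ᶠ[𝓝 F] S.W x := by
    filter_upwards [isOpen_det_pos.mem_nhds hF] with F' hF'
    exact S.W_frame x hx F' hF' R
  exact DFunLike.congr_fun ((h2.congr_of_eventuallyEq h3.symm).unique (hasFDerivAt_stored hxc hF)) H

variable {ζ' : Q} {R : Rotation}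

lemma det_pos_of_rotation (hζ : ∀ x ∈ closure S.B, 0 < (C.defGrad ζ x).det)
    (h : ∀ x ∈ closure S.B, C.defGrad ζ' x = R.clm * C.defGrad ζ x) :
    ∀ x ∈ closure S.B, 0 < (C.defGrad ζ' x).det := fun x hx => by
  rw [h x hx, det_mul_clm, R.det_clm, one_mul]; exact hζ x hx

lemma traction_rotation (hζ : ∀ x ∈ closure S.B, 0 < (C.defGrad ζ x).det)
    (h : ∀ x ∈ closure S.B, C.defGrad ζ' x = R.clm * C.defGrad ζ x) (a : Fin 3) :
    EqOn (C.traction ζ' a) (fun x => R.clm (C.traction ζ a x)) (closure S.B) := by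
  have hζ' := C.det_pos_of_rotation hζ h
  -- Frame indifference is assumed on the open body only; continuity of the tractions extends the
  -- equality to the boundary.
  refine EqOn.of_subset_closure (s := S.B) (fun x hx => ?_)
    (C.contDiffOn_traction hζ' a).continuousOn
    (R.clm.continuous.comp_continuousOn (C.contDiffOn_traction hζ a).continuousOn)
    subset_closure le_rfl
  have hxc := subset_closure hx
  refine ext_inner_right ℝ fun k => ?_
  obtain ⟨k, rfl⟩ := R.1.surjective k
  rw [C.inner_traction hζ' hxc, R.clm_apply, R.inner_map, C.inner_traction hζ hxc,
    ← stress_rotation hx (hζ x hxc) R, h x hxc]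
  congr 1
  ext1 y
  simp [R.clm_apply]

lemma elasticForce_rotation (hζ : ∀ x ∈ closure S.B, 0 < (C.defGrad ζ x).det)
    (h : ∀ x ∈ closure S.B, C.defGrad ζ' x = R.clm * C.defGrad ζ x) {x : E3} (hx : x ∈ S.B) :
    C.elasticForce ζ' x = R.clm (C.elasticForce ζ x) := by
  rw [C.elasticForce_eq (C.det_pos_of_rotation hζ h) hx, C.elasticForce_eq hζ hx, map_sum]
  refine Finset.sum_congr rfl fun a _ => ?_
  have h1 : C.traction ζ' a =ᶠ[𝓝 x] fun x => R.clm (C.traction ζ a x) := by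
    filter_upwards [S.isOpen.mem_nhds hx] with y hy
    exact C.traction_rotation hζ h a (subset_closure hy)
  have h2 := R.clm.hasFDerivAt.comp x (C.differentiableAt_traction hζ a hx).hasFDerivAt
  rw [h1.fderiv_eq, show (fun x => R.clm (C.traction ζ a x)) = R.clm ∘ C.traction ζ a from rfl,
    h2.fderiv]
  rfl

/-- Read as the vector equation ∑ nₐ tₐ = 0 between tractions, the boundary condition is carried
along by R. -/
lemma stressFree_rotation (hζ : ∀ x ∈ closure S.B, 0 < (C.defGrad ζ x).det)
    (h : ∀ x ∈ closure S.B, C.defGrad ζ' x = R.clm * C.defGrad ζ x) (hs : C.StressFree ζ) :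
    C.StressFree ζ' := by
  have key : ∀ ξ : Q, ∀ x n, (∀ i, ∑ a, C.piola ξ x i a * n a = 0) ↔
      ∑ a, (n : E3) a • C.traction ξ a x = 0 := by
    intro ξ x n
    constructor
    · intro h
      have h0 := h 0
      have h1 := h 1
      have h2 := h 2
      simp only [Fin.sum_univ_three] at *
      apply ext3 <;> simp [traction] <;> linarith
    · intro h i
      have h0 := congrArg (fun v : E3 => v i) h
      simp only [Fin.sum_univ_three, traction] at *
      simp at h0
      linarith
  intro x hx n hn
  rw [key]
  have h0 := (key ζ x n).1 (hs x hx n hn)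
  have hxc := frontier_subset_closure hx
  calc _ = R.clm (∑ a, n a • C.traction ζ a x) := by
        rw [map_sum]
        refine Finset.sum_congr rfl fun a _ => ?_
        rw [map_smul, C.traction_rotation hζ h a hxc]
    _ = 0 := by rw [h0, map_zero]

/-- Only relative positions enter, so a translation c is allowed here. The planet's field has no
such invariance, and this asymmetry later pins the centre of rotation to the planet. -/
lemma selfField_rotation {c : E3} (h : ∀ x ∈ S.B, C.ev ζ' x = R.clm (C.ev ζ x) + c) (χ : E3) :
    C.selfField ζ' (R.clm χ + c) = R.clm (C.selfField ζ χ) := by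
  rw [selfField, selfField, map_neg, neg_inj]
  have h1 := (R.1.toContinuousLinearEquiv).integral_comp_comm (μ := volume.restrict S.B)
    fun x => (S.k * S.ρ x / ‖C.ev ζ x - χ‖ ^ 3) • (C.ev ζ x - χ)
  refine Eq.trans ?_ h1
  refine setIntegral_congr_fun S.measurableSet fun x hx => ?_
  have e : C.ev ζ' x - (R.clm χ + c) = R.1 (C.ev ζ x - χ) := by
    rw [h x hx, add_sub_add_right_eq_sub, ← map_sub, R.clm_apply]
  rw [e, R.1.norm_map, map_smul]
  rfl

lemma planetField_rotation (R : Rotation) (χ : E3) :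
    S.planetField (R.clm χ) = R.clm (S.planetField χ) := by
  rw [Body.planetField, Body.planetField, map_smul, R.clm_apply, R.1.norm_map]

/-! ### Relative equilibria -/

lemma integrable_angMom (a b : Q) : Integrable (fun x => cross (C.ev a x) (S.ρ x • C.ev b x))
    (volume.restrict S.B) := by
  simp only [cross_smul_right]
  exact integrableOn_of_continuousOn_closure (C.continuousOn_angMom_density a b)

/-- The balance, at `z`, of all the forces acting in the frame that rotates with angular velocity
`w` together with the body. -/
structure Balanced (w : E3) (z : Q × Q) : Prop where
  regular : C.IsRegular z
  velocity : ∀ x ∈ S.B, C.ev z.2 x = cross w (C.ev z.1 x)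
  force : ∀ x ∈ S.B, S.ρ x • cross w (cross w (C.ev z.1 x)) = -(S.ρ x • S.planetField (C.ev z.1 x))
    - S.ρ x • C.selfField z.1 (C.ev z.1 x) + C.elasticForce z.1 x
  boundary : C.StressFree z.1

-- The angular velocity is the Lagrange multiplier. After integration by parts of the stress, the
-- force balance turns dH(δ) into ⟨w, L(ζ, δv) + L(δζ, v)⟩ = ⟨w, dL(δ)⟩, which vanishes on the
-- kernel of dL.
variable {C} in
theorem Balanced.isRelEquilibrium {w : E3} {z : Q × Q} (hz : C.Balanced w z) :
    C.IsRelEquilibrium z := by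
  refine ⟨hz.regular, fun δ hδ => ?_⟩
  have hL : C.angMom (z.1, δ.2) + C.angMom (δ.1, z.2) = 0 :=
    (C.hasDerivAt_angMom z δ).unique hδ
  have hE := C.hasDerivAt_energy hz.regular δ
  obtain ⟨hi, hstress⟩ := C.integral_stress hz.regular.2 hz.boundary δ.1
  have hρ : ContinuousOn S.ρ (closure S.B) := S.ρ_smooth.continuousOn
  have hc1 := C.continuousOn_ev δ.1
  have hc2 : ContinuousOn (fun x => cross w (cross w (C.ev z.1 x))) (closure S.B) :=
    ((crossL w).continuous.comp (crossL w).continuous).comp_continuousOn (C.continuousOn_ev z.1)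
  have hc3 : ContinuousOn (fun x => S.planetField (C.ev z.1 x)) (closure S.B) :=
    continuousOn_planetField.comp (C.continuousOn_ev z.1) fun x hx => hz.regular.ev_ne_zero hx
  have i1 : IntegrableOn (fun x => S.ρ x * inner ℝ (cross w (cross w (C.ev z.1 x))) (C.ev δ.1 x))
      S.B := integrableOn_of_continuousOn_closure (hρ.mul (hc2.inner (𝕜 := ℝ) hc1))
  have i2 : IntegrableOn (fun x => S.ρ x * inner ℝ (S.planetField (C.ev z.1 x)) (C.ev δ.1 x))
      S.B := integrableOn_of_continuousOn_closure (hρ.mul (hc3.inner (𝕜 := ℝ) hc1))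
  have i3 : IntegrableOn (fun x => inner ℝ (C.elasticForce z.1 x) (C.ev δ.1 x) -
      S.ρ x * inner ℝ (cross w (cross w (C.ev z.1 x))) (C.ev δ.1 x)) S.B := hi.sub i1
  have hself : EqOn (fun x => S.ρ x * inner ℝ (C.selfField z.1 (C.ev z.1 x)) (C.ev δ.1 x))
      (fun x => inner ℝ (C.elasticForce z.1 x) (C.ev δ.1 x) -
        S.ρ x * inner ℝ (cross w (cross w (C.ev z.1 x))) (C.ev δ.1 x) -
        S.ρ x * inner ℝ (S.planetField (C.ev z.1 x)) (C.ev δ.1 x)) S.B := by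
    intro x hx
    have h1 := congrArg (fun u => inner ℝ u (C.ev δ.1 x)) (hz.force x hx)
    simp only [inner_add_left, inner_sub_left, inner_neg_left, real_inner_smul_left] at h1
    simp only
    linarith
  have hA : ∫ x in S.B, S.ρ x * inner ℝ (C.ev z.2 x) (C.ev δ.2 x) =
      inner ℝ w (C.angMom (z.1, δ.2)) := by
    rw [angMom, ← integral_inner (C.integrable_angMom z.1 δ.2)]
    refine setIntegral_congr_fun S.measurableSet fun x hx => ?_
    simp only [cross_smul_right, inner_smul_right]
    rw [hz.velocity x hx, inner_cross_comm]
  have hB : inner ℝ w (C.angMom (δ.1, z.2)) =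
      -∫ x in S.B, S.ρ x * inner ℝ (cross w (cross w (C.ev z.1 x))) (C.ev δ.1 x) := by
    rw [angMom, ← integral_inner (C.integrable_angMom δ.1 z.2),
      ← integral_neg]
    refine setIntegral_congr_fun S.measurableSet fun x hx => ?_
    simp only [cross_smul_right, inner_smul_right]
    rw [hz.velocity x hx, cross_anticomm (C.ev δ.1 x), inner_neg_right, ← inner_cross_comm,
      inner_cross_skew, ← inner_cross_skew (w := w), ← mul_neg]
  have hsum := congrArg (fun v => inner ℝ w v) hL
  simp only [inner_add_right, inner_zero_right] at hsum
  have hD := hE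
  rw [hstress, setIntegral_congr_fun S.measurableSet hself, integral_sub i3 i2,
    integral_sub hi i1, hA] at hD
  refine HasDerivAt.congr_deriv hD ?_
  rw [hB] at hsum
  linarith

end ConfigSpace

end ElasticSatellite
end

noncomputable section

namespace ElasticSatellite

/-! ### Rigidity -/

section Rigidity

variable {U : Set E3} (hU : IsOpen U) {f g : E3 → E3} (hf : ContDiffOn ℝ 2 f U)
  (hg : ContDiffOn ℝ 2 g U) (hdet : ∀ x ∈ U, (fderiv ℝ g x).det ≠ 0)
  (hfg : ∀ x ∈ U, ∀ h k, inner ℝ (fderiv ℝ f x h) (fderiv ℝ f x k) =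
    inner ℝ (fderiv ℝ g x h) (fderiv ℝ g x k))
include hU hf hg hdet hfg

/-- The relative deformation gradient of two maps with the same Cauchy–Green tensor. -/
lemma relGrad_aux {x : E3} (hx : x ∈ U) :
    HasFDerivAt (fun y => fderiv ℝ f y ∘L (fderiv ℝ g y).inverse) (0 : E3 →L[ℝ] (E3 →L[ℝ] E3)) x ∧
      fderiv ℝ f x = (fderiv ℝ f x ∘L (fderiv ℝ g x).inverse) ∘L fderiv ℝ g x ∧
      ∀ p q, inner ℝ ((fderiv ℝ f x ∘L (fderiv ℝ g x).inverse) p)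
        ((fderiv ℝ f x ∘L (fderiv ℝ g x).inverse) q) = inner ℝ p q := by
  set F : E3 → E3 →L[ℝ] E3 := fderiv ℝ f with hF
  set H : E3 → E3 →L[ℝ] E3 := fderiv ℝ g with hH
  set A : E3 → E3 →L[ℝ] E3 := fun y => F y ∘L (H y).inverse with hA
  have hinv : ∀ y ∈ U, ∃ e : E3 ≃L[ℝ] E3, (e : E3 →L[ℝ] E3) = H y := fun y hy =>
    ⟨(H y).toContinuousLinearEquivOfDetNeZero (hdet y hy), by ext; rfl⟩
  have hfac : ∀ y ∈ U, F y = A y ∘L H y := by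
    intro y hy
    obtain ⟨e, he⟩ := hinv y hy
    simp only [hA, ← he, ContinuousLinearMap.inverse_equiv]
    ext v
    simp
  have hiso : ∀ y ∈ U, ∀ p q, inner ℝ (A y p) (A y q) = inner ℝ p q := by
    intro y hy p q
    obtain ⟨e, he⟩ := hinv y hy
    have hp : ∀ p, A y (H y p) = F y p := fun p => (DFunLike.congr_fun (hfac y hy) p).symm
    obtain ⟨p, rfl⟩ : ∃ p', H y p' = p := ⟨e.symm p, by rw [← he]; simp⟩
    obtain ⟨q, rfl⟩ : ∃ q', H y q' = q := ⟨e.symm q, by rw [← he]; simp⟩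
    rw [hp, hp, hfg y hy]
  have hF1 : ∀ y ∈ U, ContDiffAt ℝ 1 F y := fun y hy =>
    (hf.contDiffAt (hU.mem_nhds hy)).fderiv_right (by norm_num)
  have hH1 : ∀ y ∈ U, ContDiffAt ℝ 1 H y := fun y hy =>
    (hg.contDiffAt (hU.mem_nhds hy)).fderiv_right (by norm_num)
  have hA1 : DifferentiableAt ℝ A x := by
    obtain ⟨e, he⟩ := hinv x hx
    have h1 : ContDiffAt ℝ 1 ContinuousLinearMap.inverse (H x) := he ▸ contDiffAt_map_inverse e
    exact ((hF1 x hx).differentiableAt (by norm_num)).clm_comp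
      (((h1.comp x (hH1 x hx)).differentiableAt (by norm_num)))
  have hFd := ((hF1 x hx).differentiableAt (by norm_num)).hasFDerivAt
  have hHd := ((hH1 x hx).differentiableAt (by norm_num)).hasFDerivAt
  set DA := fderiv ℝ A x with hDA
  have hAd : HasFDerivAt A DA x := hA1.hasFDerivAt
  have hsymF : ∀ h k, fderiv ℝ F x h k = fderiv ℝ F x k h :=
    fun h k => ((hf.contDiffAt (hU.mem_nhds hx)).isSymmSndFDerivAt (by simp)) h k
  have hsymH : ∀ h k, fderiv ℝ H x h k = fderiv ℝ H x k h :=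
    fun h k => ((hg.contDiffAt (hU.mem_nhds hx)).isSymmSndFDerivAt (by simp)) h k
  have hprod : ∀ h k, fderiv ℝ F x h k = DA h (H x k) + A x (fderiv ℝ H x h k) := by
    intro h k
    have h1 : HasFDerivAt F _ x := (hAd.clm_comp hHd).congr_of_eventuallyEq
      (by filter_upwards [hU.mem_nhds hx] with y hy using hfac y hy)
    have h2 := DFunLike.congr_fun (DFunLike.congr_fun (hFd.unique h1) h) k
    rw [h2]
    simp [add_comm]
  have hsymA : ∀ h k, DA h (H x k) = DA k (H x h) := by
    intro h k
    have h1 := hprod h k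
    have h2 := hprod k h
    rw [hsymF, h2, hsymH k h] at h1
    exact (add_right_cancel h1).symm
  have hskew : ∀ h p q, inner ℝ (DA h p) (A x q) = -inner ℝ (DA h q) (A x p) := by
    intro h p q
    have hp := hAd.clm_apply (hasFDerivAt_const p x)
    have hq := hAd.clm_apply (hasFDerivAt_const q x)
    have h1 := hp.inner ℝ hq
    have h2 : HasFDerivAt (fun y => inner ℝ (A y p) (A y q)) (0 : E3 →L[ℝ] ℝ) x :=
      (hasFDerivAt_const (inner ℝ p q) x).congr_of_eventuallyEq
        (by filter_upwards [hU.mem_nhds hx] with y hy using hiso y hy p q)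
    have h3 := DFunLike.congr_fun (h1.unique h2) h
    simp at h3
    rw [real_inner_comm (A x p) (DA h q)]
    linarith
  -- The trilinear form is symmetric in h, k by equality of mixed second derivatives and skew in k,
  -- l because A stays isometric. Such a form vanishes.
  have hzero : ∀ h k l, inner ℝ (DA h (H x k)) (A x (H x l)) = 0 := by
    intro h k l
    have e1 := hskew h (H x k) (H x l)
    have e2 := hskew k (H x h) (H x l)
    have e3 := hskew l (H x h) (H x k)
    rw [hsymA k h] at e2
    rw [hsymA k l] at e2
    rw [hsymA l h] at e3
    linarith
  refine ⟨?_, hfac x hx, hiso x hx⟩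
  convert hAd
  symm
  ext1 h
  ext1 p
  obtain ⟨e, he⟩ := hinv x hx
  obtain ⟨k, rfl⟩ : ∃ k, H x k = p := ⟨e.symm p, by rw [← he]; simp⟩
  have hAinj : Function.Injective (A x) := by
    refine (injective_iff_map_eq_zero (A x)).2 fun v hv => ?_
    have := hiso x hx v v
    rw [hv, inner_zero_left] at this
    exact inner_self_eq_zero.1 this.symm
  have hAsurj : Function.Surjective (A x) :=
    LinearMap.surjective_of_injective (f := (A x : E3 →ₗ[ℝ] E3)) hAinj
  refine ext_inner_right ℝ fun v => ?_
  obtain ⟨v, rfl⟩ := hAsurj v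
  obtain ⟨l, rfl⟩ : ∃ l, H x l = v := ⟨e.symm v, by rw [← he]; simp⟩
  rw [hzero]
  simp

/-- The relative gradient A = Df (Dg)⁻¹ is locally constant, hence constant on a connected set, and
the signs of the determinants exclude reflections. Then f - A g has zero derivative. -/
theorem exists_rigid (hc : IsConnected U) (hpos : ∀ x ∈ U, 0 < (fderiv ℝ f x).det)
    (hpos' : ∀ x ∈ U, 0 < (fderiv ℝ g x).det) :
    ∃ (R : Rotation) (c : E3), ∀ x ∈ U, f x = R.clm (g x) + c := by
  have key := fun x hx => relGrad_aux hU hf hg hdet hfg (x := x) hx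
  set A : E3 → E3 →L[ℝ] E3 := fun y => fderiv ℝ f y ∘L (fderiv ℝ g y).inverse with hA
  obtain ⟨x₀, hx₀⟩ := hc.nonempty
  have hconst : ∀ x ∈ U, A x = A x₀ := fun x hx =>
    hU.is_const_of_fderiv_eq_zero hc.isPreconnected
      (fun y hy => (key y hy).1.differentiableAt.differentiableWithinAt)
      (fun y hy => (key y hy).1.fderiv) hx hx₀
  have hdetA : 0 < (A x₀).det := by
    have h1 : (fderiv ℝ f x₀).det = (A x₀).det * (fderiv ℝ g x₀).det := by
      conv_lhs => rw [(key x₀ hx₀).2.1]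
      exact det_mul_clm _ _
    have h2 := hpos x₀ hx₀
    rw [h1] at h2
    exact (mul_pos_iff_of_pos_right (hpos' x₀ hx₀)).1 h2
  obtain ⟨R, hR⟩ := exists_rotation (key x₀ hx₀).2.2 hdetA
  refine ⟨R, f x₀ - R.clm (g x₀), fun x hx => ?_⟩
  have hd : ∀ y ∈ U, HasFDerivAt (fun y => f y - A x₀ (g y)) (0 : E3 →L[ℝ] E3) y := by
    intro y hy
    have h1 := ((hf.contDiffAt (hU.mem_nhds hy)).differentiableAt (by norm_num)).hasFDerivAt
    have h2 := ((hg.contDiffAt (hU.mem_nhds hy)).differentiableAt (by norm_num)).hasFDerivAt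
    have h3 := h1.sub ((A x₀).hasFDerivAt.comp y h2)
    have h4 := (key y hy).2.1
    change fderiv ℝ f y = A y ∘L fderiv ℝ g y at h4
    rw [hconst y hy] at h4
    rw [← h4, sub_self] at h3
    exact h3
  have h5 := hU.is_const_of_fderiv_eq_zero hc.isPreconnected
    (fun y hy => (hd y hy).differentiableAt.differentiableWithinAt)
    (fun y hy => (hd y hy).fderiv) hx hx₀
  rw [hR]
  exact (sub_eq_iff_eq_add'.1 h5)

end Rigidity

/-! ### The field of the planet is not affine -/

open Polynomial in
-- Restrict to a ray r X₀ not parallel to d, and take the component along the part e of d orthogonal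
-- to X₀. The field at r X₀ itself drops out, so κ⟨d, e⟩ / |r X₀ + d|³, with κ = k M, would be
-- affine in r on an open set of r. A positive power of a genuine quadratic cannot divide a nonzero
-- constant.
lemma eq_zero_of_planetField_sub_affine (S : Body) {O : Set E3} (hO : IsOpen O) (hne : O.Nonempty)
    {d b : E3} {L : E3 →L[ℝ] E3}
    (h : ∀ X ∈ O, S.planetField (X + d) - S.planetField X = L X + b)
    (hd : ∀ X ∈ O, X + d ≠ 0) : d = 0 := by
  by_contra hd0
  obtain ⟨X₁, hX₁⟩ := hne
  obtain ⟨f, hf1, hdf⟩ := exists_orthogonal_unit d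
  have hκ : 0 < S.k * S.M := mul_pos S.k_pos S.M_pos
  obtain ⟨X₀, hX₀, hX₀f⟩ : ∃ X₀ ∈ O, inner ℝ X₀ f ≠ 0 := by
    by_cases h0 : inner ℝ X₁ f = 0
    · have hcont : Continuous fun s : ℝ => X₁ + s • f := by fun_prop
      have h1 : ∀ᶠ s : ℝ in 𝓝 0, X₁ + s • f ∈ O :=
        hcont.continuousAt.eventually_mem (hO.mem_nhds (by simpa using hX₁))
      obtain ⟨s, hs, hs0⟩ := (h1.filter_mono nhdsWithin_le_nhds |>.and
        (self_mem_nhdsWithin : {s : ℝ | s ≠ 0} ∈ 𝓝[≠] (0 : ℝ))).exists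
      refine ⟨_, hs, ?_⟩
      rw [inner_add_left, h0, real_inner_smul_left, real_inner_self_eq_norm_sq, hf1]
      simpa using hs0
    · exact ⟨X₁, hX₁, h0⟩
  have hX0 : X₀ ≠ 0 := fun h0 => hX₀f (by rw [h0, inner_zero_left])
  have hXX : inner ℝ X₀ X₀ ≠ 0 := inner_self_ne_zero.2 hX0
  set c := inner ℝ d X₀ / inner ℝ X₀ X₀ with hc
  set e := d - c • X₀ with he
  have heX : inner ℝ X₀ e = 0 := by
    rw [he, inner_sub_right, inner_smul_right, hc, real_inner_comm, div_mul_cancel₀ _ hXX, sub_self]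
  have he0 : e ≠ 0 := by
    intro h0
    have h1 : d = c • X₀ := sub_eq_zero.1 h0
    have h2 : c * inner ℝ X₀ f = 0 := by rw [← real_inner_smul_left, ← h1, hdf]
    rcases mul_eq_zero.1 h2 with h3 | h3
    · exact hd0 (by rw [h1, h3, zero_smul])
    · exact hX₀f h3
  have hde : inner ℝ d e ≠ 0 := by
    have : d = e + c • X₀ := by rw [he]; abel
    rw [this, inner_add_left, real_inner_smul_left, heX, mul_zero, add_zero]
    exact inner_self_ne_zero.2 he0
  set α := inner ℝ (L X₀) e with hα
  set β := inner ℝ b e with hβ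
  set q : ℝ[X] := C (inner ℝ X₀ X₀) * X ^ 2 + C (2 * inner ℝ X₀ d) * X + C (inner ℝ d d) with hq
  set p : ℝ[X] := C α * X + C β with hp
  have hqe : ∀ r : ℝ, q.eval r = ‖r • X₀ + d‖ ^ 2 := by
    intro r
    rw [← real_inner_self_eq_norm_sq, hq]
    simp only [eval_add, eval_mul, eval_C, eval_pow, eval_X, inner_add_left, inner_add_right,
      real_inner_smul_left, inner_smul_right]
    rw [real_inner_comm X₀ d]
    ring
  have hcont : Continuous fun r : ℝ => r • X₀ := by fun_prop
  have hev : ∀ᶠ r : ℝ in 𝓝 1, r • X₀ ∈ O :=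
    hcont.continuousAt.eventually_mem (hO.mem_nhds (by simpa using hX₀))
  -- Squaring makes the cube of the norm a polynomial. Equality at infinitely many r is equality of
  -- polynomials.
  have hpoly : p ^ 2 * q ^ 3 = C ((S.k * S.M * inner ℝ d e) ^ 2) := by
    refine eq_of_infinite_eval_eq _ _ (Set.Infinite.mono (s := {r : ℝ | r • X₀ ∈ O}) ?_
      (infinite_of_mem_nhds 1 hev))
    intro r hr
    have h1 := congrArg (fun v => inner ℝ v e) (h _ hr)
    have hn : ‖r • X₀ + d‖ ≠ 0 := norm_ne_zero_iff.2 (hd _ hr)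
    simp only [Body.planetField, inner_sub_left, inner_add_left, real_inner_smul_left, map_smul,
      heX, mul_zero, zero_add, sub_zero] at h1
    have h2 : p.eval r = r * α + β := by
      rw [hp]
      simp only [eval_add, eval_mul, eval_C, eval_X]
      ring
    rw [mem_ofPred_eq, eval_mul, eval_pow, eval_pow, h2, hqe, eval_C, hα, hβ, ← h1]
    field_simp
  have hunit : IsUnit (C ((S.k * S.M * inner ℝ d e) ^ 2) : ℝ[X]) :=
    isUnit_C.2 (IsUnit.mk0 _ (pow_ne_zero _ (mul_ne_zero hκ.ne' hde)))
  rw [← hpoly] at hunit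
  have hqu : IsUnit q := (isUnit_pow_iff (by norm_num)).1 (isUnit_of_mul_isUnit_right hunit)
  have h0 := natDegree_eq_zero_of_isUnit hqu
  rw [hq, natDegree_quadratic hXX] at h0
  norm_num at h0

namespace ConfigSpace

variable {S : Body} {Q : Type*} [NormedAddCommGroup Q] [NormedSpace ℝ Q] (C : ConfigSpace S Q)

lemma inner_cauchyGreen (ζ : Q) (x h k : E3) :
    inner ℝ (C.cauchyGreen ζ x h) k = inner ℝ (C.defGrad ζ x h) (C.defGrad ζ x k) := by
  simp [cauchyGreen, ContinuousLinearMap.adjoint_inner_left]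

lemma defGrad_eq_of_rigid {ζ ζ' : Q} {A : E3 →L[ℝ] E3} {c : E3}
    (h : ∀ x ∈ S.B, C.ev ζ' x = A (C.ev ζ x) + c) {x : E3} (hx : x ∈ closure S.B) :
    C.defGrad ζ' x = A * C.defGrad ζ x := by
  have h' : EqOn (C.ev ζ') (fun x => A (C.ev ζ x) + c) (closure S.B) :=
    EqOn.of_subset_closure h (C.continuousOn_ev ζ')
      ((A.continuous.comp_continuousOn (C.continuousOn_ev ζ)).add continuousOn_const)
      subset_closure le_rfl
  refine C.defGrad_eq hx ?_
  exact ((A.hasFDerivAt.comp_hasFDerivWithinAt x (C.hasFDerivWithinAt_ev ζ hx)).add_const c).congr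
    h' (h' hx)

/-- Configurations with the same Cauchy–Green tensor differ by a rigid motion. -/
lemma exists_rigid_of_cauchyGreen_eq {ζ ζ' : Q} (hζ : ∀ x ∈ closure S.B, 0 < (C.defGrad ζ x).det)
    (hζ' : ∀ x ∈ closure S.B, 0 < (C.defGrad ζ' x).det)
    (h : ∀ x ∈ S.B, C.cauchyGreen ζ' x = C.cauchyGreen ζ x) :
    ∃ (R : Rotation) (c : E3), ∀ x ∈ S.B, C.ev ζ' x = R.clm (C.ev ζ x) + c := by
  have hD : ∀ ξ : Q, ∀ x ∈ S.B, fderiv ℝ (C.ev ξ) x = C.defGrad ξ x :=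
    fun ξ x hx => (C.hasFDerivAt_ev ξ hx).fderiv
  refine exists_rigid S.isOpen ((C.contDiffOn_ev ζ').mono subset_closure)
    ((C.contDiffOn_ev ζ).mono subset_closure) (fun x hx => ?_) (fun x hx k l => ?_) S.isConnected
    (fun x hx => ?_) (fun x hx => ?_)
  · rw [hD ζ x hx]; exact (hζ x (subset_closure hx)).ne'
  · rw [hD ζ x hx, hD ζ' x hx, ← inner_cauchyGreen, ← inner_cauchyGreen, h x hx]
  · rw [hD ζ' x hx]; exact hζ' x (subset_closure hx)
  · rw [hD ζ x hx]; exact hζ x (subset_closure hx)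

/-- The image of the body has interior points. -/
lemma exists_isOpen_subset_image {ζ : Q} (hζ : ∀ x ∈ closure S.B, 0 < (C.defGrad ζ x).det) :
    ∃ O, IsOpen O ∧ O.Nonempty ∧ O ⊆ C.ev ζ '' S.B := by
  obtain ⟨x, hx⟩ := S.nonempty
  set e := (C.defGrad ζ x).toContinuousLinearEquivOfDetNeZero (hζ x (subset_closure hx)).ne' with he
  have h1 : HasStrictFDerivAt (C.ev ζ) (e : E3 →L[ℝ] E3) x := by
    have := (Body.contDiffAt_of_contDiffOn (C.contDiffOn_ev ζ) hx).hasStrictFDerivAt (by norm_num)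
    rw [(C.hasFDerivAt_ev ζ hx).fderiv] at this
    have he' : (e : E3 →L[ℝ] E3) = C.defGrad ζ x := by ext; rfl
    rwa [he']
  have h2 : C.ev ζ '' S.B ∈ 𝓝 (C.ev ζ x) := by
    rw [← h1.map_nhds_eq_of_equiv]
    exact image_mem_map (S.isOpen.mem_nhds hx)
  obtain ⟨O, hO, hOo, hxO⟩ := mem_nhds_iff.1 h2
  exact ⟨O, hOo, ⟨_, hxO⟩, hO⟩

lemma _root_.ElasticSatellite.clm_eq_zero_of_isOpen {O : Set E3} (hO : IsOpen O) (hne : O.Nonempty)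
    {A : E3 →L[ℝ] E3} {b : E3} (h : ∀ X ∈ O, A X = b) : A = 0 := by
  obtain ⟨X, hX⟩ := hne
  have h1 : HasFDerivAt A (0 : E3 →L[ℝ] E3) X :=
    (hasFDerivAt_const b X).congr_of_eventuallyEq
      (by filter_upwards [hO.mem_nhds hX] with Y hY using h Y hY)
  exact A.hasFDerivAt.unique h1

end ConfigSpace

end ElasticSatellite
end

noncomputable section

namespace ElasticSatellite

/-! ### Times -/

lemma isOpen_times (T : EReal) : IsOpen (times T) :=
  isOpen_Ioi.inter (isOpen_Iio.preimage continuous_coe_real_ereal)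

lemma ordConnected_times (T : EReal) : (times T).OrdConnected :=
  ⟨fun _ ha _ hb _ hc => ⟨ha.1.trans_le hc.1, (EReal.coe_le_coe_iff.2 hc.2).trans_lt hb.2⟩⟩

lemma mem_times_of_le {T : EReal} {s t : ℝ} (ht : t ∈ times T) (hs : 0 < s) (hst : s ≤ t) :
    s ∈ times T := ⟨hs, (EReal.coe_le_coe_iff.2 hst).trans_lt ht.2⟩

lemma isPreconnected_times (T : EReal) : IsPreconnected (times T) :=
  (ordConnected_times T).isPreconnected

@[simp] lemma times_top : times ⊤ = Ioi 0 := by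
  ext t; simp [times]

@[simp] lemma times_coe (T : ℝ) : times (T : EReal) = Ioo 0 T := by
  ext t; simp [times]

lemma exists_mem_times {T : EReal} (hT : 0 < T) : ∃ t, t ∈ times T := by
  obtain ⟨t, h0, h1⟩ := EReal.lt_iff_exists_real_btwn.1 hT
  exact ⟨t, EReal.coe_pos.1 h0, h1⟩

lemma times_mem_nhdsGT {T : EReal} (hT : 0 < T) : times T ∈ 𝓝[>] (0 : ℝ) := by
  obtain ⟨t, ht⟩ := exists_mem_times hT
  filter_upwards [Ioo_mem_nhdsGT ht.1] with s hs using mem_times_of_le ht hs.1 hs.2.le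

/-! ### Kinematics of uniform rotations -/

/-- Let Ω = Rᵀ R' be the angular velocity in the body frame. With R'' = R N, differentiating
orthogonality twice fixes |Ω p|² = -⟨N p, p⟩, while Ω' is the constant skew part K of N. An affine
function of t whose norm is constant is constant, so K = 0 and Ω is a fixed skew operator w ×. -/
theorem exists_eq_expCross {I : Set ℝ} (hI : IsOpen I) (hIc : IsPreconnected I) {s : ℝ} (hs : s ∈ I)
    {R R' R'' : ℝ → E3 →L[ℝ] E3} {N : E3 →L[ℝ] E3} (hR : ∀ t ∈ I, HasDerivAt R (R' t) t)
    (hR' : ∀ t ∈ I, HasDerivAt R' (R'' t) t)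
    (hiso : ∀ t ∈ I, ∀ p q, inner ℝ (R t p) (R t q) = inner ℝ p q) (h1 : R s = 1)
    (hN : ∀ t ∈ I, R'' t = R t * N) :
    ∃ w, ∀ t ∈ I, R t = expCross w (t - s) ∧ R' t = R t * crossL w ∧
      R'' t = R t * (crossL w * crossL w) := by
  have hRp : ∀ t ∈ I, ∀ p, HasDerivAt (fun t => R t p) (R' t p) t := fun t ht p => by
    simpa using (hR t ht).clm_apply (hasDerivAt_const t p)
  have hRp' : ∀ t ∈ I, ∀ p, HasDerivAt (fun t => R' t p) (R t (N p)) t := fun t ht p => by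
    have := (hR' t ht).clm_apply (hasDerivAt_const t p)
    rw [hN t ht] at this
    simpa using this
  have hadj : ∀ t ∈ I, ∀ p, R t (ContinuousLinearMap.adjoint (R t) p) = p := by
    intro t ht p
    have hinj : Function.Injective (R t) := (injective_iff_map_eq_zero (R t)).2 fun v hv => by
      have := hiso t ht v v
      rw [hv, inner_zero_left] at this
      exact inner_self_eq_zero.1 this.symm
    obtain ⟨a, rfl⟩ : ∃ a, R t a = p :=
      LinearMap.surjective_of_injective (f := (R t : E3 →ₗ[ℝ] E3)) hinj p
    have h2 : ContinuousLinearMap.adjoint (R t) (R t a) = a := ext_inner_right ℝ fun b => by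
      rw [ContinuousLinearMap.adjoint_inner_left, hiso t ht]
    rw [h2]
  have ha : ∀ t ∈ I, ∀ p q, inner ℝ (R' t p) (R t q) + inner ℝ (R t p) (R' t q) = 0 := by
    intro t ht p q
    have h2 := (hRp t ht p).inner ℝ (hRp t ht q)
    have h3 : HasDerivAt (fun t => inner ℝ (R t p) (R t q)) 0 t :=
      (hasDerivAt_const t (inner ℝ p q)).congr_of_eventuallyEq
        (by filter_upwards [hI.mem_nhds ht] with r hr using hiso r hr p q)
    have h4 := h2.unique h3
    linarith
  have hb : ∀ t ∈ I, ∀ p q, 2 * inner ℝ (R' t p) (R' t q) =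
      -(inner ℝ (N p) q + inner ℝ p (N q)) := by
    intro t ht p q
    have h2 := ((hRp' t ht p).inner ℝ (hRp t ht q)).add ((hRp t ht p).inner ℝ (hRp' t ht q))
    have h3 : HasDerivAt ((fun t => inner ℝ (R' t p) (R t q)) + fun t => inner ℝ (R t p) (R' t q))
        0 t := (hasDerivAt_const t (0 : ℝ)).congr_of_eventuallyEq
        (by filter_upwards [hI.mem_nhds ht] with r hr using ha r hr p q)
    have h4 := h2.unique h3
    rw [hiso t ht, hiso t ht] at h4
    linarith
  set Ω : ℝ → E3 →L[ℝ] E3 := fun t => ContinuousLinearMap.adjoint (R t) * R' t with hΩ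
  have hΩi : ∀ t p q, inner ℝ (Ω t p) q = inner ℝ (R' t p) (R t q) := fun t p q => by
    simp [hΩ, ContinuousLinearMap.adjoint_inner_left]
  have hRΩ : ∀ t ∈ I, ∀ p, R' t p = R t (Ω t p) := fun t ht p => (hadj t ht _).symm
  set K : E3 →L[ℝ] E3 := (1 / 2 : ℝ) • (N - ContinuousLinearMap.adjoint N) with hK
  have hKi : ∀ p q, inner ℝ (K p) q = 1 / 2 * (inner ℝ (N p) q - inner ℝ p (N q)) := fun p q => by
    simp [hK, inner_sub_left, real_inner_smul_left, ContinuousLinearMap.adjoint_inner_left]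
  have hΩt : ∀ t ∈ I, ∀ p, Ω t p = Ω s p + (t - s) • K p := by
    intro t ht p
    refine ext_inner_right ℝ fun q => ?_
    have hd : ∀ r ∈ I, HasDerivAt (fun r => inner ℝ (R' r p) (R r q) - r * inner ℝ (K p) q) 0 r := by
      intro r hr
      have h2 := ((hRp' r hr p).inner ℝ (hRp r hr q)).sub
        ((hasDerivAt_id r).mul_const (inner ℝ (K p) q))
      refine h2.congr_deriv ?_
      rw [hiso r hr, hKi]
      have := hb r hr p q
      linarith
    have h3 := hI.is_const_of_deriv_eq_zero hIc
      (fun r hr => (hd r hr).differentiableAt.differentiableWithinAt)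
      (fun r hr => (hd r hr).deriv) ht hs
    rw [hΩi, inner_add_left, hΩi, real_inner_smul_left]
    linarith
  have hK0 : ∀ p, K p = 0 := by
    intro p
    have hn : ∀ t ∈ I, ‖Ω t p‖ ^ 2 = -inner ℝ (N p) p := by
      intro t ht
      have h2 := hb t ht p p
      rw [hRΩ t ht, hiso t ht, real_inner_self_eq_norm_sq, real_inner_comm (N p) p] at h2
      linarith
    have hs2 : ∀ᶠ h in 𝓝 (0 : ℝ), s + h ∈ I ∧ s - h ∈ I := by
      have c1 : Continuous fun h : ℝ => s + h := by fun_prop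
      have c2 : Continuous fun h : ℝ => s - h := by fun_prop
      exact (c1.continuousAt.eventually_mem (hI.mem_nhds (by simpa using hs))).and
        (c2.continuousAt.eventually_mem (hI.mem_nhds (by simpa using hs)))
    -- The second difference of the constant |Ω p|² at s - h, s, s + h equals 2 h² |K p|².
    obtain ⟨h, ⟨hp, hm⟩, h0⟩ := ((hs2.filter_mono nhdsWithin_le_nhds).and
      (self_mem_nhdsWithin : {h : ℝ | h ≠ 0} ∈ 𝓝[≠] (0 : ℝ))).exists
    have e0 := hn s hs
    have e1 := hn _ hp
    have e2 := hn _ hm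
    rw [hΩt _ hp, norm_add_sq_real, inner_smul_right, norm_smul, mul_pow] at e1
    rw [hΩt _ hm, norm_add_sq_real, inner_smul_right, norm_smul, mul_pow] at e2
    simp only [add_sub_cancel_left, sub_sub_cancel_left, norm_neg, Real.norm_eq_abs, sq_abs] at e1 e2
    have e3 : h ^ 2 * ‖K p‖ ^ 2 = 0 := by linarith
    rcases mul_eq_zero.1 e3 with e4 | e4
    · exact absurd (pow_eq_zero_iff (by norm_num) |>.1 e4) h0
    · exact norm_eq_zero.1 (pow_eq_zero_iff (by norm_num) |>.1 e4)
  obtain ⟨w, hw⟩ : ∃ w, Ω s = crossL w := by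
    refine exists_eq_crossL fun a b => ?_
    linarith [ha s hs a b, hΩi s a b, hΩi s b a, real_inner_comm a (Ω s b),
      real_inner_comm (R s a) (R' s b)]
  have hR'w : ∀ t ∈ I, R' t = R t * crossL w := by
    intro t ht
    ext1 p
    rw [hRΩ t ht, hΩt t ht, hK0, smul_zero, add_zero, hw]
    rfl
  refine ⟨w, fun t ht => ⟨?_, hR'w t ht, ?_⟩⟩
  · have hd : ∀ r ∈ I, HasDerivAt (fun r => R r * expCross w (-(r - s))) 0 r := by
      intro r hr
      have h2 : HasDerivAt (fun r => expCross w (-(r - s)))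
          ((-1 : ℝ) • (crossL w * expCross w (-(r - s)))) r :=
        HasDerivAt.scomp (g₁ := expCross w) (h := fun r => -(r - s)) r
          (hasDerivAt_expCross w (-(r - s))) (((hasDerivAt_id r).sub_const s).fun_neg)
      have h3 := (hR r hr).mul h2
      refine h3.congr_deriv ?_
      rw [hR'w r hr]
      ext1 p
      simp
    have h3 := hI.is_const_of_deriv_eq_zero hIc
      (fun r hr => (hd r hr).differentiableAt.differentiableWithinAt)
      (fun r hr => (hd r hr).deriv) ht hs
    simp only [h1, sub_self, neg_zero, expCross_zero, mul_one] at h3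
    calc R t = R t * (expCross w (-(t - s)) * expCross w (t - s)) := by
          rw [expCross_neg_mul, mul_one]
      _ = _ := by rw [← mul_assoc, h3, one_mul]
  · have h2 : HasDerivAt R' (R' t * crossL w) t := by
      have h3 := (hR t ht).mul_const (crossL w)
      exact h3.congr_of_eventuallyEq
        (by filter_upwards [hI.mem_nhds ht] with r hr using hR'w r hr)
    rw [(hR' t ht).unique h2, hR'w t ht, mul_assoc]

namespace ConfigSpace

variable {S : Body} {Q : Type*} [NormedAddCommGroup Q] [NormedSpace ℝ Q] (C : ConfigSpace S Q)

section Action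

variable [CompleteSpace Q]

lemma defGrad_act_rotation (R : Rotation) (ζ : Q) : ∀ x ∈ closure S.B,
    C.defGrad (C.act R.clm ζ) x = R.clm * C.defGrad ζ x := fun _ hx => C.defGrad_act R.clm ζ hx

lemma image_act (R : Rotation) (ζ : Q) : C.ev (C.act R.clm ζ) '' S.B = R.1 '' (C.ev ζ '' S.B) := by
  rw [image_image]
  exact image_congr fun x hx => C.ev_act R.clm ζ (subset_closure hx)

lemma infDist_act (R : Rotation) (ζ : Q) :
    Metric.infDist 0 (C.ev (C.act R.clm ζ) '' S.B) = Metric.infDist 0 (C.ev ζ '' S.B) := by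
  have h := Metric.infDist_image R.1.isometry (x := 0) (t := C.ev ζ '' S.B)
  rw [map_zero] at h
  rw [image_act, h]

variable {C}

lemma IsRegular.act {z : Q × Q} (hz : C.IsRegular z) (R : Rotation) :
    C.IsRegular (C.actState R.clm z) :=
  ⟨by rw [actState_fst, C.infDist_act]; exact hz.1,
    C.det_pos_of_rotation hz.2 (C.defGrad_act_rotation R z.1)⟩

lemma Balanced.act {w : E3} {z : Q × Q} (hz : C.Balanced w z) (R : Rotation) :
    C.Balanced (R.1 w) (C.actState R.clm z) where
  regular := hz.regular.act R
  velocity := fun x hx => by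
    have hxc := subset_closure hx
    rw [actState_snd, actState_fst, C.ev_act _ _ hxc, C.ev_act _ _ hxc, hz.velocity x hx,
      R.clm_apply, R.map_cross, R.clm_apply]
  force := fun x hx => by
    have hxc := subset_closure hx
    have h1 := C.selfField_rotation (ζ := z.1) (ζ' := C.act R.clm z.1) (R := R) (c := 0)
      (fun x hx => by rw [C.ev_act _ _ (subset_closure hx), add_zero]) (C.ev z.1 x)
    rw [add_zero] at h1
    rw [actState_fst, C.ev_act _ _ hxc, h1, planetField_rotation,
      C.elasticForce_rotation hz.regular.2 (C.defGrad_act_rotation R z.1) hx]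
    have h2 := congrArg R.clm (hz.force x hx)
    simp only [map_add, map_sub, map_neg, map_smul] at h2
    rw [← h2]
    simp only [R.clm_apply, R.map_cross]
  boundary := C.stressFree_rotation hz.regular.2 (C.defGrad_act_rotation R z.1) hz.boundary

lemma angMom_act (R : Rotation) (z : Q × Q) :
    C.angMom (C.actState R.clm z) = R.1 (C.angMom z) := by
  have h1 := (R.1.toContinuousLinearEquiv).integral_comp_comm (μ := volume.restrict S.B)
    fun x => cross (C.ev z.1 x) (S.ρ x • C.ev z.2 x)
  rw [angMom, angMom]
  refine Eq.trans ?_ h1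
  refine setIntegral_congr_fun S.measurableSet fun x hx => ?_
  have hxc := subset_closure hx
  simp only [actState_fst, actState_snd]
  rw [C.ev_act _ _ hxc, C.ev_act _ _ hxc, cross_smul_right, R.clm_apply, R.clm_apply,
    ← R.map_cross, cross_smul_right]
  exact (map_smul R.1 _ _).symm

end Action

end ConfigSpace

end ElasticSatellite
end

noncomputable section

namespace ElasticSatellite

namespace ConfigSpace

variable {S : Body} {Q : Type*} [NormedAddCommGroup Q] [NormedSpace ℝ Q] {C : ConfigSpace S Q}

/-! ### Solutions without change of shape -/

section Solution

variable {G : Q → Q → E3 → E3} {T : EReal} {y : ℝ → Q × Q} {y₀ : Q × Q}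

lemma IsSolution.contDiffAt (hy : C.IsSolution G T y y₀) {t : ℝ} (ht : t ∈ times T) :
    ContDiffAt ℝ 2 y t := hy.smooth.contDiffAt ((isOpen_times T).mem_nhds ht)

lemma IsSolution.continuousAt (hy : C.IsSolution G T y y₀) {t : ℝ} (ht : t ∈ times T) :
    ContinuousAt y t := (hy.contDiffAt ht).continuousAt

lemma IsSolution.acceleration (hy : C.IsSolution G T y y₀) {t : ℝ} (ht : t ∈ times T) :
    HasDerivAt (fun s => (y s).2) (deriv (fun s => (y s).2) t) t :=
  (((hy.contDiffAt ht).snd).differentiableAt (by norm_num)).hasDerivAt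

lemma IsSolution.cauchyGreen_eq (hst : ∀ t ∈ times T, C.ShapeStationaryAt y t) {s t : ℝ}
    (hs : s ∈ times T) (ht : t ∈ times T) {x : E3} (hx : x ∈ S.B) :
    C.cauchyGreen (y t).1 x = C.cauchyGreen (y s).1 x :=
  (isOpen_times T).is_const_of_deriv_eq_zero (isPreconnected_times T)
    (fun r hr => (hst r hr x hx).differentiableAt.differentiableWithinAt)
    (fun r hr => (hst r hr x hx).deriv) ht hs

lemma clm_apply_deriv_eq_zero {E F : Type*} [NormedAddCommGroup E] [NormedSpace ℝ E]
    [NormedAddCommGroup F] [NormedSpace ℝ F] (A : E →L[ℝ] F) {I : Set ℝ} (hI : IsOpen I)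
    {f f' : ℝ → E} (hf : ∀ t ∈ I, HasDerivAt f (f' t) t) (h : ∀ t ∈ I, A (f t) = 0) :
    ∀ t ∈ I, A (f' t) = 0 := fun t ht => by
  have h1 : HasDerivAt (fun t => A (f t)) (A (f' t)) t := A.hasFDerivAt.comp_hasDerivAt t (hf t ht)
  have h2 : HasDerivAt (fun t => A (f t)) 0 t := (hasDerivAt_const t (0 : F)).congr_of_eventuallyEq
    (by filter_upwards [hI.mem_nhds ht] with r hr using h r hr)
  exact h1.unique h2

variable [CompleteSpace Q]

/-- A solution whose shape is stationary, and along which the nonconservative force vanishes,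
rotates uniformly about the planet. -/
theorem IsSolution.exists_uniformRotation (hy : C.IsSolution G T y y₀)
    (hst : ∀ t ∈ times T, C.ShapeStationaryAt y t)
    (hG : ∀ t ∈ times T, ∀ x ∈ S.B, G (y t).1 (y t).2 x = 0) :
    ∃ w, C.Balanced w y₀ ∧ ∀ t ∈ times T, y t = C.actState (expCross w t) y₀ := by
  obtain ⟨s, hs⟩ := exists_mem_times hy.pos
  obtain ⟨x₀, hx₀⟩ := S.nonempty
  have hx₀c := subset_closure hx₀
  have hI := isOpen_times T
  set ζ := (y s).1 with hζ
  have hreg := fun t ht => (hy.regular t ht).2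
  set e := (C.defGrad ζ x₀).toContinuousLinearEquivOfDetNeZero (hreg s hs x₀ hx₀c).ne' with he
  have he' : ∀ A : E3 →L[ℝ] E3, (A * C.defGrad ζ x₀) ∘L (e.symm : E3 →L[ℝ] E3) = A := fun A => by
    ext1 v
    obtain ⟨v, rfl⟩ := e.surjective v
    simp only [ContinuousLinearMap.comp_apply, ContinuousLinearEquiv.coe_coe,
      ContinuousLinearEquiv.symm_apply_apply]
    rfl
  -- Λ and Γ read the rotation and the translation off a configuration at the single point x₀,
  -- through continuous linear maps on Q. They therefore commute with time derivatives, and no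
  -- smoothness of the chosen rotations has to be proved.
  let Λ : Q →L[ℝ] (E3 →L[ℝ] E3) :=
    ((ContinuousLinearMap.compL ℝ E3 E3 E3).flip (e.symm : E3 →L[ℝ] E3)).comp (C.defGradL hx₀c)
  have hΛ : ∀ η, Λ η = C.defGrad η x₀ ∘L (e.symm : E3 →L[ℝ] E3) := fun η => rfl
  let Γ : Q →L[ℝ] E3 := C.evL hx₀c - (ContinuousLinearMap.apply ℝ E3 (C.ev ζ x₀)).comp Λ
  have hΓ : ∀ η, Γ η = C.ev η x₀ - Λ η (C.ev ζ x₀) := fun η => rfl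
  have hrig : ∀ t ∈ times T, ∃ R : Rotation, Λ (y t).1 = R.clm ∧
      ∀ x ∈ S.B, C.ev (y t).1 x = Λ (y t).1 (C.ev ζ x) + Γ (y t).1 := by
    intro t ht
    obtain ⟨R, c, hR⟩ := C.exists_rigid_of_cauchyGreen_eq (hreg s hs) (hreg t ht)
      fun x hx => IsSolution.cauchyGreen_eq hst hs ht hx
    have h1 : Λ (y t).1 = R.clm := by rw [hΛ, C.defGrad_eq_of_rigid hR hx₀c, he']
    refine ⟨R, h1, fun x hx => ?_⟩
    rw [hΓ, h1, hR x hx, hR x₀ hx₀, add_sub_cancel_left]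
  have hvel : ∀ t ∈ times T, HasDerivAt (fun r => (y r).1) (y t).2 t := hy.velocity
  set a : ℝ → Q := fun t => deriv (fun s => (y s).2) t with ha
  have hacc : ∀ t ∈ times T, HasDerivAt (fun r => (y r).2) (a t) t := fun t ht => hy.acceleration ht
  -- The defect from affine motion, linear in the configuration. It vanishes on positions, hence on
  -- velocities and accelerations too.
  let D : ∀ {x}, x ∈ S.B → Q →L[ℝ] E3 := fun {x} hx => C.evL (subset_closure hx) -
    (ContinuousLinearMap.apply ℝ E3 (C.ev ζ x)).comp Λ - Γ
  have hD : ∀ {x} (hx : x ∈ S.B) η, D hx η = C.ev η x - Λ η (C.ev ζ x) - Γ η := fun hx η => rfl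
  have hD0 : ∀ t ∈ times T, ∀ x (hx : x ∈ S.B), D hx (y t).1 = 0 := fun t ht x hx => by
    obtain ⟨R, -, h⟩ := hrig t ht
    rw [hD hx, h x hx]; abel
  have hD1 : ∀ t ∈ times T, ∀ x (hx : x ∈ S.B), D hx (y t).2 = 0 := fun t ht x hx =>
    clm_apply_deriv_eq_zero (D hx) hI hvel (fun t ht => hD0 t ht x hx) t ht
  have hD2 : ∀ t ∈ times T, ∀ x ∈ S.B, C.ev (a t) x = Λ (a t) (C.ev ζ x) + Γ (a t) := by
    intro t ht x hx
    have h := clm_apply_deriv_eq_zero (D hx) hI hacc (fun t ht => hD1 t ht x hx) t ht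
    rw [hD hx, sub_sub] at h
    exact sub_eq_zero.1 h
  have hmot : ∀ t ∈ times T, ∀ x ∈ S.B, S.ρ x • C.ev (a t) x =
      -(S.ρ x • S.planetField (C.ev (y t).1 x)) - S.ρ x • C.selfField (y t).1 (C.ev (y t).1 x)
      + C.elasticForce (y t).1 x := by
    intro t ht x hx
    have h := hy.motion t ht x hx
    rwa [hG t ht x hx, sub_zero, C.gradient_selfPotential (hreg t ht),
      gradient_planetPotential ((hy.regular t ht).ev_ne_zero (subset_closure hx))] at h
  obtain ⟨O, hO, hOne, hOsub⟩ := C.exists_isOpen_subset_image (hreg s hs)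
  have hkey : ∀ t ∈ times T, Γ (y t).1 = 0 ∧ Λ (a t) = Λ (y t).1 * Λ (a s) := by
    intro t ht
    -- The equation at time t is compared with the rotated equation at the reference time s. Elastic
    -- and self-gravitational forces cancel, ρ > 0 is divided out, and only affine terms and the
    -- planet's field remain.
    obtain ⟨R, hR, hev⟩ := hrig t ht
    rw [hR] at hev
    set c := Γ (y t).1 with hc
    set d := R.1.symm c with hd
    have hcd : c = R.1 d := by rw [hd, R.1.apply_symm_apply]
    have h1 : ∀ x ∈ S.B, Λ (a t) (C.ev ζ x) + Γ (a t) + S.planetField (R.clm (C.ev ζ x) + c) =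
        R.clm (Λ (a s) (C.ev ζ x) + Γ (a s) + S.planetField (C.ev ζ x)) := by
      intro x hx
      have e1 := hmot t ht x hx
      have e2 := congrArg R.clm (hmot s hs x hx)
      rw [hD2 t ht x hx, hev x hx, C.selfField_rotation hev, C.elasticForce_rotation (hreg s hs)
        (fun x hx => C.defGrad_eq_of_rigid hev hx) hx] at e1
      rw [hD2 s hs x hx] at e2
      simp only [map_add, map_sub, map_neg, map_smul] at e2
      have e3 : S.ρ x • (Λ (a t) (C.ev ζ x) + Γ (a t) + S.planetField (R.clm (C.ev ζ x) + c)) =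
          S.ρ x • R.clm (Λ (a s) (C.ev ζ x) + Γ (a s) + S.planetField (C.ev ζ x)) := by
        rw [smul_add, e1]
        simp only [map_add, smul_add] at e2 ⊢
        rw [e2]
        abel
      exact smul_right_injective E3 (S.ρ_pos x hx).ne' e3
    have hsymm : ∀ v, R.1.symm (R.clm v) = v := fun v => R.1.symm_apply_apply v
    set Rs : E3 →L[ℝ] E3 := (R.1.symm.toContinuousLinearEquiv : E3 →L[ℝ] E3) with hRs
    have hRsv : ∀ v, Rs (R.clm v) = v := hsymm
    have haff : ∀ X ∈ O, S.planetField (X + d) - S.planetField X =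
        (Λ (a s) - Rs * Λ (a t)) X + (Γ (a s) - Rs (Γ (a t))) := by
      intro X hX
      obtain ⟨x, hx, rfl⟩ := hOsub hX
      have e1 := congrArg Rs (h1 x hx)
      rw [hRsv, hcd, ← R.clm_apply, ← map_add, planetField_rotation, map_add, hRsv, map_add] at e1
      rw [sub_eq_iff_eq_add]
      change _ = Λ (a s) (C.ev ζ x) - Rs (Λ (a t) (C.ev ζ x)) + (Γ (a s) - Rs (Γ (a t))) +
        S.planetField (C.ev ζ x)
      rw [eq_sub_of_add_eq' e1]
      abel
    have hd0 : d = 0 := by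
      refine eq_zero_of_planetField_sub_affine S hO hOne haff fun X hX h0 => ?_
      obtain ⟨x, hx, rfl⟩ := hOsub hX
      refine (hy.regular t ht).ev_ne_zero (subset_closure hx) ?_
      rw [hev x hx, hcd, ← R.clm_apply, ← map_add, h0, map_zero]
    refine ⟨by rw [hcd, hd0, map_zero], ?_⟩
    have hL : Λ (a s) - Rs * Λ (a t) = 0 := by
      refine clm_eq_zero_of_isOpen hO hOne (b := -(Γ (a s) - Rs (Γ (a t)))) fun X hX => ?_
      have := haff X hX
      rw [hd0, add_zero, sub_self] at this
      exact eq_neg_of_add_eq_zero_left this.symm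
    rw [hR, sub_eq_zero.1 hL]
    ext1 v
    exact (R.1.apply_symm_apply (Λ (a t) v)).symm
  have hΓ1 := clm_apply_deriv_eq_zero Γ hI hvel fun t ht => (hkey t ht).1
  have hΓ2 := clm_apply_deriv_eq_zero Γ hI hacc hΓ1
  have hΛs : Λ (y s).1 = 1 := by
    have := he' 1
    rwa [one_mul] at this
  obtain ⟨w, hw⟩ := exists_eq_expCross hI (isPreconnected_times T) hs
    (R := fun t => Λ (y t).1) (R' := fun t => Λ (y t).2) (R'' := fun t => Λ (a t)) (N := Λ (a s))
    (fun t ht => Λ.hasFDerivAt.comp_hasDerivAt t (hvel t ht))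
    (fun t ht => Λ.hasFDerivAt.comp_hasDerivAt t (hacc t ht))
    (fun t ht p q => by
      obtain ⟨R, hR, -⟩ := hrig t ht
      rw [hR]; exact R.inner_map p q) hΛs (fun t ht => (hkey t ht).2)
  have hpos : ∀ t ∈ times T, (y t).1 = C.act (Λ (y t).1) ζ := fun t ht =>
    C.eq_of_ev_eq fun x hx => by
      rw [C.ev_act _ _ (subset_closure hx)]
      obtain ⟨R, -, h⟩ := hrig t ht
      rw [h x hx, (hkey t ht).1, add_zero]
  have hvel2 : ∀ t ∈ times T, (y t).2 = C.act (Λ (y t).2) ζ := fun t ht =>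
    C.eq_of_ev_eq fun x hx => by
      rw [C.ev_act _ _ (subset_closure hx)]
      have h := hD1 t ht x hx
      rw [hD hx, hΓ1 t ht, sub_zero] at h
      exact sub_eq_zero.1 h
  have hvs : Λ (y s).2 = crossL w := by rw [(hw s hs).2.1, hΛs, one_mul]
  have hstate : ∀ t ∈ times T, y t = C.actState (expCross w (t - s)) (y s) := by
    intro t ht
    refine Prod.ext ?_ ?_
    · rw [actState_fst, hpos t ht, (hw t ht).1]
    · rw [actState_snd, hvel2 t ht, hvel2 s hs, hvs, (hw t ht).2.1, (hw t ht).1, C.act_mul]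
  have hbal : C.Balanced w (y s) :=
    { regular := hy.regular s hs
      velocity := fun x hx => by
        rw [hvel2 s hs, C.ev_act _ _ (subset_closure hx), hvs, crossL_apply]
      force := fun x hx => by
        rw [← hmot s hs x hx, hD2 s hs x hx, hΓ2 s hs, add_zero, (hw s hs).2.2, hΛs, one_mul]
        rfl
      boundary := hy.boundary s hs }
  -- The datum is only the limit of y at 0⁺, so it is found by rotating the state at s back by -s.
  -- This makes the datum itself regular and balanced.
  have hlim : y₀ = C.actState (expCross w (-s)) (y s) := by
    refine tendsto_nhds_unique hy.initial ?_
    have hcont : Continuous fun t => C.actState (expCross w (t - s)) (y s) := by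
      have h1 : Continuous (expCross w) := (contDiff_expCross w (n := 0)).continuous
      have h2 : Continuous fun t => C.orbitStateL (y s) (expCross w (t - s)) :=
        (C.orbitStateL (y s)).continuous.comp (h1.comp (continuous_id.sub continuous_const))
      exact h2
    have h1 := (hcont.tendsto 0).mono_left (nhdsWithin_le_nhds (s := Ioi 0))
    rw [zero_sub] at h1
    refine h1.congr' ?_
    filter_upwards [times_mem_nhdsGT hy.pos] with t ht using (hstate t ht).symm
  refine ⟨w, ?_, fun t ht => ?_⟩
  · have h1 := hbal.act (rotExp w (-s))
    rwa [rotExp_apply, expCross_apply_self, clm_rotExp, ← hlim] at h1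
  · rw [hstate t ht, hlim, ← C.actState_mul, ← expCross_add, sub_eq_add_neg]

end Solution

end ConfigSpace

end ElasticSatellite
end

noncomputable section

namespace ElasticSatellite

/-! ### Limit sets -/

section LimitSet

variable {Y : Type*} [TopologicalSpace Y]

lemma omegaLimitSet_eq [FirstCountableTopology Y] (y : ℝ → Y) :
    omegaLimitSet y = {z | MapClusterPt z atTop y} := by
  ext z
  constructor
  · rintro ⟨τ, hτ, hz⟩
    exact hz.mapClusterPt.of_comp hτ
  · intro h
    have h1 : (comap y (𝓝 z) ⊓ atTop).NeBot := by
      refine inf_neBot_iff.2 fun {s} hs {t} ht => ?_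
      obtain ⟨v, hv, hvs⟩ := mem_comap.1 hs
      obtain ⟨a, hav, hat⟩ := ((mapClusterPt_iff_frequently.1 h v hv).and_eventually ht).exists
      exact ⟨a, hvs hav, hat⟩
    obtain ⟨τ, hτ⟩ := exists_seq_tendsto (comap y (𝓝 z) ⊓ atTop)
    rw [tendsto_inf, tendsto_comap_iff] at hτ
    exact ⟨τ, hτ.2, hτ.1⟩

lemma isClosed_omegaLimitSet [FirstCountableTopology Y] (y : ℝ → Y) :
    IsClosed (omegaLimitSet y) := by
  rw [omegaLimitSet_eq]
  exact isClosed_setOfPred_clusterPt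

end LimitSet

namespace ConfigSpace

variable {S : Body} {Q : Type*} [NormedAddCommGroup Q] [NormedSpace ℝ Q] {C : ConfigSpace S Q}
  {G : Q → Q → E3 → E3} {T : EReal} {y : ℝ → Q × Q} {y₀ : Q × Q}

lemma IsSolution.shift (hy : C.IsSolution G T y y₀) {s : ℝ} (hs : s ∈ times T) {T' : EReal}
    (hT' : 0 < T') (h : ∀ t ∈ times T', t + s ∈ times T) :
    C.IsSolution G T' (fun t => y (t + s)) (y s) where
  pos := hT'
  smooth := hy.smooth.comp (contDiff_id.add contDiff_const).contDiffOn h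
  initial := by
    have h1 : Tendsto (fun t : ℝ => t + s) (𝓝[>] 0) (𝓝 s) := by
      have : Continuous fun t : ℝ => t + s := by fun_prop
      simpa using (this.tendsto 0).mono_left (nhdsWithin_le_nhds (s := Ioi 0))
    exact (hy.continuousAt hs).tendsto.comp h1
  regular := fun t ht => hy.regular _ (h t ht)
  velocity := fun t ht => (hy.velocity _ (h t ht)).comp_add_const t s
  motion := fun t ht x hx => by
    have h1 := hy.motion _ (h t ht) x hx
    rwa [← deriv_comp_add_const (f := fun s => (y s).2)] at h1
  boundary := fun t ht => hy.boundary _ (h t ht)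

lemma IsSolution.mem_admissibleData (hy : C.IsSolution G T y y₀) {t : ℝ} (ht : t ∈ times T) :
    y t ∈ C.admissibleData G :=
  ⟨hy.regular t ht, subset_closure ⟨T, y, y₀, hy, t, ht, rfl⟩⟩

lemma IsSolution.angMom_eq (hA : C.Assumptions G) (hy : C.IsSolution G T y y₀) {t : ℝ}
    (ht : t ∈ times T) : C.angMom (y t) = C.angMom y₀ := by
  refine tendsto_nhds_unique (f := fun s => C.angMom (y s)) (l := 𝓝[>] 0) ?_
    ((C.continuous_angMom.tendsto y₀).comp hy.initial)
  refine tendsto_const_nhds.congr' ?_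
  filter_upwards [times_mem_nhdsGT hy.pos] with s hs
  exact hA.angMom_conserved T y y₀ hy t ht s hs

lemma IsSolution.shapeStationary_of_energy_eq (hA : C.Assumptions G) (hy : C.IsSolution G T y y₀)
    {E : ℝ} (hE : ∀ t ∈ times T, C.energy (y t) = E) :
    ∀ t ∈ times T, C.ShapeStationaryAt y t := by
  intro t ht
  obtain ⟨d, hd, -, hiff⟩ := hA.dissipation T y y₀ hy t ht
  refine hiff.1 (hd.unique ?_)
  refine (hasDerivAt_const t E).congr_of_eventuallyEq ?_
  filter_upwards [(isOpen_times T).mem_nhds ht] with s hs using hE s hs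

/-- The image of the body contains an open set, on which the velocity field determines w. Angular
velocities found separately at different times of a rotation can thus be identified. -/
lemma Balanced.velocity_unique {w w' : E3} {z : Q × Q} (h : C.Balanced w z)
    (h' : C.Balanced w' z) : w = w' := by
  obtain ⟨O, hO, hne, hsub⟩ := C.exists_isOpen_subset_image h.regular.2
  have h1 : crossL w - crossL w' = 0 := by
    refine clm_eq_zero_of_isOpen hO hne (b := 0) fun X hX => ?_
    obtain ⟨x, hx, rfl⟩ := hsub hX
    change crossL w _ - crossL w' _ = 0
    rw [crossL_apply, crossL_apply, ← h.velocity x hx, ← h'.velocity x hx, sub_self]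
  exact crossL_injective (sub_eq_zero.1 h1)

/-- The hypothesis concerns increasing positive times, so a sequence tending to infinity is first
thinned out and its initial terms are discarded. -/
lemma Precompact.exists_subseq (hp : C.Precompact y) {τ : ℕ → ℝ} (hτ : Tendsto τ atTop atTop) :
    ∃ φ : ℕ → ℕ, StrictMono φ ∧ ∃ z, C.IsRegular z ∧
      Tendsto (fun n => y (τ (φ n))) atTop (𝓝 z) := by
  obtain ⟨ψ, hψ, hτψ⟩ := strictMono_subseq_of_tendsto_atTop hτ
  obtain ⟨N, hN⟩ := ((hτ.comp hψ.tendsto_atTop).eventually_gt_atTop 0).exists_forall_of_atTop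
  obtain ⟨φ, hφ, z, hz, hlim⟩ := hp (fun n => τ (ψ (n + N)))
    (fun a b hab => hτψ (by omega)) (fun n => hN _ (by omega))
  exact ⟨fun n => ψ (φ n + N), fun a b hab => hψ (by have := hφ hab; omega), z, hz, hlim⟩

section Limit

variable (hA : C.Assumptions G) (hy : C.IsSolution G ⊤ y y₀) (hp : C.Precompact y) {z : Q × Q}

include hp in
lemma Precompact.isRegular (hz : z ∈ omegaLimitSet y) : C.IsRegular z := by
  obtain ⟨τ, hτ, hlim⟩ := hz
  obtain ⟨φ, hφ, z', hz', hlim'⟩ := hp.exists_subseq hτ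
  rwa [tendsto_nhds_unique (hlim.comp hφ.tendsto_atTop) hlim']

include hy hp in
lemma Precompact.mem_admissibleData (hz : z ∈ omegaLimitSet y) : z ∈ C.admissibleData G := by
  refine ⟨hp.isRegular hz, ?_⟩
  obtain ⟨τ, hτ, hlim⟩ := hz
  refine mem_closure_of_tendsto hlim ?_
  filter_upwards [hτ.eventually_gt_atTop 0] with n hn
  exact ⟨⊤, y, y₀, hy, τ n, by simpa using hn, rfl⟩

include hA hy hp in
lemma Precompact.tendsto_energy (hz : z ∈ omegaLimitSet y) :
    Tendsto (fun t => C.energy (y t)) atTop (𝓝 (C.energy z)) := by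
  have hreg := hp.isRegular hz
  obtain ⟨τ, hτ, hlim⟩ := hz
  have hd : ∀ t ∈ Ioi (0 : ℝ), ∃ d : ℝ, HasDerivAt (fun s => C.energy (y s)) d t ∧ d ≤ 0 := by
    intro t ht
    obtain ⟨d, h1, h2, -⟩ := hA.dissipation ⊤ y y₀ hy t (by simpa using ht)
    exact ⟨d, h1, h2⟩
  have hanti : AntitoneOn (fun t => C.energy (y t)) (Ioi 0) := by
    refine antitoneOn_of_deriv_nonpos (convex_Ioi 0) (fun t ht => ?_) (fun t ht => ?_)
      fun t ht => ?_
    · obtain ⟨d, h1, -⟩ := hd t ht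
      exact h1.continuousAt.continuousWithinAt
    · rw [interior_Ioi] at ht
      obtain ⟨d, h1, -⟩ := hd t ht
      exact h1.differentiableAt.differentiableWithinAt
    · rw [interior_Ioi] at ht
      obtain ⟨d, h1, h2⟩ := hd t ht
      rwa [h1.deriv]
  -- Monotonicity is known at positive times only; freezing the time below 1 gives a function
  -- antitone on the whole line, whose convergence along one sequence implies convergence.
  have hanti' : Antitone fun t => C.energy (y (max t 1)) := fun a b hab =>
    hanti (mem_Ioi.2 (by positivity)) (mem_Ioi.2 (by positivity)) (max_le_max_right 1 hab)
  have hmax : ∀ᶠ t : ℝ in atTop, max t 1 = t := by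
    filter_upwards [eventually_ge_atTop 1] with t ht using max_eq_left ht
  have h1 : Tendsto (fun n => C.energy (y (max (τ n) 1))) atTop (𝓝 (C.energy z)) := by
    refine ((C.continuousAt_energy hreg).tendsto.comp hlim).congr' ?_
    filter_upwards [hτ.eventually hmax] with n hn
    simp [hn]
  refine ((tendsto_iff_tendsto_subseq_of_antitone hanti' hτ).2 h1).congr' ?_
  filter_upwards [hmax] with t ht
  rw [ht]

include hA hy in
lemma IsSolution.angMom_eq_of_mem_omegaLimitSet (hz : z ∈ omegaLimitSet y) :
    C.angMom z = C.angMom y₀ := by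
  obtain ⟨τ, hτ, hlim⟩ := hz
  refine tendsto_nhds_unique ((C.continuous_angMom.tendsto z).comp hlim) ?_
  refine tendsto_const_nhds.congr' ?_
  filter_upwards [hτ.eventually_gt_atTop 0] with n hn
  exact (hy.angMom_eq hA (by simpa using hn)).symm

variable [CompleteSpace Q]

lemma Balanced.rotate {w : E3} (hz : C.Balanced w z) (t : ℝ) :
    C.Balanced w (C.actState (expCross w t) z) := by
  have h := hz.act (rotExp w t)
  rwa [rotExp_apply, expCross_apply_self, clm_rotExp] at h

lemma continuous_rotate (w : E3) (z : Q × Q) : Continuous fun t => C.actState (expCross w t) z :=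
  (C.orbitStateL z).continuous.comp (contDiff_expCross w (n := 0)).continuous

include hA hy hp

/-- LaSalle's step: the solution from a limit state stays in the limit set for a short time, so its
energy is constant there, its shape is stationary, and it is a uniform rotation. -/
lemma Precompact.exists_local (hz : z ∈ omegaLimitSet y) : ∃ w, C.Balanced w z ∧ ∃ r : ℝ, 0 < r ∧
    (∀ t ∈ times r, C.actState (expCross w t) z ∈ omegaLimitSet y) ∧
    ∀ (T' : EReal) (u : ℝ → Q × Q), C.IsSolution G T' u z →
      ∀ t ∈ times r ∩ times T', u t = C.actState (expCross w t) z := by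
  have hadm := hp.mem_admissibleData hy hz
  obtain ⟨r, hr, φ, hev, hcont⟩ := hA.wellPosed z hadm
  obtain ⟨hsol, huniq⟩ := hev.self_of_nhdsWithin hadm
  -- y shifted by τ n solves the problem with datum y (τ n), so by uniqueness y (t + τ n) = φ (y (τ
  -- n)) t; continuous dependence within admissible data passes to the limit.
  have hmem : ∀ t ∈ times r, φ z t ∈ omegaLimitSet y := by
    intro t ht
    obtain ⟨τ, hτ, hlim⟩ := hz
    have hpos : ∀ᶠ n in atTop, τ n ∈ times ⊤ := by
      filter_upwards [hτ.eventually_gt_atTop 0] with n hn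
      simpa using hn
    have hlim' : Tendsto (fun n => y (τ n)) atTop (𝓝[C.admissibleData G] z) :=
      tendsto_nhdsWithin_iff.2 ⟨hlim, hpos.mono fun n hn => hy.mem_admissibleData hn⟩
    refine ⟨fun n => t + τ n, tendsto_atTop_add_const_left _ t hτ, ?_⟩
    refine ((hcont t ht).tendsto.comp hlim').congr' ?_
    filter_upwards [hpos, hlim'.eventually hev] with n hn hn'
    have hshift := hy.shift hn (T' := ⊤) (by simp) fun s hs => by
      rw [times_top] at hs hn ⊢
      exact add_pos (mem_Ioi.1 hs) (mem_Ioi.1 hn)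
    exact (hn'.2 ⊤ _ hshift ⟨ht, by simpa using ht.1⟩).symm
  have hst := hsol.shapeStationary_of_energy_eq hA (E := C.energy z) fun t ht =>
    tendsto_nhds_unique (hp.tendsto_energy hA hy (hmem t ht)) (hp.tendsto_energy hA hy hz)
  obtain ⟨w, hw, hrot⟩ := hsol.exists_uniformRotation hst fun t ht =>
    hA.conservative _ _ _ hsol t ht (hst t ht)
  refine ⟨w, hw, r, hr, fun t ht => hrot t ht ▸ hmem t ht, fun T' u hu t ht => ?_⟩
  rw [huniq T' u hu ht, hrot t ht.1]

/-- Continuation in time: the good times form a closed set, and the local result restarted at a good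
time extends them to the right. The length of the local interval may vary with the state. -/
lemma Precompact.rotate_mem (hz : z ∈ omegaLimitSet y) {w : E3} (hw : C.Balanced w z) {b : ℝ}
    (hb : 0 ≤ b) : C.actState (expCross w b) z ∈ omegaLimitSet y := by
  have hcl : IsClosed {t | C.actState (expCross w t) z ∈ omegaLimitSet y} :=
    (isClosed_omegaLimitSet y).preimage (continuous_rotate w z)
  refine (hcl.inter isClosed_Icc).Icc_subset_of_forall_exists_gt (by simpa using hz) ?_
    (right_mem_Icc.2 hb)
  rintro x ⟨hx, -⟩ c hc
  obtain ⟨w', hw', r, hr, hmem, -⟩ := hp.exists_local hA hy hx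
  rw [hw'.velocity_unique (hw.rotate x)] at hmem
  rw [mem_Ioi] at hc
  have hpos : 0 < min (r / 2) (c - x) := lt_min (by linarith) (by linarith)
  refine ⟨min (r / 2) (c - x) + x, ?_, by linarith, by linarith [min_le_right (r / 2) (c - x)]⟩
  rw [mem_ofPred_eq, expCross_add, C.actState_mul]
  refine hmem _ ?_
  rw [times_coe]
  exact ⟨hpos, (min_le_left _ _).trans_lt (by linarith)⟩

/-- Well-posedness compares solutions on a short interval only. Restarting the comparison at each
rotated state, which is again a limit state, propagates the equality. -/
lemma Precompact.eq_rotate (hz : z ∈ omegaLimitSet y) {w : E3} (hw : C.Balanced w z) {T' : EReal}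
    {u : ℝ → Q × Q} (hu : C.IsSolution G T' u z) {b : ℝ} (hb : b ∈ times T') :
    u b = C.actState (expCross w b) z := by
  obtain ⟨w', hw', r, hr, -, hloc⟩ := hp.exists_local hA hy hz
  rw [hw'.velocity_unique hw] at hloc
  -- The continuation starts at a positive time, because a solution is constrained on (0, T) and the
  -- value u 0 is arbitrary.
  set a := min (r / 2) b with ha
  have ha0 : 0 < a := lt_min (by linarith) hb.1
  have hab : a ≤ b := min_le_right _ _
  have hin : Icc a b ⊆ times T' := fun t ht => mem_times_of_le hb (ha0.trans_le ht.1) ht.2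
  have hcl : IsClosed (Icc a b ∩ (fun t => u t - C.actState (expCross w t) z) ⁻¹' {0}) := by
    refine ContinuousOn.preimage_isClosed_of_isClosed (ContinuousOn.sub (fun t ht => ?_)
      (continuous_rotate w z).continuousOn) isClosed_Icc isClosed_singleton
    exact (hu.continuousAt (hin ht)).continuousWithinAt
  have hsub : Icc a b ⊆ {t | u t = C.actState (expCross w t) z} := by
    refine IsClosed.Icc_subset_of_forall_exists_gt ?_ ?_ ?_
    · convert hcl using 1
      ext t
      simp [sub_eq_zero, and_comm]
    · refine hloc T' u hu a ⟨?_, hin (left_mem_Icc.2 hab)⟩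
      rw [times_coe]
      exact ⟨ha0, (min_le_left _ _).trans_lt (by linarith)⟩
    · rintro x ⟨hx, hxa, hxb⟩ c hc
      rw [mem_Ioi] at hc
      have hx0 : 0 < x := ha0.trans_le hxa
      have hxT := hin ⟨hxa, hxb.le⟩
      have hxΩ := hp.rotate_mem hA hy hz hw hx0.le
      obtain ⟨w'', hw'', r', hr', -, hloc'⟩ := hp.exists_local hA hy hxΩ
      rw [hw''.velocity_unique (hw.rotate x)] at hloc'
      have hshift : C.IsSolution G ((b - x : ℝ) : EReal) (fun t => u (t + x)) (u x) :=
        hu.shift hxT (by exact_mod_cast sub_pos.2 hxb) fun t ht => by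
          rw [times_coe] at ht
          exact mem_times_of_le hb (add_pos ht.1 hx0) (by linarith [ht.2])
      rw [show u x = _ from hx] at hshift
      set d := min (r' / 2) (min (c - x) ((b - x) / 2)) with hd
      have hd0 : 0 < d := lt_min (by linarith) (lt_min (by linarith) (by linarith))
      have hd1 : d ≤ r' / 2 := min_le_left _ _
      have hd2 : d ≤ c - x := (min_le_right _ _).trans (min_le_left _ _)
      have hd3 : d ≤ (b - x) / 2 := (min_le_right _ _).trans (min_le_right _ _)
      refine ⟨d + x, ?_, by linarith, by linarith⟩
      rw [mem_ofPred_eq, expCross_add, C.actState_mul]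
      refine hloc' _ _ hshift d ⟨?_, ?_⟩
      · rw [times_coe]; exact ⟨hd0, by linarith⟩
      · rw [times_coe]; exact ⟨hd0, by linarith⟩
  exact hsub (right_mem_Icc.2 hab)

/-- G is not assumed continuous, so it must vanish at the rotated state itself, at an interior time
of some solution. Admissible data near the state at time t share a lifetime r; the solution from the
state at t - h, with h < r small, passes through the state at t with constant energy. -/
lemma Precompact.nonconservative_eq_zero (hz : z ∈ omegaLimitSet y) {w : E3}
    (hw : C.Balanced w z) {t : ℝ} (ht : 0 < t) {x : E3} (hx : x ∈ S.B) :
    G (C.actState (expCross w t) z).1 (C.actState (expCross w t) z).2 x = 0 := by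
  have hmem := fun {s : ℝ} (hs : 0 ≤ s) => hp.rotate_mem hA hy hz hw hs
  obtain ⟨r, hr, φ, hev, -⟩ := hA.wellPosed _ (hp.mem_admissibleData hy (hmem ht.le))
  have hlim : Tendsto (fun h => C.actState (expCross w (t - h)) z) (𝓝[>] 0)
      (𝓝[C.admissibleData G] (C.actState (expCross w t) z)) := by
    refine tendsto_nhdsWithin_iff.2 ⟨?_, ?_⟩
    · have h1 := (continuous_rotate (C := C) w z).comp (continuous_const.sub continuous_id :
        Continuous fun h : ℝ => t - h)
      have h2 := (h1.tendsto 0).mono_left (nhdsWithin_le_nhds (s := Ioi 0))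
      simp only [Function.comp_apply, Pi.sub_apply, sub_zero] at h2
      exact h2
    · filter_upwards [Ioo_mem_nhdsGT ht] with h hh
      exact hp.mem_admissibleData hy (hmem (by linarith [hh.2]))
  obtain ⟨h, hφ, hht, hhr⟩ := ((hlim.eventually hev).and
    (Filter.Eventually.and (Ioo_mem_nhdsGT ht : ∀ᶠ h in 𝓝[>] (0 : ℝ), h ∈ Ioo 0 t)
      (Ioo_mem_nhdsGT hr : ∀ᶠ h in 𝓝[>] (0 : ℝ), h ∈ Ioo 0 r))).exists
  have hz' := hmem (s := t - h) (by linarith [hht.2])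
  have hw' := hw.rotate (t - h)
  have heq := fun b hb => hp.eq_rotate hA hy hz' hw' hφ.1 (b := b) hb
  have hst := hφ.1.shapeStationary_of_energy_eq hA (E := C.energy z) fun b hb => by
    rw [heq b hb]
    exact tendsto_nhds_unique (hp.tendsto_energy hA hy (hp.rotate_mem hA hy hz' hw' hb.1.le))
      (hp.tendsto_energy hA hy hz)
  have hh : h ∈ times r := by rw [times_coe]; exact hhr
  have h0 := hA.conservative _ _ _ hφ.1 h hh (hst h hh) x hx
  rwa [heq h hh, ← C.actState_mul, ← expCross_add, add_sub_cancel] at h0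

lemma Precompact.isSolution_rotate (hz : z ∈ omegaLimitSet y) {w : E3} (hw : C.Balanced w z) :
    C.IsSolution G ⊤ (fun t => C.actState (expCross w t) z) z where
  pos := by simp
  smooth := ((C.orbitStateL z).contDiff.comp (contDiff_expCross w)).contDiffOn
  initial := by
    simpa using ((continuous_rotate (C := C) w z).tendsto 0).mono_left
      (nhdsWithin_le_nhds (s := Ioi 0))
  regular := fun t _ => (hw.rotate t).regular
  velocity := fun t _ => by
    have h1 := (C.orbitL z.1).hasFDerivAt.comp_hasDerivAt t (hasDerivAt_expCross' w t)
    refine h1.congr_deriv (C.eq_of_ev_eq fun x hx => ?_)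
    have hxc := subset_closure hx
    rw [C.orbitL_apply, C.ev_act _ _ hxc, actState_snd, C.ev_act _ _ hxc, hw.velocity x hx]
    rfl
  motion := fun t ht x hx => by
    have hxc := subset_closure hx
    have hb := hw.rotate t
    have h1 := (C.orbitL z.2).hasFDerivAt.comp_hasDerivAt t (hasDerivAt_expCross w t)
    have h2 : deriv (fun s => (C.actState (expCross w s) z).2) t =
      C.orbitL z.2 (crossL w * expCross w t) := h1.deriv
    rw [times_top, mem_Ioi] at ht
    rw [h2, hp.nonconservative_eq_zero hA hy hz hw ht hx, sub_zero,
      gradient_planetPotential (hb.regular.ev_ne_zero hxc),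
      C.gradient_selfPotential hb.regular.2, ← hb.force x hx, ← hb.velocity x hx, C.orbitL_apply,
      C.act_mul, C.ev_act _ _ hxc, actState_snd, crossL_apply]
  boundary := fun t _ => (hw.rotate t).boundary

lemma Precompact.isSynchronousOrbit (hz : z ∈ omegaLimitSet y) {w : E3} (hw : C.Balanced w z) :
    C.IsSynchronousOrbit G w (rotExp w) z := by
  have e : (fun t => C.rotState (rotExp w t) z) = fun t => C.actState (expCross w t) z := by
    ext1 t
    rw [C.rotState_eq, clm_rotExp]
  refine ⟨isUniformRotation_rotExp w, ?_, fun t x hx => ?_⟩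
  · rw [e]; exact hp.isSolution_rotate hA hy hz hw
  · refine (hasDerivAt_const t (C.cauchyGreen z.1 x)).congr_of_eventuallyEq
      (Eventually.of_forall fun s => ?_)
    ext1 h
    refine ext_inner_right ℝ fun k => ?_
    beta_reduce
    rw [inner_cauchyGreen, inner_cauchyGreen, C.rotState_eq, actState_fst,
      C.defGrad_act _ _ (subset_closure hx)]
    exact (rotExp w s).inner_map _ _

end Limit

end ConfigSpace

end ElasticSatellite
end

noncomputable section

namespace ElasticSatellite

/-! ### Rotations about an axis -/

lemma exists_rotation_mul (R R' : Rotation) : ∃ P : Rotation, P.clm = R.clm * R'.clm :=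
  exists_rotation (fun x y => by
    change inner ℝ (R.1 (R'.1 x)) (R.1 (R'.1 y)) = _
    rw [R.inner_map, R'.inner_map]) (by
    rw [det_mul_clm, R.det_clm, R'.det_clm]; norm_num)

lemma isCompact_isotropy (L : E3) :
    IsCompact {A : E3 →L[ℝ] E3 | ∃ R : Rotation, R.clm = A ∧ R.1 L = L} := by
  have hev : ∀ x : E3, Continuous fun A : E3 →L[ℝ] E3 => A x :=
    fun x => (ContinuousLinearMap.apply ℝ E3 x).continuous
  have hset : {A : E3 →L[ℝ] E3 | ∃ R : Rotation, R.clm = A ∧ R.1 L = L} =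
      (⋂ x, ⋂ y, {A : E3 →L[ℝ] E3 | inner ℝ (A x) (A y) = inner ℝ x y}) ∩
        ({A | A.det = 1} ∩ {A | A L = L}) := by
    ext A
    constructor
    · rintro ⟨R, rfl, hR⟩
      exact ⟨mem_iInter₂.2 fun x y => R.inner_map x y, R.det_clm, hR⟩
    · rintro ⟨h1, h2, h3⟩
      have h2' : A.det = 1 := h2
      obtain ⟨R, rfl⟩ := exists_rotation (fun x y => mem_iInter₂.1 h1 x y) (by rw [h2']; norm_num)
      exact ⟨R, rfl, h3⟩
  have hclosed : IsClosed {A : E3 →L[ℝ] E3 | ∃ R : Rotation, R.clm = A ∧ R.1 L = L} := by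
    rw [hset]
    refine IsClosed.inter (isClosed_iInter fun x => isClosed_iInter fun y => ?_)
      (IsClosed.inter (isClosed_eq ConfigSpace.continuous_det_clm continuous_const)
        (isClosed_eq (hev L) continuous_const))
    exact isClosed_eq ((hev x).inner (hev y)) continuous_const
  have hproper : ProperSpace (E3 →L[ℝ] E3) := FiniteDimensional.proper ℝ _
  refine Metric.isCompact_of_isClosed_isBounded hclosed ?_
  refine (Metric.isBounded_closedBall (x := (0 : E3 →L[ℝ] E3)) (r := 1)).subset ?_
  rintro _ ⟨R, rfl, -⟩
  rw [mem_closedBall_zero_iff]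
  refine ContinuousLinearMap.opNorm_le_bound _ zero_le_one fun x => ?_
  rw [R.clm_apply, R.1.norm_map, one_mul]

lemma exists_smul_of_cross_eq_zero {v w : E3} (hv : v ≠ 0) (h : cross v w = 0) :
    ∃ c : ℝ, w = c • v := by
  have h1 := cross_cross_self v w
  rw [h, cross_zero_right, eq_comm, sub_eq_zero] at h1
  have h2 : ‖v‖ ^ 2 ≠ 0 := pow_ne_zero _ (norm_ne_zero_iff.2 hv)
  refine ⟨(‖v‖ ^ 2)⁻¹ * inner ℝ v w, ?_⟩
  rw [mul_smul, h1, smul_smul, inv_mul_cancel₀ h2, one_smul]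

/-- A continuous function on the positive half-line is bounded if it is bounded near the ends. -/
lemma exists_bound_of_continuousOn_Ioi {f : ℝ → ℝ} (hf : ContinuousOn f (Ioi 0)) {a b : ℝ}
    (h0 : ∀ᶠ t in 𝓝[>] 0, f t ≤ a) (h1 : ∀ᶠ t in atTop, f t ≤ b) : ∃ c, ∀ t > 0, f t ≤ c := by
  obtain ⟨ε, hε, h0⟩ := mem_nhdsGT_iff_exists_Ioo_subset.1 h0
  obtain ⟨N, hN⟩ := h1.exists_forall_of_atTop
  obtain ⟨c, hc⟩ := (isCompact_Icc (a := ε) (b := N)).exists_bound_of_continuousOn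
    (hf.mono fun t ht => (mem_Ioi.1 hε).trans_le ht.1)
  refine ⟨max a (max b c), fun t ht => ?_⟩
  rcases lt_or_ge t ε with h | h
  · exact le_max_of_le_left (h0 ⟨ht, h⟩)
  rcases le_total N t with h' | h'
  · exact le_max_of_le_right (le_max_of_le_left (hN t h'))
  · exact le_max_of_le_right (le_max_of_le_right ((le_abs_self _).trans (hc t ⟨h, h'⟩)))

namespace ConfigSpace

variable {S : Body} {Q : Type*} [NormedAddCommGroup Q] [NormedSpace ℝ Q] [CompleteSpace Q]
  {C : ConfigSpace S Q} {G : Q → Q → E3 → E3} {y : ℝ → Q × Q} {y₀ z : Q × Q}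

/-! ### Isotropy orbits -/

variable (C z) in
lemma isCompact_isotropyOrbit : IsCompact (C.isotropyOrbit z) := by
  have h : C.isotropyOrbit z = C.orbitStateL z ''
      {A : E3 →L[ℝ] E3 | ∃ R : Rotation, R.clm = A ∧ R.1 (C.angMom z) = C.angMom z} := by
    ext z'
    constructor
    · rintro ⟨R, hR, rfl⟩
      exact ⟨R.clm, ⟨R, rfl, hR⟩, (C.rotState_eq R z).symm⟩
    · rintro ⟨_, ⟨R, rfl, hR⟩, rfl⟩
      exact ⟨R, hR, (C.rotState_eq R z).symm⟩
  rw [h]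
  exact (isCompact_isotropy _).image (C.orbitStateL z).continuous

variable (C z) in
lemma mem_isotropyOrbit_self : z ∈ C.isotropyOrbit z :=
  ⟨rotExp 0 0, by rw [rotExp_apply]; simp, by rw [C.rotState_eq, clm_rotExp]; simp⟩

lemma angMom_eq_of_mem_isotropyOrbit {z' : Q × Q} (h : z' ∈ C.isotropyOrbit z) :
    C.angMom z' = C.angMom z := by
  obtain ⟨R, hR, rfl⟩ := h
  rw [C.rotState_eq, angMom_act, hR]

lemma isotropyOrbit_subset {z' : Q × Q} (h : z' ∈ C.isotropyOrbit z) :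
    C.isotropyOrbit z' ⊆ C.isotropyOrbit z := by
  rintro _ ⟨R', hR', rfl⟩
  rw [angMom_eq_of_mem_isotropyOrbit h] at hR'
  obtain ⟨R, hR, rfl⟩ := h
  obtain ⟨P, hP⟩ := exists_rotation_mul R' R
  refine ⟨P, ?_, ?_⟩
  · have := congrArg (fun A : E3 →L[ℝ] E3 => A (C.angMom z)) hP
    simp only [mul_apply_eq_comp, R'.clm_apply, R.clm_apply, P.clm_apply] at this
    rw [this, hR, hR']
  · rw [C.rotState_eq, C.rotState_eq, C.rotState_eq, hP, C.actState_mul]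

/-! ### Asymptotics of precompact solutions -/

section Limit

variable (hA : C.Assumptions G) (hy : C.IsSolution G ⊤ y y₀) (hp : C.Precompact y)
  (hl : C.NondegenerateModulus ‖C.angMom y₀‖)
include hA hy hp hl

/-- Every point of the isotropy orbit is a relative equilibrium of the same angular momentum, so
nondegeneracy applies at each of them. Compactness of the orbit makes the isolating neighbourhoods
uniform. -/
lemma Precompact.exists_isolation (hz : z ∈ omegaLimitSet y) :
    ∃ ε > 0, ∀ z' ∈ omegaLimitSet y, Metric.infDist z' (C.isotropyOrbit z) < ε →
      z' ∈ C.isotropyOrbit z := by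
  obtain ⟨w, hw, -⟩ := hp.exists_local hA hy hz
  have hL := fun {z} hz => hy.angMom_eq_of_mem_omegaLimitSet hA (z := z) hz
  have hnhds : C.isotropyOrbit z ⊆
      interior {z' | z' ∈ omegaLimitSet y → z' ∈ C.isotropyOrbit z} := by
    intro o ho
    rw [mem_interior_iff_mem_nhds]
    have hLo := angMom_eq_of_mem_isotropyOrbit ho
    have hrel : C.IsRelEquilibrium o := by
      obtain ⟨R, -, rfl⟩ := ho
      rw [C.rotState_eq]
      exact (hw.act R).isRelEquilibrium
    filter_upwards [hl o hrel (by rw [hLo, hL hz])] with z' hz' hz'Ω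
    obtain ⟨w', hw', -⟩ := hp.exists_local hA hy hz'Ω
    exact isotropyOrbit_subset ho
      (hz' hw'.isRelEquilibrium (by rw [hLo, hL hz, hL hz'Ω]))
  obtain ⟨ε, hε, hsub⟩ :=
    (C.isCompact_isotropyOrbit z).exists_thickening_subset_open isOpen_interior hnhds
  refine ⟨ε, hε, fun z' hz' hd => interior_subset (hsub ?_) hz'⟩
  rwa [Metric.mem_thickening_iff_infDist_lt ⟨z, C.mem_isotropyOrbit_self z⟩]

/-- The distance to the orbit is small at arbitrarily late times. Were it also at least δ at
arbitrarily late times, the intermediate value theorem would make it equal δ at such times, and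
precompactness would give a limit state at distance exactly δ, inside the isolating neighbourhood
but off the orbit. -/
lemma Precompact.tendsto_infDist (hz : z ∈ omegaLimitSet y) :
    Tendsto (fun t => Metric.infDist (y t) (C.isotropyOrbit z)) atTop (𝓝 0) := by
  obtain ⟨ε, hε, hiso⟩ := hp.exists_isolation hA hy hl hz
  have hcont := Metric.continuous_infDist_pt (C.isotropyOrbit z)
  have key : ∀ δ, 0 < δ → δ < ε → ∀ᶠ t in atTop, Metric.infDist (y t) (C.isotropyOrbit z) < δ := by
    intro δ hδ hδε
    by_contra hnot
    rw [not_eventually] at hnot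
    have hlow : ∃ᶠ t in atTop, Metric.infDist (y t) (C.isotropyOrbit z) < δ := by
      obtain ⟨τ, hτ, hlim⟩ := hz
      refine hτ.frequently (Eventually.frequently ?_)
      have h1 := (hcont.tendsto z).comp hlim
      rw [Metric.infDist_zero_of_mem (C.mem_isotropyOrbit_self z)] at h1
      exact h1.eventually_lt_const hδ
    have heq : ∃ᶠ t in atTop, Metric.infDist (y t) (C.isotropyOrbit z) = δ := by
      rw [frequently_atTop] at hnot hlow ⊢
      intro N
      obtain ⟨a, ha, hya⟩ := hlow (max N 1)
      obtain ⟨b, hb, hyb⟩ := hnot (max N 1)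
      have hc : ContinuousOn (fun t => Metric.infDist (y t) (C.isotropyOrbit z))
          (Ici (max N 1)) := fun t ht => by
        have ht' : t ∈ times ⊤ := by
          rw [times_top]; exact lt_of_lt_of_le one_pos ((le_max_right N 1).trans ht)
        exact (hcont.continuousAt.comp (hy.continuousAt ht')).continuousWithinAt
      obtain ⟨t, ht, htδ⟩ := isPreconnected_Ici.intermediate_value ha hb hc
        ⟨hya.le, not_lt.1 hyb⟩
      exact ⟨t, (le_max_left N 1).trans ht, htδ⟩
    obtain ⟨τ, hτ, hτδ⟩ := exists_seq_forall_of_frequently heq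
    obtain ⟨φ, hφ, z', -, hlim⟩ := hp.exists_subseq hτ
    have hz' : z' ∈ omegaLimitSet y := ⟨fun n => τ (φ n), hτ.comp hφ.tendsto_atTop, hlim⟩
    have hd : Metric.infDist z' (C.isotropyOrbit z) = δ :=
      tendsto_nhds_unique ((hcont.tendsto z').comp hlim)
        (tendsto_const_nhds.congr fun n => (hτδ (φ n)).symm)
    have hmem := hiso z' hz' (by rwa [hd])
    rw [Metric.infDist_zero_of_mem hmem] at hd
    exact hδ.ne hd
  refine tendsto_order.2 ⟨fun a ha => Eventually.of_forall fun t =>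
    ha.trans_le Metric.infDist_nonneg, fun δ hδ => ?_⟩
  filter_upwards [key (min δ (ε / 2)) (lt_min hδ (by linarith))
    ((min_le_right _ _).trans_lt (by linarith))] with t ht
  exact ht.trans_le (min_le_left _ _)

lemma Precompact.omegaLimitSet_subset (hz : z ∈ omegaLimitSet y) :
    omegaLimitSet y ⊆ C.isotropyOrbit z := by
  rintro z' ⟨τ, hτ, hlim⟩
  rw [(C.isCompact_isotropyOrbit z).isClosed.mem_iff_infDist_zero
    ⟨z, C.mem_isotropyOrbit_self z⟩]
  exact tendsto_nhds_unique
    (((Metric.continuous_infDist_pt (C.isotropyOrbit z)).tendsto z').comp hlim)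
    ((hp.tendsto_infDist hA hy hl hz).comp hτ)

theorem Precompact.asymptoticToSynchronous : C.AsymptoticToSynchronous G y (C.angMom y₀) := by
  obtain ⟨φ, hφ, z, -, hlim⟩ := hp.exists_subseq tendsto_natCast_atTop_atTop
  have hz : z ∈ omegaLimitSet y :=
    ⟨fun n => (φ n : ℝ), tendsto_natCast_atTop_atTop.comp hφ.tendsto_atTop, hlim⟩
  obtain ⟨w, hw, -⟩ := hp.exists_local hA hy hz
  have hL := hy.angMom_eq_of_mem_omegaLimitSet hA hz
  have hsync := hp.isSynchronousOrbit hA hy hz hw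
  have hdist := hp.tendsto_infDist hA hy hl hz
  refine ⟨z, w, rotExp w, hw.isRelEquilibrium, hL, hsync, hdist, fun hL0 => ?_⟩
  rw [← hL] at hL0
  have hsol := hp.isSolution_rotate hA hy hz hw
  have hfix : ∀ t ∈ Ioi (0 : ℝ), expCross w t (C.angMom z) = C.angMom z := by
    intro t ht
    have h1 := hsol.angMom_eq hA (t := t) (by simpa using ht)
    rw [← clm_rotExp, angMom_act, rotExp_apply] at h1
    exact h1
  have hcross : cross w (C.angMom z) = 0 := by
    have h1 := hasDerivAt_expCross_apply w (C.angMom z) 1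
    rw [hfix 1 (by simp)] at h1
    refine h1.unique ((hasDerivAt_const (1 : ℝ) (C.angMom z)).congr_of_eventuallyEq ?_)
    filter_upwards [Ioi_mem_nhds (zero_lt_one (α := ℝ))] with t ht using hfix t ht
  -- With w = 0 the limit state would be at rest and have no angular momentum.
  have hw0 : w ≠ 0 := by
    rintro rfl
    refine hL0 ?_
    have h1 : ∀ x ∈ S.B, cross (C.ev z.1 x) (S.ρ x • C.ev z.2 x) = 0 := fun x hx => by
      rw [hw.velocity x hx, cross_zero_left, smul_zero, cross_zero_right]
    rw [angMom, setIntegral_congr_fun S.measurableSet h1]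
    simp
  obtain ⟨c, hc⟩ := exists_smul_of_cross_eq_zero hw0 hcross
  obtain ⟨c', hc'⟩ := exists_smul_of_cross_eq_zero hL0
    (w := w) (by rw [cross_anticomm, hcross, neg_zero])
  have hrot : ∀ s, C.rotState (rotExp w s) z = C.actState (expCross w s) z := fun s => by
    rw [C.rotState_eq, clm_rotExp]
  -- As w is parallel to L, rotations fixing L are rotations about w. Nonnegative parameters
  -- suffice, and they are the ones for which the rotated state is known to be a limit state.
  have horb : ∀ o ∈ C.isotropyOrbit z, ∃ s, 0 ≤ s ∧ C.rotState (rotExp w s) z = o := by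
    rintro _ ⟨R, hR, rfl⟩
    obtain ⟨s, hs, rfl⟩ := Rotation.exists_eq_rotExp hw0 (R := R) (by
      rw [hc', map_smul, hR])
    exact ⟨s, hs, rfl⟩
  have hrange : (range fun s => C.rotState (rotExp w s) z) = C.isotropyOrbit z := by
    refine Subset.antisymm ?_ fun o ho => ?_
    · rintro _ ⟨s, rfl⟩
      exact ⟨rotExp w s, by rw [rotExp_apply, hc, map_smul, expCross_apply_self], rfl⟩
    · obtain ⟨s, -, h⟩ := horb o ho
      exact ⟨s, h⟩
  rw [hrange]
  refine ⟨hdist, Subset.antisymm (hp.omegaLimitSet_subset hA hy hl hz) fun o ho => ?_⟩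
  obtain ⟨s, hs, rfl⟩ := horb o ho
  rw [hrot]
  exact hp.rotate_mem hA hy hz hw hs

end Limit

/-! ### Solutions that approach a compact orbit -/

lemma infDist_image_le (C : ConfigSpace S Q) {κ : ℝ}
    (hκ : ∀ ζ : Q, ∀ x ∈ closure S.B, ‖C.ev ζ x‖ ≤ κ * ‖ζ‖) (ζ ζ' : Q) :
    Metric.infDist 0 (C.ev ζ '' S.B) ≤ Metric.infDist 0 (C.ev ζ' '' S.B) + κ * dist ζ ζ' := by
  refine le_of_forall_pos_le_add fun η hη => ?_
  obtain ⟨_, ⟨x, hx, rfl⟩, hlt⟩ := (Metric.infDist_lt_iff (x := (0 : E3))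
    (S.nonempty.image (C.ev ζ'))).1 (lt_add_of_pos_right (Metric.infDist 0 (C.ev ζ' '' S.B)) hη)
  have h1 := Metric.infDist_le_dist_of_mem (x := (0 : E3)) (mem_image_of_mem (C.ev ζ) hx)
  have h2 := hκ (ζ - ζ') x (subset_closure hx)
  rw [map_sub, Pi.sub_apply, ← dist_eq_norm, ← dist_eq_norm] at h2
  have h3 := dist_triangle_right (0 : E3) (C.ev ζ x) (C.ev ζ' x)
  have h4 := dist_triangle (0 : E3) (C.ev ζ' x) (C.ev ζ x)
  rw [dist_comm (C.ev ζ' x)] at h4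
  linarith

lemma continuous_infDist_image (C : ConfigSpace S Q) :
    Continuous fun ζ : Q => Metric.infDist 0 (C.ev ζ '' S.B) := by
  obtain ⟨κ, hκ, hbound⟩ := C.exists_bound
  have h := fun ζ ζ' => C.infDist_image_le (fun ζ x hx => (hbound ζ x hx).1) ζ ζ'
  exact (LipschitzWith.of_le_add_mul' κ h).continuous

variable (hy : C.IsSolution G ⊤ y y₀)
  (hlim : Tendsto (fun t => Metric.infDist (y t) (C.isotropyOrbit z)) atTop (𝓝 0))
include hy hlim

lemma IsSolution.boundedTrajectory : C.BoundedTrajectory ⊤ y := by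
  obtain ⟨κ, hκ, hbound⟩ := C.exists_bound
  obtain ⟨b, hb⟩ := (C.isCompact_isotropyOrbit z).isBounded.exists_norm_le
  obtain ⟨c, hc⟩ := exists_bound_of_continuousOn_Ioi (f := fun t => ‖y t‖) (a := ‖y₀‖ + 1)
    (b := b + 1) (fun t ht => (hy.continuousAt (by simpa using ht)).norm.continuousWithinAt)
    ((hy.initial.norm.eventually_lt_const (lt_add_one ‖y₀‖)).mono fun t ht => ht.le) (by
      filter_upwards [hlim.eventually_lt_const one_pos] with t ht
      obtain ⟨o, ho, hd⟩ := (Metric.infDist_lt_iff ⟨z, C.mem_isotropyOrbit_self z⟩).1 ht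
      have h1 := norm_le_norm_add_norm_sub' (y t) o
      rw [← dist_eq_norm] at h1
      have h2 := hb o ho
      linarith)
  refine ⟨κ * c, fun t ht x hx => ?_⟩
  rw [times_top] at ht
  refine (hbound _ x (subset_closure hx)).1.trans (mul_le_mul_of_nonneg_left ?_ hκ.le)
  exact (norm_fst_le (y t)).trans (hc t ht)

/-- The distance to the planet is continuous and positive at positive times. It is bounded below
near 0 by regularity of the datum and at late times because every state of the isotropy orbit is as
far from the planet as z. -/
lemma IsSolution.not_impacts (hz : C.IsRegular z) (hy₀ : C.IsRegular y₀) : ¬ C.Impacts ⊤ y := by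
  set D : Q × Q → ℝ := fun z => Metric.infDist 0 (C.ev z.1 '' S.B) with hD
  have hDc : Continuous D := C.continuous_infDist_image.comp continuous_fst
  obtain ⟨κ, hκ, hbound⟩ := C.exists_bound
  have hDpos : ∀ t ∈ Ioi (0 : ℝ), 0 < D (y t) := fun t ht =>
    (hy.regular t (by simpa using ht)).1
  have hz0 : 0 < D z := hz.1
  have hy0 : 0 < D y₀ := hy₀.1
  -- A lower bound for the distance is an upper bound for its reciprocal; D z / (2κ) is the
  -- tolerance at which D varies by at most D z / 2.
  obtain ⟨c, hc⟩ := exists_bound_of_continuousOn_Ioi (f := fun t => (D (y t))⁻¹)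
    (a := (D y₀ / 2)⁻¹) (b := (D z / 2)⁻¹)
    (fun t ht => ((hDc.continuousAt.comp (hy.continuousAt (by simpa using ht))).inv₀
      (hDpos t ht).ne').continuousWithinAt) (by
      filter_upwards [((hDc.tendsto y₀).comp hy.initial).eventually_const_lt (half_lt_self hy0)]
        with t ht
      exact inv_anti₀ (by linarith) (le_of_lt ht)) (by
      have hδ : 0 < D z / (2 * κ) := by positivity
      filter_upwards [hlim.eventually_lt_const hδ] with t ht
      obtain ⟨o, ho, hd⟩ := (Metric.infDist_lt_iff ⟨z, C.mem_isotropyOrbit_self z⟩).1 ht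
      have h1 := C.infDist_image_le (fun ζ x hx => (hbound ζ x hx).1) o.1 (y t).1
      have h2 : Metric.infDist 0 (C.ev o.1 '' S.B) = D z := by
        obtain ⟨R, -, rfl⟩ := ho
        rw [C.rotState_eq, actState_fst, C.infDist_act]
      have h3 : κ * dist o.1 (y t).1 ≤ κ * (D z / (2 * κ)) := by
        refine mul_le_mul_of_nonneg_left ?_ hκ.le
        rw [dist_comm]
        exact (le_max_left _ _).trans hd.le
      have h4 : κ * (D z / (2 * κ)) = D z / 2 := by field_simp
      refine inv_anti₀ (by linarith) ?_
      rw [h2] at h1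
      change D z ≤ D (y t) + _ at h1
      linarith)
  intro himp
  have hc0 : 0 < c := (inv_pos.2 (hDpos 1 (by simp))).trans_le (hc 1 one_pos)
  obtain ⟨t, ht, hlt⟩ := himp c⁻¹ (inv_pos.2 hc0)
  rw [times_top] at ht
  have h1 := hc t ht
  rw [inv_le_comm₀ (hDpos t ht) hc0] at h1
  exact absurd hlt (not_lt.2 h1)

end ConfigSpace

end ElasticSatellite
end

/-! ### The alternative and the exclusions. -/

theorem mainTheorem1 (S : Body) {Q : Type*} [NormedAddCommGroup Q] [NormedSpace ℝ Q]
    [CompleteSpace Q] (C : ConfigSpace S Q) (G : Q → Q → E3 → E3) (hG : C.Assumptions G)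
    (T : EReal) (y : ℝ → Q × Q) (y₀ : Q × Q) (hy : C.IsMaximalSolution G T y y₀)
    (hl : C.NondegenerateModulus ‖C.angMom y₀‖) :
    (¬ C.BoundedTrajectory T y ∨ C.Impacts T y ∨
      (T = ⊤ ∧ C.AsymptoticToSynchronous G y (C.angMom y₀))) ∧
    (T = ⊤ ∧ C.AsymptoticToSynchronous G y (C.angMom y₀) →
      C.BoundedTrajectory T y ∧ (C.IsRegular y₀ → ¬ C.Impacts T y)) := by
  refine ⟨?_, ?_⟩
  · by_cases hb : C.BoundedTrajectory T y
    · by_cases hi : C.Impacts T y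
      · exact Or.inr (Or.inl hi)
      · obtain rfl := hG.global T y y₀ hy hi
        exact Or.inr (Or.inr ⟨rfl,
          (hG.precompact y y₀ hy.1 hi hb).asymptoticToSynchronous hG hy.1 hl⟩)
    · exact Or.inl hb
  · rintro ⟨rfl, z, w, R, hz, -, -, hlim, -⟩
    exact ⟨hy.1.boundedTrajectory hlim, hy.1.not_impacts hlim hz.1⟩
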